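/- **Theorem (Evaluation and Generation).** *Setting.* Let $G$ be an acyclic directed mixed graph (ADMG) on $n\ge 1$ observable variables $\mathbf V$, with directed edges (forming an acyclic graph) and bidirected edges (between distinct variables). A *causal Bayes net* $\mathcal P$ on $G$ over a finite alphabet $\Sigma$ has finitely many independent hidden variables $\mathbf U$, each without parents and affecting exactly two observable variables, such that two observables are joined by a bidirected edge if and only if some hidden variable affects both, and, for each $V\in\mathbf V$, a conditional distribution of $V\in\Sigma$ given its observable parents $\mathrm{Pa}(V)$ in $G$ and the hidden variables affecting it. Its *observational distribution* is $P(\mathbf v)=\mathbb E_{\mathbf U}\big[\prod_{V\in\mathbf V}\Pr(v\mid \mathrm{pa}(V),\mathbf U)\big]$. For $X\in\mathbf V$ and $x\in\Sigma$, the *interventional distribution* $P_x$ on assignments $\mathbf w$ to $\mathbf V\setminus\{X\}$ is $P_x(\mathbf w)=\mathbb E_{\mathbf U}\big[\prod_{V\ne X}\Pr(v\mid \mathrm{pa}(V),\mathbf U)\big]$, where $X$ is set to $x$ in all factors. A *c-component* is a connected component of the graph of bidirected edges. Let $d$ be the maximum number of directed edges coming into a node, $k$ the size of the largest c-component, and $\mathbf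 S_1$ the c-component of $X$. *Assumptions.* (Identifiability with respect to $X$) No child of $X$ lies in $\mathbf S_1$. ($\alpha$-strong positivity with respect to $X$, $\alpha>0$) With $\mathbf Z=\mathbf S_1\cup\bigcup_{V\in\mathbf S_1}\mathrm{Pa}(V)$, $P(\mathbf Z=\mathbf z)>\alpha$ for every assignment $\mathbf z$ to $\mathbf Z$. *Conclusion.* There are a randomized learning algorithm, an evaluation algorithm and a generation algorithm (on a real RAM: unit-cost arithmetic and comparisons on natural and real numbers, indirect addressing, uniform random numbers in $[0,1]$), and absolute constants $C,c$, such that the following holds for all $n$, $\Sigma$, $G$, $X$, $\mathcal P$, $\alpha$ as above, all $x\in\Sigma$ and all $\epsilon,\delta\in(0,1)$. Put $$M=\frac{|\Sigma|^{2kd}\,n}{\alpha^k\epsilon^2},\qquad T=\frac{|\Sigma|^{4kd}\,n^2}{\alpha^k\epsilon^2}.$$ Given $G,|\Sigma|,X,x,\alpha,\epsilon,\delta$ and access to independent samples from $P$, the learning algorithm uses at most $C\,M\log^c(2+M)\,(1+\log\tfrac1\delta)$ samples and at most $C\,T\log^c(2+T)\,(1+\log\tfrac1\delta)^3$ steps and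 outputs a representation of a probability distribution $\hat P$ on assignments to $\mathbf V\setminus\{X\}$; with probability at least $1-\delta$, $d_{\mathrm{TV}}(P_x,\hat P)\le\epsilon$. Moreover, from this representation: - *Evaluation:* given an assignment $\mathbf w$ to $\mathbf V\setminus\{X\}$, the evaluation algorithm computes $\hat P(\mathbf w)$ in at most $C\,n|\Sigma|(kd+k)$ steps; - *Generation:* using fresh random numbers, the generation algorithm outputs a sample distributed exactly according to $\hat P$ in at most $C\,n|\Sigma|(kd+k)$ steps. -/

import Mathlib

open MeasureTheory
open scoped ENNReal

universe u

/-! ### Graphs -/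

/-- An acyclic directed mixed graph on the observable variables `0, …, n - 1`:
`dir i j` is the directed edge `i → j`, `bi.Adj i j` the bidirected edge `i ↔ j`. -/
structure ADMG (n : ℕ) where
  dir : Fin n → Fin n → Prop
  bi : SimpleGraph (Fin n)
  acyclic : ∀ i, ¬ Relation.TransGen dir i i

namespace ADMG

variable {n : ℕ}

/-- The observable parents of `i`. -/
def parents (G : ADMG n) (i : Fin n) : Set (Fin n) := {j | G.dir j i}

/-- The c-component of `i`. -/
def cComp (G : ADMG n) (i : Fin n) : Set (Fin n) := {j | G.bi.Reachable i j}

/-- A set of variables together with all their observable parents. -/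
def paPlus (G : ADMG n) (S : Set (Fin n)) : Set (Fin n) := S ∪ ⋃ i ∈ S, G.parents i

/-- The maximum in-degree (directed edges only). -/
noncomputable def inDegree (G : ADMG n) : ℕ :=
  Finset.univ.sup fun i => (G.parents i).ncard

/-- The size of the largest c-component. -/
noncomputable def maxCComp (G : ADMG n) : ℕ :=
  Finset.univ.sup fun i => (G.cComp i).ncard

/-- No child of `X` is joined to `X` by a path of bidirected edges. -/
def Identifiable (G : ADMG n) (X : Fin n) : Prop :=
  ∀ j, G.dir X j → j ∉ G.cComp X

end ADMG

/-- The assignment to all variables that is `x` at `X` and `w` elsewhere. -/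
def extendAssign {n q : ℕ} (X : Fin n) (x : Fin q) (w : {i : Fin n // i ≠ X} → Fin q) :
    Fin n → Fin q :=
  fun i => if h : i = X then x else w ⟨i, h⟩

/-! ### Causal Bayes nets -/

/-- A semi-Markovian causal Bayes net over the alphabet `Fin q` whose graph projects to the
ADMG `G`.  There are finitely many hidden variables; the hidden variable `h` has no parents,
takes values in an arbitrary probability space and affects exactly the two observables in
`ends h`.  `cpd i` is the conditional distribution of the observable `i` given its observable
parents and the hidden variables that affect it. -/
structure CausalBayesNet {n : ℕ} (G : ADMG n) (q : ℕ) where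
  Hidden : Type
  [fintypeHidden : Fintype Hidden]
  ends : Hidden → Sym2 (Fin n)
  range_ends : Set.range ends = G.bi.edgeSet
  Val : Hidden → Type u
  [measurableVal : ∀ h, MeasurableSpace (Val h)]
  law : ∀ h, Measure (Val h)
  [probLaw : ∀ h, IsProbabilityMeasure (law h)]
  cpd : ∀ i : Fin n, (G.parents i → Fin q) → (∀ h : {h // i ∈ ends h}, Val h.1) → PMF (Fin q)
  measurable_cpd : ∀ i pa a, Measurable fun uu => cpd i pa uu a

namespace CausalBayesNet

attribute [instance] fintypeHidden measurableVal probLaw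

variable {n q : ℕ} {G : ADMG n}

/-- The conditional probability that the observable `i` takes its value under `v`, given the
values under `v` of its parents and the values `uu` of the hidden variables. -/
noncomputable def factor (P : CausalBayesNet.{u} G q) (i : Fin n) (v : Fin n → Fin q)
    (uu : ∀ h, P.Val h) : ℝ≥0∞ :=
  P.cpd i (fun j => v j.1) (fun h => uu h.1) (v i)

theorem measurable_factor (P : CausalBayesNet.{u} G q) (i : Fin n) (v : Fin n → Fin q) :
    Measurable (P.factor i v) :=
  (P.measurable_cpd i (fun j => v j.1) (v i)).comp
    (measurable_pi_lambda _ fun h => measurable_pi_apply h.1)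

open Classical in
theorem sum_prod_factor (P : CausalBayesNet.{u} G q) (uu : ∀ h, P.Val h) (v₀ : Fin n → Fin q)
    (A : Finset (Fin n)) :
    ∑ v : Fin n → Fin q with (∀ i, i ∉ A → v i = v₀ i), ∏ i ∈ A, P.factor i v uu = 1 := by
  induction hm : A.card generalizing A with
  | zero =>
    obtain rfl := Finset.card_eq_zero.mp hm
    have : (Finset.univ.filter fun v : Fin n → Fin q => ∀ i, i ∉ (∅ : Finset (Fin n)) →
        v i = v₀ i) = {v₀} := by
      ext v; simp [funext_iff]
    rw [this]; simp
  | succ m ih =>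
    have hne : A.Nonempty := by
      rw [← Finset.card_pos]; omega
    -- a variable of `A` without children in `A`
    obtain ⟨s, hsA, hs⟩ : ∃ s ∈ A, ∀ j ∈ A, ¬ G.dir s j := by
      have : IsTrans (Fin n) (fun a b => Relation.TransGen G.dir b a) :=
        ⟨fun a b c h1 h2 => h2.trans h1⟩
      have : Std.Irrefl (fun a b => Relation.TransGen G.dir b a) := ⟨fun a => G.acyclic a⟩
      have wf := Finite.wellFounded_of_trans_of_irrefl
        (fun a b : Fin n => Relation.TransGen G.dir b a)
      obtain ⟨s, hs, hmin⟩ := wf.has_min (A : Set (Fin n)) hne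
      exact ⟨s, hs, fun j hj h => hmin j hj (Relation.TransGen.single h)⟩
    have hcard : (A.erase s).card = m := by
      rw [Finset.card_erase_of_mem hsA]; omega
    rw [← ih (A.erase s) hcard]
    rw [← Finset.sum_fiberwise_of_maps_to
      (t := Finset.univ.filter fun v : Fin n → Fin q => ∀ i, i ∉ A.erase s → v i = v₀ i)
      (g := fun v => Function.update v s (v₀ s))]
    · refine Finset.sum_congr rfl fun w hw => ?_
      have hw' : ∀ i, i ∉ A.erase s → w i = v₀ i := by simpa using hw
      have himg : ((Finset.univ.filter fun v : Fin n → Fin q => ∀ i, i ∉ A → v i = v₀ i).filter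
          fun v => Function.update v s (v₀ s) = w) =
          Finset.univ.image fun a => Function.update w s a := by
        ext v
        simp only [Finset.mem_filter, Finset.mem_univ, true_and, Finset.mem_image]
        constructor
        · rintro ⟨h1, h2⟩
          refine ⟨v s, ?_⟩
          rw [← h2]; simp
        · rintro ⟨a, rfl⟩
          constructor
          · intro i hi
            have his : i ≠ s := fun h => hi (h ▸ hsA)
            rw [Function.update_of_ne his]
            exact hw' i fun h => hi (Finset.mem_of_mem_erase h)
          · rw [Function.update_idem, ← hw' s (by simp), Function.update_eq_self]
      rw [himg, Finset.sum_image fun a _ b _ h => Function.update_injective w s h]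
      have hprod : ∀ a, ∏ i ∈ A, P.factor i (Function.update w s a) uu =
          P.cpd s (fun j => w j.1) (fun h => uu h.1) a * ∏ i ∈ A.erase s, P.factor i w uu := by
        intro a
        rw [← Finset.mul_prod_erase A _ hsA]
        congr 1
        · unfold factor
          have : (fun j : G.parents s => Function.update w s a j.1) = fun j => w j.1 := by
            funext j
            refine Function.update_of_ne (fun h => ?_) _ _
            have hj : G.dir j.1 s := j.2
            rw [h] at hj
            exact G.acyclic s (Relation.TransGen.single hj)
          rw [this, Function.update_self]
        · refine Finset.prod_congr rfl fun i hi => ?_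
          have hi' := Finset.mem_erase.mp hi
          unfold factor
          have : (fun j : G.parents i => Function.update w s a j.1) = fun j => w j.1 := by
            funext j
            refine Function.update_of_ne (fun h => ?_) _ _
            have hj : G.dir j.1 i := j.2
            rw [h] at hj
            exact hs i hi'.2 hj
          rw [this, Function.update_of_ne hi'.1]
      simp only [hprod]
      rw [← Finset.sum_mul, ← tsum_fintype (L := .unconditional _), PMF.tsum_coe, one_mul]
    · intro v hv
      simp only [Finset.mem_filter, Finset.mem_univ, true_and, Finset.mem_erase, not_and]
        at hv ⊢
      intro i hi
      by_cases his : i = s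
      · subst his; simp
      · rw [Function.update_of_ne his]
        exact hv i fun h => hi his h

/-- The observational distribution: average over the hidden variables of the product of all
the conditional probabilities. -/
noncomputable def obs (P : CausalBayesNet.{u} G q) : PMF (Fin n → Fin q) :=
  PMF.ofFintype (fun v => ∫⁻ uu, ∏ i, P.factor i v uu ∂(Measure.pi P.law)) (by
    rw [← lintegral_finsetSum _ fun v _ =>
      Finset.measurable_prod _ fun i _ => P.measurable_factor i v]
    have h : ∀ uu : (∀ h, P.Val h), ∑ v : Fin n → Fin q, ∏ i, P.factor i v uu = 1 := by
      intro uu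
      have : Nonempty (Fin n → Fin q) :=
        ⟨fun i => (PMF.support_nonempty (P.cpd i (fun _ => Classical.choice (by
          by_contra hq
          rw [not_nonempty_iff] at hq
          by_cases hp : ∃ j, G.dir j i
          · -- an empty alphabet carries no distribution
            have : Std.Irrefl (Relation.TransGen G.dir) := ⟨fun a => G.acyclic a⟩
            have wf := Finite.wellFounded_of_trans_of_irrefl (Relation.TransGen G.dir)
            obtain ⟨s, -, hmin⟩ := wf.has_min (Set.univ : Set (Fin n)) ⟨i, trivial⟩
            have hs : IsEmpty (G.parents s) :=
              ⟨fun j => hmin j.1 trivial (Relation.TransGen.single j.2)⟩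
            exact hq.elim' (PMF.support_nonempty
              (P.cpd s (fun j => hs.elim j) (fun h => uu h.1))).some
          · exact hq.elim' (PMF.support_nonempty
              (P.cpd i (fun j => (hp ⟨j.1, j.2⟩).elim) (fun h => uu h.1))).some))
          (fun h => uu h.1))).some⟩
      have := P.sum_prod_factor uu (Classical.arbitrary _) Finset.univ
      simpa using this
    simp [h])

/-- The interventional distribution under `do(X = x)`, on the variables other than `X`: the
factor of `X` is dropped and `X` is set to `x` in all the other factors. -/
noncomputable def doDist (P : CausalBayesNet.{u} G q) (X : Fin n) (x : Fin q) :
    PMF ({i : Fin n // i ≠ X} → Fin q) :=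
  PMF.ofFintype (fun w => ∫⁻ uu, ∏ i : {i : Fin n // i ≠ X},
      P.factor i.1 (extendAssign X x w) uu ∂(Measure.pi P.law)) (by
    rw [← lintegral_finsetSum _ fun v _ =>
      Finset.measurable_prod _ fun i _ => P.measurable_factor i.1 _]
    have h : ∀ uu : (∀ h, P.Val h), ∑ w : {i : Fin n // i ≠ X} → Fin q,
        ∏ i : {i : Fin n // i ≠ X}, P.factor i.1 (extendAssign X x w) uu = 1 := by
      intro uu
      rw [← P.sum_prod_factor uu (fun _ => x) (Finset.univ.erase X)]
      refine Finset.sum_bij' (fun w _ => extendAssign X x w) (fun v _ i => v i.1) ?_ ?_ ?_ ?_ ?_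
      · intro w _; simp [extendAssign]
      · intro v _; simp
      · intro w _; funext i; simp [extendAssign, i.2]
      · intro v hv
        have hv' : v X = x := by simpa using hv
        funext i
        by_cases hi : i = X
        · subst hi; simp [extendAssign, hv']
        · simp [extendAssign, hi]
      · intro w _
        refine (Finset.prod_subtype _ (fun i => ?_) fun i =>
          P.factor i (extendAssign X x w) uu).symm
        simp
    simp [h])

/-- `α`-strong positivity with respect to `X`: every assignment to `Pa⁺(S₁)`, where `S₁` is the
c-component of `X`, has observational probability greater than `α`. -/
def StronglyPositive (P : CausalBayesNet.{u} G q) (X : Fin n) (α : ℝ) : Prop :=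
  ∀ z : Fin n → Fin q,
    ENNReal.ofReal α < P.obs.toMeasure {v | ∀ i ∈ G.paPlus (G.cComp X), v i = z i}

end CausalBayesNet

/-- Total variation distance of distributions on a finite set. -/
noncomputable def tvDist {Ω : Type} [Fintype Ω] (p r : PMF Ω) : ℝ :=
  (1 / 2) * ∑ w, |(p w).toReal - (r w).toReal|

/-! ### The machine model

A randomized real RAM, written as a structured programming language.  There is a memory of
natural numbers and a memory of real numbers, both indirectly addressable by natural numbers and
initially zero, and there are read-only inputs.  Natural numbers can be added, subtracted (with
cut-off at zero), multiplied and compared; real numbers can be added, subtracted, multiplied,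
divided and compared.  There is no rounding, no integer division and no bit operation.  Every
operation costs one step, drawing a sample costs one step per observable variable, drawing a
random number costs one step. -/
namespace RealRAM

/-- What a run reads from outside. `samples t i` is the value of variable `i` in sample `t`,
`width` the number of variables in a sample, `coins` the sequence of random numbers. -/
structure Env where
  natIn : ℕ → ℕ
  realIn : ℕ → ℝ
  query : ℕ → ℕ
  width : ℕ
  samples : ℕ → ℕ → ℕ
  coins : ℕ → ℝ

/-- The two memories, and how many samples and random numbers have been used. -/
structure State where
  nat : ℕ → ℕ
  real : ℕ → ℝ
  drawn : ℕ
  tossed : ℕ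

/-- The state in which every run starts. -/
def State.init : State := ⟨fun _ => 0, fun _ => 0, 0, 0⟩

inductive NExp where
  | const (c : ℕ)
  | mem (a : NExp)
  | natIn (a : NExp)
  | query (a : NExp)
  | add (a b : NExp)
  | sub (a b : NExp)
  | mul (a b : NExp)

inductive RExp where
  | ofNat (a : NExp)
  | mem (a : NExp)
  | realIn (a : NExp)
  | add (a b : RExp)
  | sub (a b : RExp)
  | mul (a b : RExp)
  | div (a b : RExp)

inductive BExp where
  | natLt (a b : NExp)
  | realLt (a b : RExp)
  | not (a : BExp)
  | and (a b : BExp)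

inductive Cmd where
  | skip
  | setNat (a : NExp) (e : NExp)
  | setReal (a : NExp) (e : RExp)
  | draw (a : NExp)
  | toss (a : NExp)
  | seq (c₁ c₂ : Cmd)
  | ite (b : BExp) (c₁ c₂ : Cmd)
  | while (b : BExp) (c : Cmd)

def NExp.eval (E : Env) (s : State) : NExp → ℕ
  | .const c => c
  | .mem a => s.nat (a.eval E s)
  | .natIn a => E.natIn (a.eval E s)
  | .query a => E.query (a.eval E s)
  | .add a b => a.eval E s + b.eval E s
  | .sub a b => a.eval E s - b.eval E s
  | .mul a b => a.eval E s * b.eval E s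

noncomputable def RExp.eval (E : Env) (s : State) : RExp → ℝ
  | .ofNat a => (a.eval E s : ℝ)
  | .mem a => s.real (a.eval E s)
  | .realIn a => E.realIn (a.eval E s)
  | .add a b => a.eval E s + b.eval E s
  | .sub a b => a.eval E s - b.eval E s
  | .mul a b => a.eval E s * b.eval E s
  | .div a b => a.eval E s / b.eval E s

def BExp.Holds (E : Env) (s : State) : BExp → Prop
  | .natLt a b => a.eval E s < b.eval E s
  | .realLt a b => a.eval E s < b.eval E s
  | .not a => ¬ a.Holds E s
  | .and a b => a.Holds E s ∧ b.Holds E s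

/-- The number of operations needed to evaluate an expression. -/
def NExp.cost : NExp → ℕ
  | .const _ => 1
  | .mem a => a.cost + 1
  | .natIn a => a.cost + 1
  | .query a => a.cost + 1
  | .add a b => a.cost + b.cost + 1
  | .sub a b => a.cost + b.cost + 1
  | .mul a b => a.cost + b.cost + 1

def RExp.cost : RExp → ℕ
  | .ofNat a => a.cost + 1
  | .mem a => a.cost + 1
  | .realIn a => a.cost + 1
  | .add a b => a.cost + b.cost + 1
  | .sub a b => a.cost + b.cost + 1
  | .mul a b => a.cost + b.cost + 1
  | .div a b => a.cost + b.cost + 1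

def BExp.cost : BExp → ℕ
  | .natLt a b => a.cost + b.cost + 1
  | .realLt a b => a.cost + b.cost + 1
  | .not a => a.cost + 1
  | .and a b => a.cost + b.cost + 1

/-- `Exec E c s t s'`: started in `s`, the program `c` halts in `s'` after exactly `t` steps.
`draw a` copies the next sample to the cells `a, …, a + width - 1` of the memory of natural
numbers; `toss a` stores the next random number in cell `a` of the memory of real numbers. -/
inductive Exec (E : Env) : Cmd → State → ℕ → State → Prop where
  | skip (s : State) : Exec E .skip s 1 s
  | setNat (a e : NExp) (s : State) :
      Exec E (.setNat a e) s (a.cost + e.cost + 1)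
        { s with nat := Function.update s.nat (a.eval E s) (e.eval E s) }
  | setReal (a : NExp) (e : RExp) (s : State) :
      Exec E (.setReal a e) s (a.cost + e.cost + 1)
        { s with real := Function.update s.real (a.eval E s) (e.eval E s) }
  | draw (a : NExp) (s : State) :
      Exec E (.draw a) s (a.cost + E.width + 1)
        { s with
          nat := fun c => if a.eval E s ≤ c ∧ c < a.eval E s + E.width
            then E.samples s.drawn (c - a.eval E s) else s.nat c
          drawn := s.drawn + 1 }
  | toss (a : NExp) (s : State) :
      Exec E (.toss a) s (a.cost + 1)
        { s with
          real := Function.update s.real (a.eval E s) (E.coins s.tossed)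
          tossed := s.tossed + 1 }
  | seq {c₁ c₂ : Cmd} {s s₁ s₂ : State} {t₁ t₂ : ℕ} :
      Exec E c₁ s t₁ s₁ → Exec E c₂ s₁ t₂ s₂ → Exec E (.seq c₁ c₂) s (t₁ + t₂) s₂
  | iteTrue {b : BExp} {c₁ c₂ : Cmd} {s s' : State} {t : ℕ} :
      b.Holds E s → Exec E c₁ s t s' → Exec E (.ite b c₁ c₂) s (b.cost + t) s'
  | iteFalse {b : BExp} {c₁ c₂ : Cmd} {s s' : State} {t : ℕ} :
      ¬ b.Holds E s → Exec E c₂ s t s' → Exec E (.ite b c₁ c₂) s (b.cost + t) s'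
  | whileTrue {b : BExp} {c : Cmd} {s s₁ s₂ : State} {t₁ t₂ : ℕ} :
      b.Holds E s → Exec E c s t₁ s₁ → Exec E (.while b c) s₁ t₂ s₂ →
        Exec E (.while b c) s (b.cost + t₁ + t₂) s₂
  | whileFalse {b : BExp} {c : Cmd} {s : State} :
      ¬ b.Holds E s → Exec E (.while b c) s b.cost s

end RealRAM

/-! ### Learning, evaluating, generating -/

open RealRAM

/-- The law of an infinite sequence of independent uniform random numbers in `[0, 1]`. -/
noncomputable def coinLaw : Measure (ℕ → unitInterval) :=
  Measure.infinitePi fun _ => (volume : Measure unitInterval)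

/-- The law of an infinite sequence of independent samples from `p`. -/
noncomputable def sampleLaw {n q : ℕ} (p : PMF (Fin n → Fin q)) :
    Measure (ℕ → Fin n → Fin q) :=
  Measure.infinitePi fun _ => p.toMeasure

open Classical in
/-- The discrete part of the input of the learner: the number of variables, the size of the
alphabet, `X`, `x`, and the two adjacency matrices. -/
noncomputable def encodeNat {n q : ℕ} (G : ADMG n) (X : Fin n) (x : Fin q) : ℕ → ℕ
  | 0 => n
  | 1 => q
  | 2 => X
  | 3 => x
  | a + 4 =>
    if ∃ i j : Fin n, (G.dir i j ∧ a = i * n + j) ∨ (G.bi.Adj i j ∧ a = n * n + (i * n + j))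
    then 1 else 0

/-- The numerical part of the input of the learner. -/
def encodeReal (α ε δ : ℝ) : ℕ → ℝ
  | 0 => α
  | 1 => ε
  | 2 => δ
  | _ => 0

/-- The inputs of the learner, with the samples `S` and the random numbers `r`. -/
noncomputable def learnEnv {n q : ℕ} (G : ADMG n) (X : Fin n) (x : Fin q) (α ε δ : ℝ)
    (S : ℕ → Fin n → Fin q) (r : ℕ → unitInterval) : Env where
  natIn := encodeNat G X x
  realIn := encodeReal α ε δ
  query := fun _ => 0
  width := n
  samples := fun t i => if h : i < n then (S t ⟨i, h⟩ : ℕ) else 0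
  coins := fun t => r t

/-- The inputs of the evaluator: the memory `out` that the learner left, and an assignment `w`
to the variables other than `X`.  There are no samples and no random numbers. -/
def evalEnv {n q : ℕ} (X : Fin n) (out : State) (w : {i : Fin n // i ≠ X} → Fin q) : Env where
  natIn := out.nat
  realIn := out.real
  query := fun i => if h : i < n then
    (if h' : (⟨i, h⟩ : Fin n) ≠ X then (w ⟨⟨i, h⟩, h'⟩ : ℕ) else 0) else 0
  width := n
  samples := fun _ _ => 0
  coins := fun _ => 0

/-- The inputs of the generator: the memory `out` that the learner left, and fresh random
numbers `r`.  There are no samples. -/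
def genEnv (n : ℕ) (out : State) (r : ℕ → unitInterval) : Env where
  natIn := out.nat
  realIn := out.real
  query := fun _ => 0
  width := n
  samples := fun _ _ => 0
  coins := fun t => r t

/-- From the memory `out`, the program `eval` computes the probability under `D` of every
assignment within `T` steps (the result is in cell `0` of the memory of real numbers). -/
def EvaluatesWithin {n q : ℕ} {X : Fin n} (eval : Cmd) (out : State)
    (D : PMF ({i : Fin n // i ≠ X} → Fin q)) (T : ℝ) : Prop :=
  ∀ w, ∃ t s, Exec (evalEnv X out w) eval State.init t s ∧ (t : ℝ) ≤ T ∧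
    s.real 0 = (D w).toReal

/-- From the memory `out` and fresh random numbers, the program `gen` always halts within `T`
steps, and its result (the value of variable `i` is in cell `i` of the memory of natural numbers)
is distributed according to `D`. -/
def GeneratesWithin {n q : ℕ} {X : Fin n} (gen : Cmd) (out : State)
    (D : PMF ({i : Fin n // i ≠ X} → Fin q)) (T : ℝ) : Prop :=
  (∀ r, ∃ t s, Exec (genEnv n out r) gen State.init t s ∧ (t : ℝ) ≤ T) ∧
  ∀ w, coinLaw {r | ∃ t s, Exec (genEnv n out r) gen State.init t s ∧
    ∀ i : {i : Fin n // i ≠ X}, s.nat i.1 = w i} = D w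

/-- The output of the learner is a memory from which `D` can be evaluated and generated. -/
def Represents {n q : ℕ} {X : Fin n} (eval gen : Cmd) (out : State)
    (D : PMF ({i : Fin n // i ≠ X} → Fin q)) (T : ℝ) : Prop :=
  EvaluatesWithin eval out D T ∧ GeneratesWithin gen out D T

/-! ### Sums over assignments of products of conditional probabilities -/

section BayesNetSums

variable {n q : ℕ}

/-! Fix a topological order. The factors of different c-components read disjoint families of
independent hidden variables, so their averages multiply (`cFactor_union`); inside one component,
adding the variables in order writes the average as a telescoping product of quotients
(`cFactor_eq_prod`). Hence the observational distribution is an ordinary Bayes net in which every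
variable depends only on its effective parents, the earlier variables in its c-component or among
the parents of that component. As no child of `X` lies in its component `S₁`, the value of `X`
enters the factor of `S₁` only through the factor of `X` itself, and summing over it removes that
factor. So `P_x` is a marginal of a Bayes net with the same tables, where the variables outside `S₁`
are shown `x` and those inside the actual value of `X` (`toReal_doDist_eq_sum`). It suffices to
learn the tables, which have at most `n q^(kd+k)` entries.

The tables are estimated by frequencies smoothed with the constant `3L`, where `L` is logarithmic in
the table size over `δ`. Squared total variation is at most relative entropy (`sum_abs_sub_sq_le`).
By the chain rule, the relative entropy of the two intervened nets is a sum over the variables of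
averaged relative entropies of table rows, each at most a chi-square error (`sum_mul_log_div_le`).
Strong positivity replaces the average under the intervened net by the observational one at the
price of a factor `1/α` (`sum_intervene_le_of_stronglyPositive`). Observationally, a row of
probability `p` has weight `p` and error of order `qL/(Np)`, so `p` cancels and rare rows do no harm
(`sum_chiSq_le`). Altogether `N` of order `WL/(αε²)` is enough, `W` being the number of table
entries (`tvDist_estDist_le`). The counts are controlled by a Chernoff bound whose variance is of
the order of the mean and by a union bound (`infinitePi_count_deviation`, `sampleLaw_union_bound`).
Without directed edges the factor `1/α` is not needed, and it must be avoided: then `q^(2kd) = 1`,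
and the whole power `α^(-k) > q^k` is spent on the table size.

On the machine, a table row is addressed by the base `q` code of the values of the effective
parents; memory starts at zero, so the tables need no initialization. The values of the variables
are in the cells `0, …, n-1`. For variables outside `S₁`, the effective parent `X` is redirected to
the extra cell `n` (`entry`), into which the learner writes the sampled value of `X`, but the
evaluator and the generator write `x`. One lookup routine thus serves all three programs. Evaluation
sums products of `n` ratios over the values of `X`; generation samples the variables in order, each
from its own random number, and the value of `X` is ignored. Correctness and time are proved
together, with loop rules that carry explicit step bounds. -/

theorem sum_sum_update (j : Fin n) (F : (Fin n → Fin q) → ℝ) :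
    ∑ v : Fin n → Fin q, ∑ a, F (Function.update v j a) = q * ∑ v, F v := by
  have h : ∑ p : (Fin n → Fin q) × Fin q, F (Function.update p.1 j p.2) =
      ∑ p : (Fin n → Fin q) × Fin q, F p.1 := by
    -- Exchanging `a` with the old value at `j` is an involution of the pairs.
    refine Fintype.sum_equiv (Function.Involutive.toPerm
      (fun p : (Fin n → Fin q) × Fin q => (Function.update p.1 j p.2, p.1 j)) (by
      rintro ⟨v, a⟩; simp)) _ _ ?_
    rintro ⟨v, a⟩; rfl
  rw [Fintype.sum_prod_type, Fintype.sum_prod_type] at h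
  rw [h]
  simp [Finset.mul_sum]

/-- Conditional probabilities of a Bayes net for which `pos` is a topological order. -/
structure IsBayesNet (pos : Fin n → ℕ) (f : Fin n → (Fin n → Fin q) → ℝ) : Prop where
  inj : Function.Injective pos
  dep : ∀ j v v', (∀ i, pos i ≤ pos j → v i = v' i) → f j v = f j v'
  nonneg : ∀ j v, 0 ≤ f j v
  sum_one : ∀ j v, ∑ a, f j (Function.update v j a) = 1

namespace IsBayesNet

variable {pos : Fin n → ℕ} {f : Fin n → (Fin n → Fin q) → ℝ}

theorem update_eq (H : IsBayesNet pos f) {i s : Fin n} (h : pos i < pos s) (v : Fin n → Fin q)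
    (a : Fin q) : f i (Function.update v s a) = f i v := by
  refine H.dep i _ _ fun l hl => Function.update_of_ne ?_ _ _
  rintro rfl; omega

/-- The last variable of `A` occurs in no other factor of the product, so it can be summed first.
All sums range over total assignments; a variable that has been summed out stays as a free
coordinate, which accounts for the factor `q`. -/
theorem sum_prod_mul (H : IsBayesNet pos f) (A : Finset (Fin n)) {s : Fin n} (hs : s ∈ A)
    (hmax : ∀ i ∈ A, i ≠ s → pos i < pos s) (h : (Fin n → Fin q) → ℝ) :
    q * ∑ v, (∏ i ∈ A, f i v) * h v =
      ∑ v, (∏ i ∈ A.erase s, f i v) *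
        ∑ a, f s (Function.update v s a) * h (Function.update v s a) := by
  rw [← sum_sum_update s]
  refine Finset.sum_congr rfl fun v _ => ?_
  rw [Finset.mul_sum]
  refine Finset.sum_congr rfl fun a _ => ?_
  rw [← Finset.mul_prod_erase A _ hs]
  have : ∏ i ∈ A.erase s, f i (Function.update v s a) = ∏ i ∈ A.erase s, f i v :=
    Finset.prod_congr rfl fun i hi =>
      H.update_eq (hmax i (Finset.mem_of_mem_erase hi) (Finset.ne_of_mem_erase hi)) v a
  rw [this]; ring

/-- Variables that come after all of `A₀` and do not influence `h` are removed from the end, one at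
a time, each leaving a conditional distribution that sums to one and a factor `q` for the free
coordinate. -/
theorem sum_prod_eq (H : IsBayesNet pos f) (A₀ : Finset (Fin n)) (h : (Fin n → Fin q) → ℝ)
    (hA₀ : ∀ i ∈ A₀, ∀ s ∉ A₀, pos i < pos s)
    (hh : ∀ s ∉ A₀, ∀ v a, h (Function.update v s a) = h v)
    (A : Finset (Fin n)) (hA : A₀ ⊆ A) :
    (q : ℝ) ^ (A \ A₀).card * ∑ v, (∏ i ∈ A, f i v) * h v = ∑ v, (∏ i ∈ A₀, f i v) * h v := by
  induction hm : (A \ A₀).card generalizing A with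
  | zero =>
    rw [Finset.card_eq_zero, Finset.sdiff_eq_empty_iff_subset] at hm
    rw [Finset.Subset.antisymm hm hA]; simp
  | succ m ih =>
    obtain ⟨s, hs, hmax⟩ := Finset.exists_max_image (A \ A₀) pos
      (by rw [← Finset.card_pos]; omega)
    rw [Finset.mem_sdiff] at hs
    have hcard : (A.erase s \ A₀).card = m := by
      rw [Finset.erase_sdiff_comm, Finset.card_erase_of_mem (by simp [hs])]; omega
    have hsub : A₀ ⊆ A.erase s := fun i hi =>
      Finset.mem_erase.mpr ⟨fun h => hs.2 (h ▸ hi), hA hi⟩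
    rw [← ih _ hsub hcard, pow_succ, mul_assoc, H.sum_prod_mul A hs.1]
    · congr 1
      refine Finset.sum_congr rfl fun v _ => ?_
      simp only [hh s hs.2]
      rw [← Finset.sum_mul, H.sum_one, one_mul]
    · intro i hi his
      by_cases hi0 : i ∈ A₀
      · exact hA₀ i hi0 s hs.2
      · exact lt_of_le_of_ne (hmax i (by simp [hi, hi0])) fun h => his (H.inj h)

theorem sum_prod (H : IsBayesNet pos f) (hq : 0 < q) : ∑ v, ∏ i, f i v = 1 := by
  have h := H.sum_prod_eq ∅ (fun _ => 1) (by simp) (by simp) Finset.univ (by simp)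
  have hq' : (q : ℝ) ^ n ≠ 0 := by positivity
  simpa [hq'] using h

/-- Averaging over the value of `j` given everything that precedes it. -/
theorem sum_prod_cond (H : IsBayesNet pos f) (hq : 0 < q) (j : Fin n)
    (h : (Fin n → Fin q) → ℝ)
    (hh : ∀ s, pos j < pos s → ∀ v a, h (Function.update v s a) = h v) :
    ∑ v, (∏ i, f i v) * h v =
      ∑ v, (∏ i, f i v) * ∑ a, f j (Function.update v j a) * h (Function.update v j a) := by
  have hq' : (0 : ℝ) < q := by exact_mod_cast hq
  set A₀ : Finset (Fin n) := Finset.univ.filter fun i => pos i ≤ pos j with hA₀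
  have hlt : ∀ i ∈ A₀, ∀ s ∉ A₀, pos i < pos s := by
    intro i hi s hs
    simp only [hA₀, Finset.mem_filter, Finset.mem_univ, true_and] at hi hs
    omega
  have hj : j ∈ A₀ := by simp [hA₀]
  have hmax : ∀ i ∈ A₀, i ≠ j → pos i < pos j := by
    intro i hi hij
    simp only [hA₀, Finset.mem_filter, Finset.mem_univ, true_and] at hi
    exact lt_of_le_of_ne hi fun e => hij (H.inj e)
  -- `κ` no longer depends on the value at `j`. Summing out `j` in the sum with `h` and in the sum
  -- with `κ` therefore leads to the same expression.
  set κ : (Fin n → Fin q) → ℝ :=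
    fun v => ∑ a, f j (Function.update v j a) * h (Function.update v j a) with hκ
  have hout : ∀ s ∉ A₀, pos j < pos s := by
    intro s hs; simpa [hA₀] using hs
  have hκs : ∀ s ∉ A₀, ∀ v a, κ (Function.update v s a) = κ v := by
    intro s hs v a
    have hsj : s ≠ j := fun e => hs (e ▸ hj)
    refine Finset.sum_congr rfl fun b _ => ?_
    rw [Function.update_comm hsj, H.update_eq (hout s hs), hh s (hout s hs)]
  have e1 := H.sum_prod_eq A₀ h hlt (fun s hs => hh s (hout s hs)) Finset.univ (by simp)
  have e2 := H.sum_prod_eq A₀ κ hlt hκs Finset.univ (by simp)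
  have e3 := H.sum_prod_mul A₀ hj hmax h
  have e4 := H.sum_prod_mul A₀ hj hmax κ
  have hκj : ∀ v, ∑ a, f j (Function.update v j a) * κ (Function.update v j a) = κ v := by
    intro v
    have : ∀ a, κ (Function.update v j a) = κ v := by
      intro a; simp [hκ]
    simp only [this]
    rw [← Finset.sum_mul, H.sum_one, one_mul]
  simp only [hκj] at e4
  have e5 : ∑ v, (∏ i ∈ A₀, f i v) * h v = ∑ v, (∏ i ∈ A₀, f i v) * κ v :=
    mul_left_cancel₀ hq'.ne' (e3.trans e4.symm)
  have hp : (q : ℝ) ^ (Finset.univ \ A₀).card ≠ 0 := by positivity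
  exact mul_left_cancel₀ hp (by rw [e1, e2, e5])

end IsBayesNet

end BayesNetSums

/-! ### Total variation and relative entropy -/

section Divergence

variable {ι : Type*} [Fintype ι]

/-- Apply `log t ≤ t - 1` to `t = √(r / p)`. The root makes the left sides add up to a squared
Hellinger distance. -/
theorem mul_log_div_ge {p r : ℝ} (hp : 0 ≤ p) (hr : 0 < r) :
    2 * p - 2 * √(p * r) ≤ p * Real.log (p / r) := by
  rcases hp.eq_or_lt with rfl | hp
  · simp
  have h1 : Real.log (√(r / p)) ≤ √(r / p) - 1 :=
    Real.log_le_sub_one_of_pos (by positivity)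
  rw [Real.log_sqrt (by positivity), ← inv_div p r, Real.log_inv] at h1
  have h2 : p * √((p / r)⁻¹) = √(p * r) := by
    rw [inv_div]
    have : p * r = p ^ 2 * (r / p) := by field_simp
    rw [this, Real.sqrt_mul (by positivity), Real.sqrt_sq hp.le]
  nlinarith

/-- Total variation is bounded through relative entropy. -/
theorem sum_abs_sub_sq_le (p r : ι → ℝ) (hp : ∀ i, 0 ≤ p i) (hr : ∀ i, 0 < r i)
    (sp : ∑ i, p i = 1) (sr : ∑ i, r i = 1) :
    (∑ i, |p i - r i|) ^ 2 ≤ 4 * ∑ i, p i * Real.log (p i / r i) := by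
  -- Cauchy–Schwarz is applied to this factorization: the first factors give the squared Hellinger
  -- distance, which is at most the relative entropy, and the squares of the second ones sum to at
  -- most `4`.
  have h1 : ∀ i, |p i - r i| = |√(p i) - √(r i)| * (√(p i) + √(r i)) := by
    intro i
    rw [← abs_of_nonneg (by positivity : 0 ≤ √(p i) + √(r i)), ← abs_mul]
    congr 1
    have a := Real.mul_self_sqrt (hp i)
    have b := Real.mul_self_sqrt (hr i).le
    nlinarith
  have h2 := Finset.sum_mul_sq_le_sq_mul_sq Finset.univ
    (fun i => |√(p i) - √(r i)|) (fun i => √(p i) + √(r i))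
  simp only [← h1, sq_abs] at h2
  have h3 : ∀ i, (√(p i) - √(r i)) ^ 2 = p i + r i - 2 * √(p i * r i) := by
    intro i
    rw [Real.sqrt_mul (hp i), sub_sq, Real.sq_sqrt (hp i), Real.sq_sqrt (hr i).le]; ring
  have h4 : ∀ i, (√(p i) + √(r i)) ^ 2 ≤ 2 * p i + 2 * r i := by
    intro i
    have := sq_nonneg (√(p i) - √(r i))
    rw [sub_sq, Real.sq_sqrt (hp i), Real.sq_sqrt (hr i).le] at this
    rw [add_sq, Real.sq_sqrt (hp i), Real.sq_sqrt (hr i).le]; linarith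
  have h5 : ∑ i, (√(p i) + √(r i)) ^ 2 ≤ 4 := by
    refine (Finset.sum_le_sum fun i _ => h4 i).trans ?_
    rw [Finset.sum_add_distrib, ← Finset.mul_sum, ← Finset.mul_sum, sp, sr]; norm_num
  have h6 : ∑ i, (√(p i) - √(r i)) ^ 2 ≤ ∑ i, p i * Real.log (p i / r i) := by
    have : ∑ i, (√(p i) - √(r i)) ^ 2 = ∑ i, (2 * p i - 2 * √(p i * r i)) := by
      simp only [h3, Finset.sum_sub_distrib, Finset.sum_add_distrib]
      rw [← Finset.mul_sum, ← Finset.mul_sum, sp, sr]; ring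
    rw [this]
    exact Finset.sum_le_sum fun i _ => mul_log_div_ge (hp i) (hr i)
  have h7 : 0 ≤ ∑ i, (√(p i) - √(r i)) ^ 2 := Finset.sum_nonneg fun i _ => sq_nonneg _
  have h8 : 0 ≤ ∑ i, (√(p i) + √(r i)) ^ 2 := Finset.sum_nonneg fun i _ => sq_nonneg _
  nlinarith

theorem sum_mul_log_div_nonneg (p r : ι → ℝ) (hp : ∀ i, 0 ≤ p i) (hr : ∀ i, 0 < r i)
    (sp : ∑ i, p i = 1) (sr : ∑ i, r i = 1) : 0 ≤ ∑ i, p i * Real.log (p i / r i) := by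
  have := sum_abs_sub_sq_le p r hp hr sp sr
  nlinarith [sq_nonneg (∑ i, |p i - r i|)]

/-- Relative entropy is bounded by the chi-square divergence. -/
theorem sum_mul_log_div_le (p r : ι → ℝ) (hp : ∀ i, 0 ≤ p i) (hr : ∀ i, 0 < r i)
    (sp : ∑ i, p i = 1) (sr : ∑ i, r i = 1) :
    ∑ i, p i * Real.log (p i / r i) ≤ ∑ i, (p i - r i) ^ 2 / r i := by
  -- From `log t ≤ t - 1`; the linear terms `p i - r i` cancel in the sum.
  have h : ∀ i, p i * Real.log (p i / r i) ≤ (p i - r i) ^ 2 / r i + (p i - r i) := by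
    intro i
    rcases (hp i).eq_or_lt with h0 | h0
    · rw [← h0]; have := (hr i).ne'; field_simp; simp
    have h1 := Real.log_le_sub_one_of_pos (div_pos h0 (hr i))
    have h2 := mul_le_mul_of_nonneg_left h1 h0.le
    have h3 : p i * (p i / r i - 1) = (p i - r i) ^ 2 / r i + (p i - r i) := by
      have := (hr i).ne'; field_simp; ring
    linarith
  refine (Finset.sum_le_sum fun i _ => h i).trans ?_
  rw [Finset.sum_add_distrib, Finset.sum_sub_distrib, sp, sr]; simp

end Divergence

/-! ### c-factors of a causal Bayes net -/

namespace CausalBayesNet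

variable {n q : ℕ} {G : ADMG n}

theorem factor_le_one (P : CausalBayesNet.{u} G q) (i : Fin n) (v : Fin n → Fin q)
    (uu : ∀ h, P.Val h) : P.factor i v uu ≤ 1 := PMF.coe_le_one _ _

theorem factor_congr (P : CausalBayesNet.{u} G q) {i : Fin n} {v v' : Fin n → Fin q}
    (hi : v i = v' i) (hp : ∀ l, G.dir l i → v l = v' l) (uu : ∀ h, P.Val h) :
    P.factor i v uu = P.factor i v' uu := by
  unfold factor
  have : (fun j : G.parents i => v j.1) = fun j => v' j.1 := funext fun j => hp j.1 j.2
  rw [this, hi]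

/-- The product of the factors of a set of variables, averaged over the hidden variables. -/
noncomputable def cFactor (P : CausalBayesNet.{u} G q) (A : Finset (Fin n))
    (v : Fin n → Fin q) : ℝ :=
  (∫⁻ uu, ∏ i ∈ A, P.factor i v uu ∂(Measure.pi P.law)).toReal

theorem lintegral_factor_le_one (P : CausalBayesNet.{u} G q) (A : Finset (Fin n))
    (v : Fin n → Fin q) : ∫⁻ uu, ∏ i ∈ A, P.factor i v uu ∂(Measure.pi P.law) ≤ 1 := by
  calc _ ≤ ∫⁻ _, 1 ∂(Measure.pi P.law) :=
        lintegral_mono fun uu => Finset.prod_le_one' fun i _ => P.factor_le_one i v uu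
    _ = 1 := by simp

theorem cFactor_nonneg (P : CausalBayesNet.{u} G q) (A : Finset (Fin n)) (v : Fin n → Fin q) :
    0 ≤ P.cFactor A v := ENNReal.toReal_nonneg

theorem cFactor_le_one (P : CausalBayesNet.{u} G q) (A : Finset (Fin n)) (v : Fin n → Fin q) :
    P.cFactor A v ≤ 1 :=
  ENNReal.toReal_le_of_le_ofReal zero_le_one (by simpa using P.lintegral_factor_le_one A v)

theorem cFactor_anti (P : CausalBayesNet.{u} G q) {A B : Finset (Fin n)} (h : A ⊆ B)
    (v : Fin n → Fin q) : P.cFactor B v ≤ P.cFactor A v := by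
  refine ENNReal.toReal_mono (ne_top_of_le_ne_top ENNReal.one_ne_top
    (P.lintegral_factor_le_one A v)) (lintegral_mono fun uu => ?_)
  exact Finset.prod_le_prod_of_subset_of_le_one' h fun i _ _ => P.factor_le_one i v uu

theorem cFactor_congr (P : CausalBayesNet.{u} G q) {A : Finset (Fin n)} {v v' : Fin n → Fin q}
    (h : ∀ i ∈ A, v i = v' i ∧ ∀ l, G.dir l i → v l = v' l) :
    P.cFactor A v = P.cFactor A v' := by
  unfold cFactor
  congr 2; funext uu
  exact Finset.prod_congr rfl fun i hi => P.factor_congr (h i hi).1 (h i hi).2 uu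

/-- Sets of variables without bidirected edges between them have independent factors. -/
theorem cFactor_union (P : CausalBayesNet.{u} G q) {A B : Finset (Fin n)}
    (h : ∀ i ∈ A, ∀ j ∈ B, i ≠ j ∧ ¬ G.bi.Adj i j) (v : Fin n → Fin q) :
    P.cFactor (A ∪ B) v = P.cFactor A v * P.cFactor B v := by
  classical
  have hdisj : Disjoint A B := by
    rw [Finset.disjoint_left]
    exact fun i hA hB => (h i hA i hB).1 rfl
  let HH : Finset (Fin n) → Finset P.Hidden :=
    fun C => Finset.univ.filter fun h => ∃ i ∈ C, i ∈ P.ends h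
  -- A hidden variable that reaches both sets would produce a bidirected edge between them, because
  -- it affects exactly two observables.
  have hH : Disjoint (HH A) (HH B) := by
    rw [Finset.disjoint_left]
    intro e hA hB
    simp only [HH, Finset.mem_filter, Finset.mem_univ, true_and] at hA hB
    obtain ⟨i, hi, hie⟩ := hA
    obtain ⟨j, hj, hje⟩ := hB
    have he : P.ends e = s(i, j) := ((Sym2.mem_and_mem_iff (h i hi j hj).1).mp ⟨hie, hje⟩)
    have : P.ends e ∈ G.bi.edgeSet := P.range_ends ▸ Set.mem_range_self e
    rw [he] at this
    exact (h i hi j hj).2 this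
  have hind := ProbabilityTheory.iIndepFun.indepFun_finset (HH A) (HH B) hH
    (ProbabilityTheory.iIndepFun_pi (μ := P.law) (X := fun _ => id)
      fun _ => aemeasurable_id) (fun i => measurable_pi_apply i)
  -- The product over `C` as a function of those hidden variables only that reach `C`, the form that
  -- independence of disjoint blocks requires.
  let φ : ∀ C : Finset (Fin n), (∀ e : HH C, P.Val e) → ℝ≥0∞ := fun C y =>
    ∏ i ∈ C.attach, P.cpd i.1 (fun j => v j.1)
      (fun e => y ⟨e.1, by simpa [HH] using ⟨i.1, i.2, e.2⟩⟩) (v i.1)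
  have hφ : ∀ C, Measurable (φ C) := fun C =>
    Finset.measurable_prod _ fun i _ => (P.measurable_cpd i.1 (fun j => v j.1) (v i.1)).comp
      (measurable_pi_lambda _ fun e => measurable_pi_apply _)
  have hφ' : ∀ C, ∀ uu : (∀ e, P.Val e), φ C (fun e => uu e.1) = ∏ i ∈ C, P.factor i v uu := by
    intro C uu
    exact Finset.prod_attach C fun i => P.factor i v uu
  have hind' := hind.comp (hφ A) (hφ B)
  have key := ProbabilityTheory.lintegral_mul_eq_lintegral_mul_lintegral_of_indepFun''
    (((hφ A).comp (measurable_pi_lambda _ fun e => measurable_pi_apply _)).aemeasurable)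
    (((hφ B).comp (measurable_pi_lambda _ fun e => measurable_pi_apply _)).aemeasurable) hind'
  simp only [Function.comp_def, hφ'] at key
  unfold cFactor
  rw [← ENNReal.toReal_mul, ← key]
  simp only [Finset.prod_union hdisj]

/-- If `s` has no child in `A`, its value is read only by its own factor, which sums to one for
every value of the hidden variables. -/
theorem sum_cFactor_update (P : CausalBayesNet.{u} G q) {A : Finset (Fin n)} {s : Fin n}
    (hs : s ∈ A) (hc : ∀ j ∈ A, ¬ G.dir s j) (v : Fin n → Fin q) :
    ∑ a, P.cFactor A (Function.update v s a) = P.cFactor (A.erase s) v := by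
  unfold cFactor
  rw [← ENNReal.toReal_sum fun a _ => ne_top_of_le_ne_top ENNReal.one_ne_top
    (P.lintegral_factor_le_one A _)]
  rw [← lintegral_finsetSum _ fun a _ =>
      Finset.measurable_prod _ fun i _ => P.measurable_factor i _]
  congr 2; funext uu
  have hprod : ∀ a, ∏ i ∈ A, P.factor i (Function.update v s a) uu =
      P.cpd s (fun j => v j.1) (fun h => uu h.1) a * ∏ i ∈ A.erase s, P.factor i v uu := by
    intro a
    rw [← Finset.mul_prod_erase A _ hs]
    congr 1
    · unfold factor
      have : (fun j : G.parents s => Function.update v s a j.1) = fun j => v j.1 := by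
        funext j
        refine Function.update_of_ne (fun h => ?_) _ _
        have hj : G.dir j.1 s := j.2
        rw [h] at hj
        exact hc s hs hj
      rw [this, Function.update_self]
    · refine Finset.prod_congr rfl fun i hi => P.factor_congr ?_ ?_ uu
      · exact Function.update_of_ne (Finset.ne_of_mem_erase hi) _ _
      · intro l hl
        refine Function.update_of_ne (fun h => ?_) _ _
        exact hc i (Finset.mem_of_mem_erase hi) (h ▸ hl)
  simp only [hprod]
  rw [← Finset.sum_mul, ← tsum_fintype (L := .unconditional _), PMF.tsum_coe, one_mul]

theorem toReal_obs (P : CausalBayesNet.{u} G q) (v : Fin n → Fin q) :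
    (P.obs v).toReal = P.cFactor Finset.univ v := rfl

theorem toReal_doDist (P : CausalBayesNet.{u} G q) (X : Fin n) (x : Fin q)
    (w : {i : Fin n // i ≠ X} → Fin q) :
    (P.doDist X x w).toReal = P.cFactor (Finset.univ.erase X) (extendAssign X x w) := by
  unfold cFactor
  change (∫⁻ uu, ∏ i : {i : Fin n // i ≠ X},
      P.factor i.1 (extendAssign X x w) uu ∂(Measure.pi P.law)).toReal = _
  congr 2; funext uu
  exact (Finset.prod_subtype _ (fun i => by simp) fun i =>
    P.factor i (extendAssign X x w) uu).symm

end CausalBayesNet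

/-! ### Effective parents and the conditional probabilities given them -/

namespace ADMG

variable {n : ℕ}

/-- `pos` lists parents before children. -/
structure IsTopoOrder (G : ADMG n) (pos : Fin n → ℕ) : Prop where
  inj : Function.Injective pos
  lt : ∀ i j, G.dir i j → pos i < pos j

open Classical in
/-- The part of the c-component of `j` that precedes `j`. -/
noncomputable def before (G : ADMG n) (pos : Fin n → ℕ) (j : Fin n) : Finset (Fin n) :=
  Finset.univ.filter fun l => G.bi.Reachable j l ∧ pos l < pos j

open Classical in
/-- The variables preceding `j` that are in its c-component or parents of it. -/
noncomputable def effParents (G : ADMG n) (pos : Fin n → ℕ) (j : Fin n) : Finset (Fin n) :=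
  Finset.univ.filter fun l => l ∈ G.paPlus (G.cComp j) ∧ pos l < pos j

theorem mem_effParents (G : ADMG n) (pos : Fin n → ℕ) (j l : Fin n) :
    l ∈ G.effParents pos j ↔ l ∈ G.paPlus (G.cComp j) ∧ pos l < pos j := by
  simp [effParents]

theorem self_notMem_effParents (G : ADMG n) (pos : Fin n → ℕ) (j : Fin n) :
    j ∉ G.effParents pos j := by simp [effParents]

theorem mem_paPlus (G : ADMG n) (S : Set (Fin n)) (l : Fin n) :
    l ∈ G.paPlus S ↔ l ∈ S ∨ ∃ i ∈ S, G.dir l i := by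
  simp [paPlus, parents]

open Classical in
/-- The assignment that the conditional probability of `j` gets to see under `do(X = x)`. -/
noncomputable def intervene {q : ℕ} (G : ADMG n) (X : Fin n) (x : Fin q) (j : Fin n)
    (v : Fin n → Fin q) : Fin n → Fin q :=
  if G.bi.Reachable X j then v else Function.update v X x

end ADMG

namespace CausalBayesNet

variable {n q : ℕ} {G : ADMG n}

open Classical in
/-- The conditional probability of the value of `j` given its effective parents. -/
noncomputable def condProb (P : CausalBayesNet.{u} G q) (pos : Fin n → ℕ) (j : Fin n)
    (v : Fin n → Fin q) : ℝ :=
  -- The uniform default keeps this a probability distribution on rows of probability zero, so that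
  -- the Bayes net property holds without any positivity.
  if P.cFactor (G.before pos j) v = 0 then 1 / q
  else P.cFactor (insert j (G.before pos j)) v / P.cFactor (G.before pos j) v

theorem before_congr_aux {pos : Fin n → ℕ} (hpos : G.IsTopoOrder pos) {j : Fin n}
    {v v' : Fin n → Fin q} (h : ∀ l ∈ G.effParents pos j, v l = v' l) :
    ∀ i ∈ G.before pos j, v i = v' i ∧ ∀ l, G.dir l i → v l = v' l := by
  intro i hi
  simp only [ADMG.before, Finset.mem_filter, Finset.mem_univ, true_and] at hi
  refine ⟨h i ?_, fun l hl => h l ?_⟩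
  · rw [G.mem_effParents, G.mem_paPlus]; exact ⟨Or.inl hi.1, hi.2⟩
  · rw [G.mem_effParents, G.mem_paPlus]
    exact ⟨Or.inr ⟨i, hi.1, hl⟩, (hpos.lt l i hl).trans hi.2⟩

theorem condProb_congr (P : CausalBayesNet.{u} G q) {pos : Fin n → ℕ}
    (hpos : G.IsTopoOrder pos) {j : Fin n} {v v' : Fin n → Fin q} (hj : v j = v' j)
    (h : ∀ l ∈ G.effParents pos j, v l = v' l) : P.condProb pos j v = P.condProb pos j v' := by
  classical
  have h1 := before_congr_aux hpos h
  have e1 : P.cFactor (G.before pos j) v = P.cFactor (G.before pos j) v' := P.cFactor_congr h1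
  have e2 : P.cFactor (insert j (G.before pos j)) v =
      P.cFactor (insert j (G.before pos j)) v' := by
    refine P.cFactor_congr fun i hi => ?_
    rcases Finset.mem_insert.mp hi with rfl | hi
    · refine ⟨hj, fun l hl => h l ?_⟩
      rw [G.mem_effParents, G.mem_paPlus]
      exact ⟨Or.inr ⟨i, SimpleGraph.Reachable.refl i, hl⟩, hpos.lt l i hl⟩
    · exact h1 i hi
  simp only [condProb, e1, e2]

theorem condProb_nonneg (P : CausalBayesNet.{u} G q) (pos : Fin n → ℕ) (j : Fin n)
    (v : Fin n → Fin q) : 0 ≤ P.condProb pos j v := by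
  unfold condProb
  split_ifs
  · positivity
  · exact div_nonneg (P.cFactor_nonneg _ _) (P.cFactor_nonneg _ _)

theorem self_notMem_before (G : ADMG n) (pos : Fin n → ℕ) (j : Fin n) :
    j ∉ G.before pos j := by simp [ADMG.before]

/-- Where the denominator vanishes, so does the left side, since c-factors decrease when the set
grows; the default value is harmless. -/
theorem cFactor_insert_before (P : CausalBayesNet.{u} G q) (pos : Fin n → ℕ) (j : Fin n)
    (v : Fin n → Fin q) : P.cFactor (insert j (G.before pos j)) v =
      P.condProb pos j v * P.cFactor (G.before pos j) v := by
  classical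
  unfold condProb
  split_ifs with h0
  · rw [h0, mul_zero]
    exact le_antisymm (h0 ▸ P.cFactor_anti (Finset.subset_insert _ _) v) (P.cFactor_nonneg _ _)
  · rw [div_mul_cancel₀ _ h0]

theorem isBayesNet_condProb (P : CausalBayesNet.{u} G q) {pos : Fin n → ℕ}
    (hpos : G.IsTopoOrder pos) (hq : 0 < q) : IsBayesNet pos (P.condProb pos) where
  inj := hpos.inj
  dep j v v' h := P.condProb_congr hpos (h j le_rfl) fun l hl =>
    h l ((G.mem_effParents pos j l).mp hl).2.le
  nonneg := P.condProb_nonneg pos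
  sum_one j v := by
    classical
    have h1 : ∀ a, P.cFactor (G.before pos j) (Function.update v j a) =
        P.cFactor (G.before pos j) v := fun a =>
      P.cFactor_congr (before_congr_aux hpos fun l hl => Function.update_of_ne (by
        rintro rfl; exact G.self_notMem_effParents pos _ hl) _ _)
    simp only [condProb, h1]
    split_ifs with h0
    · have : (q : ℝ) ≠ 0 := by positivity
      simp [this]
    · rw [← Finset.sum_div, P.sum_cFactor_update (Finset.mem_insert_self _ _),
        Finset.erase_insert (self_notMem_before G pos j), div_self h0]
      intro i hi hd
      have := hpos.lt _ _ hd
      rcases Finset.mem_insert.mp hi with rfl | hi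
      · omega
      · simp only [ADMG.before, Finset.mem_filter, Finset.mem_univ, true_and] at hi
        omega

theorem cFactor_empty (P : CausalBayesNet.{u} G q) (v : Fin n → Fin q) : P.cFactor ∅ v = 1 := by
  simp [cFactor]

/-- A c-factor is the product of the conditional probabilities given effective parents. -/
theorem cFactor_eq_prod (P : CausalBayesNet.{u} G q) {pos : Fin n → ℕ}
    (hpos : G.IsTopoOrder pos) (A : Finset (Fin n))
    (hA : ∀ i ∈ A, ∀ l, G.bi.Reachable i l → pos l ≤ pos i → l ∈ A) (v : Fin n → Fin q) :
    P.cFactor A v = ∏ j ∈ A, P.condProb pos j v := by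
  classical
  induction hm : A.card generalizing A with
  | zero => rw [Finset.card_eq_zero] at hm; simp [hm, cFactor_empty]
  | succ m ih =>
    obtain ⟨j, hj, hmax⟩ := Finset.exists_max_image A pos (by rw [← Finset.card_pos]; omega)
    have hlt : ∀ i ∈ A, i ≠ j → pos i < pos j := fun i hi hij =>
      lt_of_le_of_ne (hmax i hi) fun e => hij (hpos.inj e)
    -- With `j` last in `A`, the hypothesis on `A` puts all of `G.before pos j` into `A`, and `R` is
    -- what lies in other c-components. The factor of `R` splits off both from `A` and from `A.erase
    -- j`, so the two c-factors differ exactly by the conditional probability of `j`.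
    set R := A.filter fun i => ¬ G.bi.Reachable j i with hR
    have hsplit : ∀ i ∈ G.before pos j, i ∈ A ∧ G.bi.Reachable j i := by
      intro i hi
      simp only [ADMG.before, Finset.mem_filter, Finset.mem_univ, true_and] at hi
      exact ⟨hA j hj i hi.1 hi.2.le, hi.1⟩
    have hA1 : A = insert j (G.before pos j) ∪ R := by
      ext i
      simp only [hR, Finset.mem_union, Finset.mem_insert, Finset.mem_filter]
      constructor
      · intro hi
        by_cases hij : i = j
        · exact Or.inl (Or.inl hij)
        by_cases hr : G.bi.Reachable j i
        · refine Or.inl (Or.inr ?_)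
          simp [ADMG.before, hr, hlt i hi hij]
        · exact Or.inr ⟨hi, hr⟩
      · rintro ((rfl | hi) | hi)
        · exact hj
        · exact (hsplit i hi).1
        · exact hi.1
    have hjR : j ∉ R := by simp [hR]
    have hA2 : A.erase j = G.before pos j ∪ R := by
      conv_lhs => rw [hA1]
      rw [Finset.insert_union, Finset.erase_insert]
      simp [hjR, self_notMem_before]
    have hsep : ∀ i ∈ insert j (G.before pos j), ∀ l ∈ R, i ≠ l ∧ ¬ G.bi.Adj i l := by
      intro i hi l hl
      have hji : G.bi.Reachable j i := by
        rcases Finset.mem_insert.mp hi with rfl | hi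
        · exact SimpleGraph.Reachable.refl _
        · exact (hsplit i hi).2
      have hl' := (Finset.mem_filter.mp hl).2
      exact ⟨fun e => hl' (e ▸ hji), fun e => hl' (hji.trans e.reachable)⟩
    have e1 : P.cFactor A v = P.condProb pos j v * P.cFactor (A.erase j) v := by
      rw [hA2, P.cFactor_union (fun i hi => hsep i (Finset.mem_insert_of_mem hi))]
      conv_lhs => rw [hA1]
      rw [P.cFactor_union hsep, P.cFactor_insert_before, mul_assoc]
    rw [e1, ih (A.erase j)]
    · exact Finset.mul_prod_erase A (fun j => P.condProb pos j v) hj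
    · intro i hi l hil hl
      have hi' := Finset.mem_erase.mp hi
      refine Finset.mem_erase.mpr ⟨?_, hA i hi'.2 l hil hl⟩
      rintro rfl
      have := hlt i hi'.2 hi'.1
      omega
    · rw [Finset.card_erase_of_mem hj]; omega

theorem toReal_obs_eq_prod (P : CausalBayesNet.{u} G q) {pos : Fin n → ℕ}
    (hpos : G.IsTopoOrder pos) (v : Fin n → Fin q) :
    (P.obs v).toReal = ∏ j, P.condProb pos j v := by
  rw [P.toReal_obs, P.cFactor_eq_prod hpos]; simp

/-! ### Identification of the interventional distribution -/

open Classical in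
/-- The c-component of `X` as a finset. -/
noncomputable def compFinset (G : ADMG n) (X : Fin n) : Finset (Fin n) :=
  Finset.univ.filter fun j => G.bi.Reachable X j

theorem mem_compFinset {X j : Fin n} : j ∈ compFinset G X ↔ G.bi.Reachable X j := by
  simp [compFinset]

open Classical in
theorem compFinset_sep (X : Fin n) : ∀ i ∈ compFinset G X, ∀ j ∈ (compFinset G X)ᶜ,
    i ≠ j ∧ ¬ G.bi.Adj i j := by
  intro i hi j hj
  rw [Finset.mem_compl, mem_compFinset] at hj
  rw [mem_compFinset] at hi
  exact ⟨fun e => hj (e ▸ hi), fun e => hj (hi.trans e.reachable)⟩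

open Classical in
-- The c-component of `X` and its complement are both unions of c-components, so `cFactor_eq_prod`
-- applies to each, with its own assignment.
theorem prod_condProb_intervene (P : CausalBayesNet.{u} G q) {pos : Fin n → ℕ}
    (hpos : G.IsTopoOrder pos) (X : Fin n) (x : Fin q) (v : Fin n → Fin q) :
    ∏ j, P.condProb pos j (G.intervene X x j v) =
      P.cFactor (compFinset G X) v * P.cFactor (compFinset G X)ᶜ (Function.update v X x) := by
  rw [P.cFactor_eq_prod hpos, P.cFactor_eq_prod hpos,
    ← Finset.prod_mul_prod_compl (compFinset G X)]
  · congr 1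
    · refine Finset.prod_congr rfl fun j hj => ?_
      rw [mem_compFinset] at hj
      simp [ADMG.intervene, hj]
    · refine Finset.prod_congr rfl fun j hj => ?_
      rw [Finset.mem_compl, mem_compFinset] at hj
      simp [ADMG.intervene, hj]
  · intro i hi l hil _
    rw [Finset.mem_compl, mem_compFinset] at *
    exact fun h => hi (h.trans hil.symm)
  · intro i hi l hil _
    rw [mem_compFinset] at *
    exact hi.trans hil

open Classical in
-- Identifiability enters here: no member of the component has `X` as a parent, so only the factor
-- of `X` reads the value of `X` and the sum deletes it. What is left does not depend on that value,
-- which may be set to `x`.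
theorem sum_cFactor_intervene (P : CausalBayesNet.{u} G q) {X : Fin n} (hid : G.Identifiable X)
    (x : Fin q) (v : Fin n → Fin q) :
    ∑ a, P.cFactor (compFinset G X) (Function.update v X a) *
        P.cFactor (compFinset G X)ᶜ (Function.update v X x) =
      P.cFactor ((compFinset G X).erase X) (Function.update v X x) *
        P.cFactor (compFinset G X)ᶜ (Function.update v X x) := by
  have hnd : ∀ j ∈ compFinset G X, ¬ G.dir X j := fun j hj hd =>
    hid j hd (mem_compFinset.mp hj)
  rw [← Finset.sum_mul, P.sum_cFactor_update (by simp [mem_compFinset]) hnd]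
  congr 1
  refine P.cFactor_congr fun i hi => ⟨?_, fun l hl => ?_⟩
  · rw [Function.update_of_ne (Finset.ne_of_mem_erase hi)]
  · rw [Function.update_of_ne]
    rintro rfl
    exact hnd i (Finset.mem_of_mem_erase hi) hl

open Classical in
theorem cFactor_erase_mul (P : CausalBayesNet.{u} G q) (X : Fin n) (v : Fin n → Fin q) :
    P.cFactor ((compFinset G X).erase X) v * P.cFactor (compFinset G X)ᶜ v =
      P.cFactor (Finset.univ.erase X) v := by
  rw [← P.cFactor_union fun i hi => compFinset_sep X i (Finset.mem_of_mem_erase hi)]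
  congr 1
  ext i
  by_cases h : i ∈ compFinset G X
  · simp [h]
  · have : i ≠ X := by rintro rfl; exact h (by simp [mem_compFinset])
    simp [h, this]

theorem update_extendAssign (X : Fin n) (x a : Fin q) (w : {i : Fin n // i ≠ X} → Fin q) :
    Function.update (extendAssign X x w) X a = extendAssign X a w := by
  funext i
  by_cases h : i = X
  · subst h; simp [extendAssign]
  · simp [extendAssign, h]

/-- The interventional distribution is a marginal of the Bayes net in which all conditional
probabilities outside the c-component of `X` see `x`. -/
theorem toReal_doDist_eq_sum (P : CausalBayesNet.{u} G q) {pos : Fin n → ℕ}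
    (hpos : G.IsTopoOrder pos) {X : Fin n} (hid : G.Identifiable X) (x : Fin q)
    (w : {i : Fin n // i ≠ X} → Fin q) :
    (P.doDist X x w).toReal =
      ∑ a, ∏ j, P.condProb pos j (G.intervene X x j (extendAssign X a w)) := by
  classical
  have h := P.sum_cFactor_intervene hid x (extendAssign X x w)
  rw [P.cFactor_erase_mul] at h
  simp only [update_extendAssign] at h
  rw [P.toReal_doDist, ← h]
  refine Finset.sum_congr rfl fun a _ => ?_
  rw [P.prod_condProb_intervene hpos, update_extendAssign]


/-! ### Consequences of strong positivity and the change of measure -/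

open Classical in
theorem sum_cFactor_compl (P : CausalBayesNet.{u} G q) (A : Finset (Fin n))
    (v : Fin n → Fin q) :
    ∑ u : Fin n → Fin q with (∀ i, i ∉ A → u i = v i), P.cFactor A u = 1 := by
  unfold cFactor
  rw [← ENNReal.toReal_sum fun a _ => ne_top_of_le_ne_top ENNReal.one_ne_top
    (P.lintegral_factor_le_one A _)]
  rw [← lintegral_finsetSum _ fun a _ =>
      Finset.measurable_prod _ fun i _ => P.measurable_factor i _]
  simp [P.sum_prod_factor]

open Classical in
theorem StronglyPositive.lt_sum {P : CausalBayesNet.{u} G q} {X : Fin n} {α : ℝ}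
    (hα : 0 < α) (h : P.StronglyPositive X α) (z : Fin n → Fin q) :
    α < ∑ v : Fin n → Fin q with (∀ i ∈ G.paPlus (G.cComp X), v i = z i), (P.obs v).toReal := by
  have h1 := h z
  rw [PMF.toMeasure_apply_fintype] at h1
  rw [← ENNReal.toReal_sum fun v _ => P.obs.apply_ne_top v, Finset.sum_filter]
  have h2 : ∑ v, (({v | ∀ i ∈ G.paPlus (G.cComp X), v i = z i} : Set (Fin n → Fin q)).indicator
      P.obs) v = ∑ v, if (∀ i ∈ G.paPlus (G.cComp X), v i = z i) then P.obs v else 0 := by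
    refine Finset.sum_congr rfl fun v _ => ?_
    simp [Set.indicator_apply]
  rw [h2] at h1
  rw [← ENNReal.ofReal_lt_iff_lt_toReal hα.le]
  · exact h1
  · refine ENNReal.sum_ne_top.mpr fun v _ => ?_
    split_ifs
    · exact P.obs.apply_ne_top v
    · exact ENNReal.zero_ne_top

open Classical in
theorem obs_eq_mul (P : CausalBayesNet.{u} G q) (X : Fin n) (v : Fin n → Fin q) :
    (P.obs v).toReal = P.cFactor (compFinset G X) v * P.cFactor (compFinset G X)ᶜ v := by
  rw [P.toReal_obs, ← P.cFactor_union (compFinset_sep X), Finset.union_compl]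

/-- The c-factor of the component of `X` depends only on the coordinates in `Z`, so the probability
of an assignment to `Z` is this c-factor times a partial sum of the complementary one. That partial
sum is at most `1`. -/
theorem StronglyPositive.lt_cFactor {P : CausalBayesNet.{u} G q} {X : Fin n} {α : ℝ}
    (hα : 0 < α) (h : P.StronglyPositive X α) (v : Fin n → Fin q) :
    α < P.cFactor (compFinset G X) v := by
  classical
  have hsum : ∑ u : Fin n → Fin q with (∀ i ∈ G.paPlus (G.cComp X), u i = v i),
      P.cFactor (compFinset G X)ᶜ u ≤ 1 := by
    rw [← P.sum_cFactor_compl (compFinset G X)ᶜ v]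
    refine Finset.sum_le_sum_of_subset_of_nonneg ?_ fun _ _ _ => P.cFactor_nonneg _ _
    intro u hu
    simp only [Finset.mem_filter, Finset.mem_univ, true_and, Finset.mem_compl, not_not] at hu ⊢
    intro i hi
    exact hu i ((G.mem_paPlus _ _).mpr (Or.inl (mem_compFinset.mp hi)))
  calc α < ∑ u : Fin n → Fin q with (∀ i ∈ G.paPlus (G.cComp X), u i = v i),
        (P.obs u).toReal := h.lt_sum hα v
    _ = P.cFactor (compFinset G X) v * ∑ u : Fin n → Fin q with
        (∀ i ∈ G.paPlus (G.cComp X), u i = v i), P.cFactor (compFinset G X)ᶜ u := by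
      rw [Finset.mul_sum]
      refine Finset.sum_congr rfl fun u hu => ?_
      simp only [Finset.mem_filter, Finset.mem_univ, true_and] at hu
      rw [P.obs_eq_mul X]
      congr 1
      refine P.cFactor_congr fun i hi => ⟨hu i ?_, fun l hl => hu l ?_⟩
      · exact (G.mem_paPlus _ _).mpr (Or.inl (mem_compFinset.mp hi))
      · exact (G.mem_paPlus _ _).mpr (Or.inr ⟨i, mem_compFinset.mp hi, hl⟩)
    _ ≤ _ := mul_le_of_le_one_right (P.cFactor_nonneg _ _) hsum

/-- The `q` disjoint events that fix the value of `X` each have probability greater than `α`. The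
bound lets powers of `1/α` absorb powers of `q` when there are no directed edges. -/
theorem StronglyPositive.mul_lt_one {P : CausalBayesNet.{u} G q} {X : Fin n} {α : ℝ}
    (hα : 0 < α) (h : P.StronglyPositive X α) (x : Fin q) : q * α < 1 := by
  classical
  have h1 : ∀ a : Fin q, α < ∑ v : Fin n → Fin q with (v X = a), (P.obs v).toReal := by
    intro a
    refine (h.lt_sum hα fun _ => a).trans_le ?_
    refine Finset.sum_le_sum_of_subset_of_nonneg ?_ fun _ _ _ => ENNReal.toReal_nonneg
    intro v hv
    simp only [Finset.mem_filter, Finset.mem_univ, true_and] at hv ⊢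
    exact hv X ((G.mem_paPlus _ _).mpr (Or.inl (SimpleGraph.Reachable.refl _)))
  have h2 : ∑ a : Fin q, ∑ v : Fin n → Fin q with (v X = a), (P.obs v).toReal = 1 := by
    rw [Finset.sum_fiberwise, ← ENNReal.toReal_sum fun v _ => P.obs.apply_ne_top v,
      ← tsum_fintype (L := .unconditional _), PMF.tsum_coe, ENNReal.toReal_one]
  have h3 := Finset.sum_lt_sum_of_nonempty (s := Finset.univ) ⟨x, Finset.mem_univ x⟩
    fun a _ => h1 a
  rw [h2] at h3
  simpa using h3

theorem prod_condProb_nonneg (P : CausalBayesNet.{u} G q) (pos : Fin n → ℕ)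
    (V : Fin n → Fin n → Fin q) : 0 ≤ ∏ j, P.condProb pos j (V j) :=
  Finset.prod_nonneg fun j _ => P.condProb_nonneg pos j _

/-- The Bayes net obtained by intervention. -/
theorem isBayesNet_intervene {f : Fin n → (Fin n → Fin q) → ℝ} {pos : Fin n → ℕ}
    (H : IsBayesNet pos f) (X : Fin n) (x : Fin q) :
    IsBayesNet pos fun j v => f j (G.intervene X x j v) where
  inj := H.inj
  dep j v v' h := by
    refine H.dep j _ _ fun i hi => ?_
    unfold ADMG.intervene
    split_ifs
    · exact h i hi
    · by_cases hX : i = X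
      · subst hX; simp
      · simp [hX, h i hi]
  nonneg j v := H.nonneg j _
  sum_one j v := by
    unfold ADMG.intervene
    split_ifs with hr
    · exact H.sum_one j v
    · have : j ≠ X := by rintro rfl; exact hr (SimpleGraph.Reachable.refl _)
      simp only [Function.update_comm this]
      exact H.sum_one j _

/-- The change of measure from the intervened net to the observational distribution, for nonnegative
functions of the effective parents of one variable. The reason differs inside and outside the
c-component of `X`. -/
theorem sum_intervene_le_of_stronglyPositive (P : CausalBayesNet.{u} G q) {pos : Fin n → ℕ}
    (hpos : G.IsTopoOrder pos) {X : Fin n} (hid : G.Identifiable X) (x : Fin q) {α : ℝ}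
    (hα : 0 < α) (hP : P.StronglyPositive X α) (j : Fin n) (g : (Fin n → Fin q) → ℝ)
    (hg : ∀ v, 0 ≤ g v) (hgT : ∀ v v', (∀ l ∈ G.effParents pos j, v l = v' l) → g v = g v') :
    ∑ v, (∏ i, P.condProb pos i (G.intervene X x i v)) * g (G.intervene X x j v) ≤
      1 / α * ∑ v, (P.obs v).toReal * g v := by
  classical
  have hobs : ∀ v, 0 ≤ (P.obs v).toReal * g v := fun v =>
    mul_nonneg ENNReal.toReal_nonneg (hg v)
  have hq : 0 < q := x.pos
  by_cases hj : G.bi.Reachable X j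
  -- Inside the component, the effective parents are among the variables of `Z`; every assignment to
  -- them has probability at least `α`, so the maximum of `g` is at most `1/α` times its mean.
  · have h1 : ∀ v, g v ≤ 1 / α * ∑ v, (P.obs v).toReal * g v := by
      intro v
      rw [one_div, ← div_eq_inv_mul, le_div_iff₀ hα, mul_comm]
      calc α * g v ≤ (∑ u : Fin n → Fin q with (∀ i ∈ G.paPlus (G.cComp X), u i = v i),
              (P.obs u).toReal) * g v :=
            mul_le_mul_of_nonneg_right (hP.lt_sum hα v).le (hg v)
        _ = ∑ u : Fin n → Fin q with (∀ i ∈ G.paPlus (G.cComp X), u i = v i),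
              (P.obs u).toReal * g u := by
            rw [Finset.sum_mul]
            refine Finset.sum_congr rfl fun u hu => ?_
            simp only [Finset.mem_filter, Finset.mem_univ, true_and] at hu
            rw [hgT u v fun l hl => hu l ?_]
            have := ((G.mem_effParents pos j l).mp hl).1
            rw [G.mem_paPlus] at this ⊢
            rcases this with h | ⟨i, hi, hd⟩
            · exact Or.inl (hj.trans h)
            · exact Or.inr ⟨i, hj.trans hi, hd⟩
        _ ≤ _ := Finset.sum_le_sum_of_subset_of_nonneg (Finset.subset_univ _)
            fun u _ _ => hobs u
    have hs := (isBayesNet_intervene (G := G) (P.isBayesNet_condProb hpos hq) X x).sum_prod hq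
    calc _ ≤ ∑ v, (∏ i, P.condProb pos i (G.intervene X x i v)) *
          (1 / α * ∑ v, (P.obs v).toReal * g v) :=
          Finset.sum_le_sum fun v _ => mul_le_mul_of_nonneg_left (h1 _)
            (P.prod_condProb_nonneg pos _)
      _ = _ := by rw [← Finset.sum_mul, hs, one_mul]
  · have hq' : (0 : ℝ) < q := by exact_mod_cast hq
    refine le_of_mul_le_mul_left ?_ hq'
    rw [mul_left_comm, ← sum_sum_update X, ← sum_sum_update X, Finset.mul_sum]
    refine Finset.sum_le_sum fun v _ => ?_
    have e1 : ∀ a, (∏ i, P.condProb pos i (G.intervene X x i (Function.update v X a))) *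
        g (G.intervene X x j (Function.update v X a)) =
        (P.cFactor (compFinset G X) (Function.update v X a) *
        P.cFactor (compFinset G X)ᶜ (Function.update v X x)) * g (Function.update v X x) := by
      intro a
      rw [P.prod_condProb_intervene hpos]
      simp [ADMG.intervene, hj]
    simp only [e1]
    rw [← Finset.sum_mul, P.sum_cFactor_intervene hid x v]
    set vx := Function.update v X x
    -- Outside, `g` is evaluated only where `X` has the value `x`. After summing over `X`, the
    -- density of the intervened net is compared pointwise: the first c-factor is at most `1`, while
    -- the one in the observational density exceeds `α`.
    have h2 : P.cFactor ((compFinset G X).erase X) vx * P.cFactor (compFinset G X)ᶜ vx ≤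
        1 / α * (P.obs vx).toReal := by
      rw [P.obs_eq_mul X, ← mul_assoc]
      refine mul_le_mul_of_nonneg_right ?_ (P.cFactor_nonneg _ _)
      refine (P.cFactor_le_one _ _).trans ?_
      rw [one_div, ← div_eq_inv_mul, le_div_iff₀ hα, one_mul]
      exact (hP.lt_cFactor hα vx).le
    calc _ ≤ 1 / α * (P.obs vx).toReal * g vx := mul_le_mul_of_nonneg_right h2 (hg _)
      _ = 1 / α * ((P.obs vx).toReal * g vx) := mul_assoc _ _ _
      _ ≤ _ := mul_le_mul_of_nonneg_left
          (Finset.single_le_sum (f := fun a => (P.obs (Function.update v X a)).toReal *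
            g (Function.update v X a)) (fun a _ => hobs _) (Finset.mem_univ x)) (by positivity)

/-- Without directed edges no factor or effective parent outside the c-component of `X` refers to
`X`, so the intervened net coincides with the observational one and nothing is lost. -/
theorem sum_intervene_le_of_no_edges (P : CausalBayesNet.{u} G q) {pos : Fin n → ℕ}
    (hpos : G.IsTopoOrder pos) {X : Fin n} (x : Fin q) (hd : ∀ i j, ¬ G.dir i j) (j : Fin n)
    (g : (Fin n → Fin q) → ℝ)
    (hgT : ∀ v v', (∀ l ∈ G.effParents pos j, v l = v' l) → g v = g v') :
    ∑ v, (∏ i, P.condProb pos i (G.intervene X x i v)) * g (G.intervene X x j v) ≤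
      ∑ v, (P.obs v).toReal * g v := by
  classical
  refine (Finset.sum_congr rfl fun v _ => ?_).le
  have e1 : P.cFactor (compFinset G X)ᶜ (Function.update v X x) =
      P.cFactor (compFinset G X)ᶜ v := by
    refine P.cFactor_congr fun i hi => ⟨Function.update_of_ne ?_ _ _, fun l hl =>
      (hd _ _ hl).elim⟩
    rintro rfl
    simp [mem_compFinset] at hi
  rw [P.prod_condProb_intervene hpos, e1, ← P.obs_eq_mul X]
  congr 1
  refine hgT _ _ fun l hl => ?_
  unfold ADMG.intervene
  split_ifs with hr
  · rfl
  · refine Function.update_of_ne ?_ _ _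
    rintro rfl
    have := ((G.mem_effParents pos j l).mp hl).1
    rw [G.mem_paPlus] at this
    rcases this with h | ⟨i, _, h⟩
    · exact hr (SimpleGraph.Reachable.symm h)
    · exact hd _ _ h

end CausalBayesNet

/-! ### Concentration of empirical counts -/

section Concentration

variable {Ω : Type*} [MeasurableSpace Ω] (μ : Measure Ω) [IsProbabilityMeasure μ]

/-- For `|l| ≤ 1` one has `exp l ≤ 1 + l + l ^ 2`, and then `1 + t ≤ exp t`. The exponent stays
proportional to the probability of the event, which makes the deviation bound sharp for rare events.
-/
theorem lintegral_exp_indicator_le {E : Set Ω} (hE : MeasurableSet E) {l : ℝ} (hl : |l| ≤ 1) :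
    ∫⁻ ω, ENNReal.ofReal (Real.exp (E.indicator (fun _ => l) ω)) ∂μ ≤
      ENNReal.ofReal (Real.exp (μ.real E * (l + l ^ 2))) := by
  have h1 : ∀ ω, ENNReal.ofReal (Real.exp (E.indicator (fun _ => l) ω)) =
      E.indicator (fun _ => ENNReal.ofReal (Real.exp l)) ω + Eᶜ.indicator (fun _ => 1) ω := by
    intro ω
    by_cases h : ω ∈ E <;> simp [h]
  simp only [h1]
  rw [lintegral_add_left (measurable_const.indicator hE), lintegral_indicator hE,
    lintegral_indicator hE.compl]
  simp only [lintegral_const, Measure.restrict_apply_univ, one_mul]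
  have h2 : μ E = ENNReal.ofReal (μ.real E) := by simp
  have h3 : μ Eᶜ = ENNReal.ofReal (1 - μ.real E) := by
    rw [← probReal_compl_eq_one_sub hE]; simp
  have h4 : μ.real E ≤ 1 := measureReal_le_one
  have h5 : 0 ≤ μ.real E := measureReal_nonneg
  rw [h2, h3, ← ENNReal.ofReal_mul (Real.exp_pos _).le,
    ← ENNReal.ofReal_add (by positivity) (by linarith)]
  refine ENNReal.ofReal_le_ofReal ?_
  have h6 := Real.abs_exp_sub_one_sub_id_le hl
  have h7 := (abs_le.mp h6).2
  have h8 := Real.add_one_le_exp (μ.real E * (l + l ^ 2))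
  nlinarith

open Classical in
-- Markov's inequality for the exponential of `l` times the count; positive `l` gives the upper
-- tail, negative `l` the lower one.
theorem infinitePi_chernoff {E : Set Ω} (hE : MeasurableSet E) {l : ℝ} (hl : |l| ≤ 1) (N : ℕ)
    (L : ℝ) :
    Measure.infinitePi (fun _ : ℕ => μ) {S | N * μ.real E * (l + l ^ 2) + L ≤
      l * ((Finset.range N).filter fun t => S t ∈ E).card} ≤ ENNReal.ofReal (Real.exp (-L)) := by
  set f : Ω → ℝ≥0∞ := fun ω => ENNReal.ofReal (Real.exp (E.indicator (fun _ => l) ω)) with hf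
  have hfm : Measurable f :=
    ENNReal.measurable_ofReal.comp
      (Real.measurable_exp.comp (measurable_const.indicator hE))
  have hprod : ∫⁻ S, ∏ t ∈ Finset.range N, f (S t) ∂(Measure.infinitePi fun _ : ℕ => μ) =
      (∫⁻ ω, f ω ∂μ) ^ N := by
    rw [ProbabilityTheory.lintegral_prod_eq_prod_lintegral_of_indepFun _
      (fun t (S : ℕ → Ω) => f (S t))
      (ProbabilityTheory.iIndepFun_infinitePi (X := fun _ => f) fun _ => hfm)
      (fun t => hfm.comp (measurable_pi_apply t))]
    have : ∀ t : ℕ, ∫⁻ S, f (S t) ∂(Measure.infinitePi fun _ : ℕ => μ) = ∫⁻ ω, f ω ∂μ := by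
      intro t
      conv_rhs => rw [← Measure.infinitePi_map_eval (fun _ : ℕ => μ) t]
      rw [lintegral_map hfm (measurable_pi_apply t)]
    simp [this]
  have hval : ∀ S : ℕ → Ω, ∏ t ∈ Finset.range N, f (S t) = ENNReal.ofReal (Real.exp
      (l * ((Finset.range N).filter fun t => S t ∈ E).card)) := by
    intro S
    rw [← ENNReal.ofReal_prod_of_nonneg fun t _ => (Real.exp_pos _).le, ← Real.exp_sum]
    congr 2
    rw [Finset.card_filter, Nat.cast_sum, Finset.mul_sum]
    refine Finset.sum_congr rfl fun t _ => ?_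
    by_cases h : S t ∈ E <;> simp [h]
  set a := N * μ.real E * (l + l ^ 2) + L with ha
  have hmarkov := mul_meas_ge_le_lintegral (μ := Measure.infinitePi fun _ : ℕ => μ)
    (Finset.measurable_prod (Finset.range N) fun t _ => hfm.comp (measurable_pi_apply t))
    (ENNReal.ofReal (Real.exp a))
  simp only [Function.comp_def] at hmarkov
  rw [hprod] at hmarkov
  simp only [hval] at hmarkov
  have hsub : {S : ℕ → Ω | a ≤ l * ((Finset.range N).filter fun t => S t ∈ E).card} ⊆
      {S | ENNReal.ofReal (Real.exp a) ≤ ENNReal.ofReal (Real.exp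
      (l * ((Finset.range N).filter fun t => S t ∈ E).card))} := fun S hS =>
    ENNReal.ofReal_le_ofReal (Real.exp_le_exp.mpr hS)
  have h1 : (∫⁻ ω, f ω ∂μ) ^ N ≤ ENNReal.ofReal (Real.exp (a - L)) := by
    refine (pow_le_pow_left' (lintegral_exp_indicator_le μ hE hl) N).trans ?_
    rw [← ENNReal.ofReal_pow (Real.exp_pos _).le, ← Real.exp_nat_mul]
    refine ENNReal.ofReal_le_ofReal (Real.exp_le_exp.mpr (le_of_eq ?_))
    rw [ha]; ring
  have h2 : ENNReal.ofReal (Real.exp a) ≠ 0 := by simp [Real.exp_pos]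
  refine (measure_mono hsub).trans ?_
  rw [← ENNReal.mul_le_mul_iff_right h2 ENNReal.ofReal_ne_top]
  refine hmarkov.trans (h1.trans ?_)
  rw [← ENNReal.ofReal_mul (Real.exp_pos _).le, ← Real.exp_add, sub_eq_add_neg]

open Classical in
/-- A two-sided bound with a variance of the order of the mean. -/
theorem infinitePi_count_deviation {E : Set Ω} (hE : MeasurableSet E) (N : ℕ) {L : ℝ}
    (hL : 0 < L) :
    Measure.infinitePi (fun _ : ℕ => μ) {S | 4 * L * (N * μ.real E + L) <
      (((Finset.range N).filter fun t => S t ∈ E).card - N * μ.real E) ^ 2} ≤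
      ENNReal.ofReal (2 * Real.exp (-L)) := by
  set m := N * μ.real E with hm
  have hm0 : 0 ≤ m := mul_nonneg (Nat.cast_nonneg _) measureReal_nonneg
  obtain ⟨l, hl0, hl1, hl⟩ : ∃ l : ℝ, 0 < l ∧ l ≤ 1 ∧ (l ^ 2 * m + L) ^ 2 ≤
      l ^ 2 * (4 * L * (m + L)) := by
    -- The best slope is `√(L / m)`, as long as it does not exceed `1`; for means below `L` the
    -- slope `1` is enough.
    rcases le_or_gt m L with h | h
    · exact ⟨1, one_pos, le_rfl, by nlinarith⟩
    · have hmp : 0 < m := hL.trans h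
      refine ⟨√(L / m), by positivity, ?_, ?_⟩
      · rw [Real.sqrt_le_one, div_le_one hmp]; exact h.le
      · rw [Real.sq_sqrt (by positivity), div_mul_cancel₀ _ hmp.ne']
        have : L / m * (4 * L * (m + L)) = 4 * L * L + 4 * L * L * (L / m) := by field_simp
        rw [this]
        have : 0 ≤ 4 * L * L * (L / m) := by positivity
        nlinarith
  have hup := infinitePi_chernoff μ hE (l := l) (by rw [abs_of_pos hl0]; exact hl1) N L
  have hdn := infinitePi_chernoff μ hE (l := -l) (by rw [abs_neg, abs_of_pos hl0]; exact hl1) N L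
  rw [← hm] at hup hdn
  rw [two_mul, ENNReal.ofReal_add (Real.exp_pos _).le (Real.exp_pos _).le]
  refine (measure_mono ?_).trans ((measure_union_le _ _).trans (add_le_add hup hdn))
  intro S hS
  simp only [Set.mem_ofPred_eq, Set.mem_union] at hS ⊢
  set c : ℝ := (((Finset.range N).filter fun t => S t ∈ E).card : ℝ)
  have h1 : (l ^ 2 * m + L) ^ 2 ≤ (l * (c - m)) ^ 2 := by
    rw [mul_pow]
    exact hl.trans (mul_le_mul_of_nonneg_left hS.le (sq_nonneg l))
  have h3 := sq_le_sq.mp h1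
  rw [abs_of_nonneg (by positivity)] at h3
  rcases le_abs.mp h3 with h | h
  · left; nlinarith
  · right; nlinarith

end Concentration

/-- The chi-square error of smoothed frequencies whose deviations are of standard size. -/
theorem sum_chiSq_le {q : ℕ} (r : Fin q → ℝ) (hr : ∀ a, 0 ≤ r a) (sr : ∑ a, r a = 1) {m L : ℝ}
    (hm : 0 ≤ m) (hL : 0 < L) (c : Fin q → ℝ) (t : ℝ) (hc0 : ∀ a, 0 ≤ c a) (ht0 : 0 ≤ t)
    (hc : ∀ a, (c a - m * r a) ^ 2 ≤ 4 * L * (m * r a + L))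
    (ht : (t - m) ^ 2 ≤ 4 * L * (m + L)) :
    m * ∑ a, (r a - (c a + 3 * L) / (t + q * (3 * L))) ^ 2 / ((c a + 3 * L) / (t + q * (3 * L))) ≤
      312 * (q * L) := by
  -- By the inequality of the means, `2√(L(z+L)) ≤ 2L + (z+L)/2`, so `y ≥ z/2 - 5L/2`. This is why
  -- the smoothing constant is `3L`: it turns the deviation bound into a lower bound for the
  -- denominators.
  have hlow : ∀ {y z : ℝ}, 0 ≤ z → (y - z) ^ 2 ≤ 4 * L * (z + L) → (z + L) / 2 ≤ y + 3 * L := by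
    intro y z hz h
    by_contra hcon
    push Not at hcon
    have h1 : 0 < z - y - (5 / 2 * L + z / 2) := by linarith
    nlinarith [sq_nonneg (z + L - 4 * L), sq_nonneg (z - y - (5 / 2 * L + z / 2))]
  have hq1 : ∀ a : Fin q, (1 : ℝ) ≤ q := fun a => by exact_mod_cast a.pos
  rw [Finset.mul_sum]
  -- Summed over the `q` letters, with `∑ r a = 1`, this gives `204 + 108 = 312` times `qL`.
  have hterm : ∀ a, m * ((r a - (c a + 3 * L) / (t + q * (3 * L))) ^ 2 /
      ((c a + 3 * L) / (t + q * (3 * L)))) ≤ 204 * L + 108 * (L * q) * r a := by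
    intro a
    have hq := hq1 a
    set D := t + q * (3 * L) with hD
    set e := c a + 3 * L with he
    have hDpos : 0 < D := by positivity
    have hepos : 0 < e := by have := hc0 a; positivity
    have hr1 : r a ≤ 1 := by
      rw [← sr]; exact Finset.single_le_sum (fun b _ => hr b) (Finset.mem_univ a)
    have hra := hr a
    have hma : 0 ≤ m * r a := mul_nonneg hm hra
    have he' : (m * r a + L) / 2 ≤ e := hlow hma (hc a)
    have hD' : (m + q * L) / 2 ≤ D := by
      have := hlow hm ht
      nlinarith
    have e1 : m * ((r a - e / D) ^ 2 / (e / D)) = m * (r a * D - e) ^ 2 / (D * e) := by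
      field_simp
    have e2 : r a * D - e = r a * (t - m) - (c a - m * r a) + 3 * L * (r a * q - 1) := by
      rw [hD, he]; ring
    -- The square of a sum of three terms is at most three times the sum of the squares: `51 = 3 *
    -- (4 + 4 + 9)` and `27 = 3 * 9`. The lower bounds for `D` and `e` each cost a factor `2`,
    -- whence `204` and `108`.
    have h3 : (r a * D - e) ^ 2 ≤ 51 * (L * (m * r a + L)) + 27 * (L * q * r a) ^ 2 := by
      rw [e2]
      have b1 : (r a * (t - m)) ^ 2 ≤ 4 * (L * (m * r a + L)) := by
        rw [mul_pow]
        have : r a ^ 2 * (t - m) ^ 2 ≤ r a ^ 2 * (4 * L * (m + L)) :=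
          mul_le_mul_of_nonneg_left ht (sq_nonneg _)
        have h2 : r a ^ 2 ≤ r a := by nlinarith
        have h3 : r a ^ 2 * m ≤ r a * m := mul_le_mul_of_nonneg_right h2 hm
        have h4 : r a ^ 2 * L ≤ L := by nlinarith
        nlinarith
      have b2 := hc a
      have b3 : (3 * L * (r a * q - 1)) ^ 2 ≤ 9 * (L * q * r a) ^ 2 + 9 * (L * (m * r a + L)) := by
        have : 0 ≤ L * (m * r a) := by positivity
        have : 0 ≤ L * L * (r a * q) := by positivity
        nlinarith
      nlinarith [sq_nonneg (r a * (t - m) + (c a - m * r a)),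
        sq_nonneg (r a * (t - m) - 3 * L * (r a * q - 1)),
        sq_nonneg ((c a - m * r a) + 3 * L * (r a * q - 1))]
    rw [e1, div_le_iff₀ (by positivity)]
    have h4 : (m + q * L) * (m * r a + L) ≤ 4 * (D * e) := by
      have := mul_le_mul hD' he' (by positivity) hDpos.le
      linarith
    have h5 : 0 ≤ 204 * L + 108 * (L * q) * r a := by positivity
    have h6 : m * (51 * (L * (m * r a + L)) + 27 * (L * q * r a) ^ 2) ≤
        (204 * L + 108 * (L * q) * r a) * ((m + q * L) * (m * r a + L) / 4) := by
      have p1 : 0 ≤ 51 * L * (q * L) * (m * r a + L) := by positivity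
      have p2 : 27 * (L * q * r a) * (m * r a * (L * q)) ≤
          27 * (L * q * r a) * ((m + q * L) * (m * r a + L)) := by
        refine mul_le_mul_of_nonneg_left ?_ (by positivity)
        have : 0 ≤ m * (m * r a + L) := by positivity
        have : 0 ≤ q * L * L := by positivity
        nlinarith
      nlinarith
    calc m * (r a * D - e) ^ 2 ≤ m * (51 * (L * (m * r a + L)) + 27 * (L * q * r a) ^ 2) :=
          mul_le_mul_of_nonneg_left h3 hm
      _ ≤ _ := h6
      _ ≤ _ := mul_le_mul_of_nonneg_left (by linarith) h5
  refine (Finset.sum_le_sum fun a _ => hterm a).trans ?_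
  rw [Finset.sum_add_distrib, ← Finset.mul_sum (f := r), sr]
  simp
  nlinarith

/-! ### The estimated interventional distribution -/

section Estimate

variable {n q : ℕ}

theorem sum_extendAssign (X : Fin n) (F : (Fin n → Fin q) → ℝ) :
    ∑ w : {i : Fin n // i ≠ X} → Fin q, ∑ a, F (extendAssign X a w) = ∑ v, F v := by
  rw [← Fintype.sum_prod_type' (fun w a => F (extendAssign X a w))]
  refine Fintype.sum_equiv
    { toFun := fun p => extendAssign X p.2 p.1
      invFun := fun v => (fun i => v i.1, v X)
      left_inv := ?_
      right_inv := ?_ } _ _ fun p => rfl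
  · rintro ⟨w, a⟩
    refine Prod.ext (funext fun i => ?_) ?_
    · simp [extendAssign, i.2]
    · simp [extendAssign]
  · intro v
    funext i
    by_cases h : i = X
    · subst h; simp [extendAssign]
    · simp [extendAssign, h]

/-- The number of the first `N` samples that agree with `v` on `T`. -/
def agreeCount (S : ℕ → Fin n → Fin q) (N : ℕ) (T : Finset (Fin n)) (v : Fin n → Fin q) : ℕ :=
  ((Finset.range N).filter fun t => ∀ i ∈ T, S t i = v i).card

theorem agreeCount_congr (S : ℕ → Fin n → Fin q) (N : ℕ) {T : Finset (Fin n)}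
    {v v' : Fin n → Fin q} (h : ∀ i ∈ T, v i = v' i) :
    agreeCount S N T v = agreeCount S N T v' := by
  unfold agreeCount
  congr 1
  refine Finset.filter_congr fun t _ => forall₂_congr fun i hi => ?_
  rw [h i hi]

theorem sum_agreeCount_insert (S : ℕ → Fin n → Fin q) (N : ℕ) {T : Finset (Fin n)} {j : Fin n}
    (hj : j ∉ T) (v : Fin n → Fin q) :
    ∑ a, agreeCount S N (insert j T) (Function.update v j a) = agreeCount S N T v := by
  unfold agreeCount
  rw [Finset.card_eq_sum_card_fiberwise (f := fun t => S t j) (t := Finset.univ)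
    fun _ _ => by simp]
  refine Finset.sum_congr rfl fun a _ => ?_
  congr 1
  ext t
  simp only [Finset.mem_filter, Finset.mem_insert, forall_eq_or_imp, Function.update_self,
    and_assoc]
  refine and_congr_right fun _ => ?_
  rw [and_comm]
  refine and_congr_left fun _ => forall₂_congr fun i hi => ?_
  rw [Function.update_of_ne (by rintro rfl; exact hj hi)]

/-- The smoothed empirical conditional probability of the value of `j` given its effective
parents. -/
noncomputable def estimate (G : ADMG n) (pos : Fin n → ℕ) (A : ℝ) (S : ℕ → Fin n → Fin q) (N : ℕ)
    (j : Fin n) (v : Fin n → Fin q) : ℝ :=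
  (agreeCount S N (insert j (G.effParents pos j)) v + A) /
    (agreeCount S N (G.effParents pos j) v + q * A)

variable {G : ADMG n} {pos : Fin n → ℕ} {A : ℝ} (S : ℕ → Fin n → Fin q) (N : ℕ)

theorem estimate_pos (hA : 0 < A) (j : Fin n) (v : Fin n → Fin q) :
    0 < estimate G pos A S N j v := by
  have : (0 : ℝ) < q := by exact_mod_cast (v j).pos
  unfold estimate; positivity

theorem estimate_congr {j : Fin n} {v v' : Fin n → Fin q} (hj : v j = v' j)
    (h : ∀ l ∈ G.effParents pos j, v l = v' l) :
    estimate G pos A S N j v = estimate G pos A S N j v' := by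
  unfold estimate
  rw [agreeCount_congr S N h, agreeCount_congr S N (T := insert j _) (v := v) (v' := v')]
  simpa [hj] using h

theorem isBayesNet_estimate (hpos : G.IsTopoOrder pos) (hA : 0 < A) :
    IsBayesNet pos (estimate G pos A S N) where
  inj := hpos.inj
  dep j v v' h := estimate_congr S N (h j le_rfl) fun l hl =>
    h l ((G.mem_effParents pos j l).mp hl).2.le
  nonneg j v := (estimate_pos S N hA j v).le
  sum_one j v := by
    have hq : (0 : ℝ) < q := by exact_mod_cast (v j).pos
    have h1 : ∀ a, agreeCount S N (G.effParents pos j) (Function.update v j a) =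
        agreeCount S N (G.effParents pos j) v := fun a =>
      agreeCount_congr S N fun l hl => Function.update_of_ne (by
        rintro rfl; exact G.self_notMem_effParents pos _ hl) _ _
    simp only [estimate, h1]
    rw [← Finset.sum_div, Finset.sum_add_distrib, ← Nat.cast_sum,
      sum_agreeCount_insert S N (G.self_notMem_effParents pos j)]
    simp only [Finset.sum_const, Finset.card_univ, Fintype.card_fin, nsmul_eq_mul]
    exact div_self (by positivity)

/-- The estimated interventional distribution. -/
noncomputable def estDist (hpos : G.IsTopoOrder pos) (hA : 0 < A) (X : Fin n) (x : Fin q) :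
    PMF ({i : Fin n // i ≠ X} → Fin q) :=
  PMF.ofFintype (fun w => ENNReal.ofReal
    (∑ a, ∏ j, estimate G pos A S N j (G.intervene X x j (extendAssign X a w)))) (by
    have H := CausalBayesNet.isBayesNet_intervene (G := G) (isBayesNet_estimate S N hpos hA) X x
    rw [← ENNReal.ofReal_sum_of_nonneg fun w _ => Finset.sum_nonneg fun a _ =>
      Finset.prod_nonneg fun j _ => H.nonneg j _]
    rw [sum_extendAssign X fun v => ∏ j, estimate G pos A S N j (G.intervene X x j v),
      H.sum_prod x.pos, ENNReal.ofReal_one])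

theorem toReal_estDist (hpos : G.IsTopoOrder pos) (hA : 0 < A) (X : Fin n) (x : Fin q)
    (w : {i : Fin n // i ≠ X} → Fin q) :
    (estDist S N hpos hA X x w).toReal =
      ∑ a, ∏ j, estimate G pos A S N j (G.intervene X x j (extendAssign X a w)) :=
  ENNReal.toReal_ofReal (Finset.sum_nonneg fun _ _ =>
    Finset.prod_nonneg fun j _ => (estimate_pos S N hA j _).le)

/-! ### Table rows and the union bound -/

/-- Representatives of the assignments to `T`. -/
def reps (v₀ : Fin n → Fin q) (T : Finset (Fin n)) : Finset (Fin n → Fin q) :=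
  Fintype.piFinset fun i => if i ∈ T then Finset.univ else {v₀ i}

theorem card_reps (v₀ : Fin n → Fin q) (T : Finset (Fin n)) : (reps v₀ T).card = q ^ T.card := by
  rw [reps, Fintype.card_piFinset]
  have : ∀ i, (if i ∈ T then (Finset.univ : Finset (Fin q)) else {v₀ i}).card =
      if i ∈ T then q else 1 := by
    intro i; split_ifs <;> simp
  simp only [this]
  rw [Finset.prod_ite_mem]; simp

/-- The representative of `v`. -/
def toRep (v₀ : Fin n → Fin q) (T : Finset (Fin n)) (v : Fin n → Fin q) : Fin n → Fin q :=
  fun i => if i ∈ T then v i else v₀ i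

theorem toRep_mem (v₀ : Fin n → Fin q) (T : Finset (Fin n)) (v : Fin n → Fin q) :
    toRep v₀ T v ∈ reps v₀ T := by
  simp only [reps, Fintype.mem_piFinset, toRep]
  intro i; split_ifs <;> simp

theorem toRep_eq_iff {v₀ : Fin n → Fin q} {T : Finset (Fin n)} {u z : Fin n → Fin q}
    (hz : z ∈ reps v₀ T) : toRep v₀ T u = z ↔ ∀ i ∈ T, u i = z i := by
  simp only [reps, Fintype.mem_piFinset] at hz
  constructor
  · rintro rfl i hi; simp [toRep, hi]
  · intro h; funext i
    have := hz i
    by_cases hi : i ∈ T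
    · simp [toRep, hi, h i hi]
    · simp only [hi, if_false, Finset.mem_singleton] at this
      simp [toRep, hi, this]

/-- The probability that a sample agrees with `v` on `T`. -/
noncomputable def agreeProb (p : PMF (Fin n → Fin q)) (T : Finset (Fin n)) (v : Fin n → Fin q) :
    ℝ := p.toMeasure.real {u | ∀ i ∈ T, u i = v i}

theorem agreeProb_eq_sum (p : PMF (Fin n → Fin q)) (T : Finset (Fin n)) (v : Fin n → Fin q) :
    agreeProb p T v = ∑ u, (p u).toReal * if (∀ i ∈ T, u i = v i) then 1 else 0 := by
  classical
  unfold agreeProb Measure.real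
  rw [PMF.toMeasure_apply_fintype, ENNReal.toReal_sum]
  · refine Finset.sum_congr rfl fun u _ => ?_
    by_cases h : ∀ i ∈ T, u i = v i
    · rw [Set.indicator_of_mem (by exact h), if_pos h, mul_one]
    · rw [Set.indicator_of_notMem (by exact h), if_neg h, mul_zero, ENNReal.toReal_zero]
  · intro u _
    exact ne_top_of_le_ne_top (p.apply_ne_top u) (Set.indicator_le_self _ _ u)

/-- Grouping by the values on `T` turns a mean into a sum over table rows, so that each row can be
bounded together with its probability. -/
theorem sum_mul_eq_sum_reps (p : PMF (Fin n → Fin q)) (T : Finset (Fin n)) (v₀ : Fin n → Fin q)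
    (g : (Fin n → Fin q) → ℝ) (hg : ∀ v v', (∀ l ∈ T, v l = v' l) → g v = g v') :
    ∑ v, (p v).toReal * g v = ∑ z ∈ reps v₀ T, agreeProb p T z * g z := by
  rw [← Finset.sum_fiberwise_of_maps_to (t := reps v₀ T) (g := toRep v₀ T)
    fun v _ => toRep_mem v₀ T v]
  refine Finset.sum_congr rfl fun z hz => ?_
  rw [agreeProb_eq_sum, Finset.sum_mul, Finset.sum_filter]
  refine Finset.sum_congr rfl fun u _ => ?_
  by_cases h : ∀ i ∈ T, u i = z i
  · rw [if_pos ((toRep_eq_iff hz).mpr h), if_pos h, mul_one, hg u z h]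
  · rw [if_neg (fun e => h ((toRep_eq_iff hz).mp e)), if_neg h]; simp

/-- The count of the samples that agree with `v` on `T` deviates as expected from its mean. -/
def GoodCount (p : PMF (Fin n → Fin q)) (L : ℝ) (T : Finset (Fin n)) (v : Fin n → Fin q) : Prop :=
  (agreeCount S N T v - N * agreeProb p T v) ^ 2 ≤ 4 * L * (N * agreeProb p T v + L)

theorem goodCount_congr {p : PMF (Fin n → Fin q)} {L : ℝ} {T : Finset (Fin n)}
    {v v' : Fin n → Fin q} (h : ∀ i ∈ T, v i = v' i) :
    GoodCount S N p L T v ↔ GoodCount S N p L T v' := by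
  unfold GoodCount
  have : agreeProb p T v = agreeProb p T v' := by
    unfold agreeProb; congr 1; ext u
    exact forall₂_congr fun i hi => by rw [h i hi]
  rw [this, agreeCount_congr S N h]

theorem sampleLaw_not_goodCount_le (p : PMF (Fin n → Fin q)) {L : ℝ} (hL : 0 < L)
    (T : Finset (Fin n)) (v : Fin n → Fin q) :
    sampleLaw p {S | ¬ GoodCount S N p L T v} ≤ ENNReal.ofReal (2 * Real.exp (-L)) := by
  have := infinitePi_count_deviation p.toMeasure (E := {u | ∀ i ∈ T, u i = v i})
    (Set.toFinite _).measurableSet N hL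
  refine (measure_mono ?_).trans this
  intro S hS
  simp only [GoodCount, not_le, Set.mem_ofPred_eq] at hS ⊢
  refine lt_of_lt_of_eq hS ?_
  unfold agreeCount agreeProb
  congr 4

/-- Each variable has at most `q ^ (card + 1)` count events of either kind, and each fails with
probability at most `2 * exp (-L)`; this explains the `4` in the condition on `L`. -/
theorem sampleLaw_union_bound (p : PMF (Fin n → Fin q)) (v₀ : Fin n → Fin q) {L δ : ℝ}
    (hL : 0 < L) (hδ : 4 * ∑ j, (q : ℝ) ^ ((G.effParents pos j).card + 1) ≤ Real.exp L * δ) :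
    sampleLaw p {S | ¬ ∀ j v, GoodCount S N p L (G.effParents pos j) v ∧
      GoodCount S N p L (insert j (G.effParents pos j)) v} ≤ ENNReal.ofReal δ := by
  have hsub : {S | ¬ ∀ j v, GoodCount S N p L (G.effParents pos j) v ∧
      GoodCount S N p L (insert j (G.effParents pos j)) v} ⊆
      ⋃ j ∈ (Finset.univ : Finset (Fin n)),
        ((⋃ z ∈ reps v₀ (G.effParents pos j), {S | ¬ GoodCount S N p L (G.effParents pos j) z}) ∪
        ⋃ z ∈ reps v₀ (insert j (G.effParents pos j)),
          {S | ¬ GoodCount S N p L (insert j (G.effParents pos j)) z}) := by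
    intro S hS
    by_contra hcon
    apply hS
    have hz : ∀ T : Finset (Fin n), (∀ z ∈ reps v₀ T, GoodCount S N p L T z) →
        ∀ v, GoodCount S N p L T v := by
      intro T hT v
      refine (goodCount_congr S N ?_).mpr (hT _ (toRep_mem v₀ T v))
      intro i hi; simp [toRep, hi]
    simp only [Finset.mem_univ, Set.iUnion_true, Set.mem_iUnion, Set.mem_union, not_exists,
      not_or] at hcon
    intro j v
    refine ⟨hz _ (fun z hzz => ?_) v, hz _ (fun z hzz => ?_) v⟩
    · by_contra h; exact (hcon j).1 z hzz h
    · by_contra h; exact (hcon j).2 z hzz h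
  refine (measure_mono hsub).trans ?_
  have hT : ∀ T : Finset (Fin n), sampleLaw p (⋃ z ∈ reps v₀ T, {S | ¬ GoodCount S N p L T z}) ≤
      ENNReal.ofReal ((q : ℝ) ^ T.card * (2 * Real.exp (-L))) := by
    intro T
    refine (measure_biUnion_finset_le _ _).trans
      ((Finset.sum_le_sum fun z _ => sampleLaw_not_goodCount_le N p hL T z).trans ?_)
    rw [Finset.sum_const, card_reps, nsmul_eq_mul,
      ENNReal.ofReal_mul (p := (q : ℝ) ^ T.card) (by positivity),
      ENNReal.ofReal_pow (Nat.cast_nonneg q)]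
    simp
  have hj : ∀ j : Fin n, sampleLaw p
      ((⋃ z ∈ reps v₀ (G.effParents pos j), {S | ¬ GoodCount S N p L (G.effParents pos j) z}) ∪
        ⋃ z ∈ reps v₀ (insert j (G.effParents pos j)),
          {S | ¬ GoodCount S N p L (insert j (G.effParents pos j)) z}) ≤
      ENNReal.ofReal (4 * Real.exp (-L) * (q : ℝ) ^ ((G.effParents pos j).card + 1)) := by
    intro j
    have hq : (1 : ℝ) ≤ q := by exact_mod_cast (v₀ j).pos
    refine (measure_union_le _ _).trans ((add_le_add (hT _) (hT _)).trans ?_)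
    rw [← ENNReal.ofReal_add (by positivity) (by positivity),
      Finset.card_insert_of_notMem (G.self_notMem_effParents pos j)]
    refine ENNReal.ofReal_le_ofReal ?_
    have h1 : (q : ℝ) ^ (G.effParents pos j).card ≤ (q : ℝ) ^ ((G.effParents pos j).card + 1) :=
      pow_le_pow_right₀ hq (by omega)
    nlinarith [Real.exp_pos (-L)]
  refine (measure_biUnion_finset_le _ _).trans ((Finset.sum_le_sum fun j _ => hj j).trans ?_)
  rw [← ENNReal.ofReal_sum_of_nonneg fun j _ => by positivity]
  refine ENNReal.ofReal_le_ofReal ?_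
  rw [← Finset.mul_sum]
  have h1 : Real.exp (-L) * Real.exp L = 1 := by rw [← Real.exp_add]; simp
  have h2 := mul_le_mul_of_nonneg_left hδ (Real.exp_pos (-L)).le
  rw [← mul_assoc (Real.exp (-L)) (Real.exp L), h1] at h2
  linarith

theorem agreeProb_nonneg (p : PMF (Fin n → Fin q)) (T : Finset (Fin n)) (v : Fin n → Fin q) :
    0 ≤ agreeProb p T v := measureReal_nonneg

/-- Averaging over the value of `j` given everything before it shows that `condProb`, defined by
c-factors, is the observational conditional probability given the effective parents. This connects
the counts with the quantity to be learnt. -/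
theorem agreeProb_insert (P : CausalBayesNet.{u} G q) (hpos : G.IsTopoOrder pos) (j : Fin n)
    (v : Fin n → Fin q) (a : Fin q) :
    agreeProb P.obs (insert j (G.effParents pos j)) (Function.update v j a) =
      agreeProb P.obs (G.effParents pos j) v * P.condProb pos j (Function.update v j a) := by
  have hjT := G.self_notMem_effParents pos j
  have hne : ∀ l ∈ G.effParents pos j, l ≠ j := by rintro l hl rfl; exact hjT hl
  rw [agreeProb_eq_sum, agreeProb_eq_sum, Finset.sum_mul]
  simp only [P.toReal_obs_eq_prod hpos]
  rw [(P.isBayesNet_condProb hpos a.pos).sum_prod_cond a.pos j]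
  · refine Finset.sum_congr rfl fun u _ => ?_
    rw [mul_assoc]
    congr 1
    rw [Finset.sum_eq_single a]
    · by_cases h : ∀ i ∈ G.effParents pos j, u i = v i
      · rw [if_pos h, if_pos, mul_one, one_mul]
        · refine P.condProb_congr hpos (by simp) fun l hl => ?_
          simp [hne l hl, h l hl]
        · simp only [Finset.mem_insert, forall_eq_or_imp, Function.update_self, true_and]
          intro i hi; simp [hne i hi, h i hi]
      · rw [if_neg h, if_neg, mul_zero, zero_mul]
        intro hcon
        refine h fun i hi => ?_
        simpa [hne i hi] using hcon i (Finset.mem_insert_of_mem hi)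
    · intro b _ hb
      rw [if_neg, mul_zero]
      intro hcon
      exact hb (by simpa using hcon j (Finset.mem_insert_self _ _))
    · simp
  · intro s hs u b
    have : (∀ i ∈ insert j (G.effParents pos j), Function.update u s b i =
        Function.update v j a i) ↔
        ∀ i ∈ insert j (G.effParents pos j), u i = Function.update v j a i := by
      refine forall₂_congr fun i hi => ?_
      rw [Function.update_of_ne]
      rintro rfl
      rcases Finset.mem_insert.mp hi with rfl | hi
      · omega
      · have := ((G.mem_effParents pos j i).mp hi).2; omega
    simp only [this]

/-! ### The error of the estimated distribution -/

theorem intervene_update (X : Fin n) (x : Fin q) (j : Fin n) (v : Fin n → Fin q) (a : Fin q) :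
    G.intervene X x j (Function.update v j a) = Function.update (G.intervene X x j v) j a := by
  unfold ADMG.intervene
  split_ifs with hr
  · rfl
  · rw [Function.update_comm]
    rintro rfl; exact hr (SimpleGraph.Reachable.refl _)

/-- If all counts deviate as expected, the estimate is accurate. -/
theorem tvDist_estDist_le (P : CausalBayesNet.{u} G q) (hpos : G.IsTopoOrder pos) {X : Fin n}
    (hid : G.Identifiable X) (x : Fin q) {L ρ ε : ℝ} (hL : 0 < L) (hA : 0 < 3 * L) (hρ : 0 ≤ ρ)
    (hε : 0 < ε) (hN : 0 < N)
    (hratio : ∀ (j : Fin n) (g : (Fin n → Fin q) → ℝ), (∀ v, 0 ≤ g v) →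
      (∀ v v', (∀ l ∈ G.effParents pos j, v l = v' l) → g v = g v') →
      ∑ v, (∏ i, P.condProb pos i (G.intervene X x i v)) * g (G.intervene X x j v) ≤
        ρ * ∑ v, (P.obs v).toReal * g v)
    (hNε : 312 * (∑ j, (q : ℝ) ^ ((G.effParents pos j).card + 1)) * L * ρ ≤ N * ε ^ 2)
    (hgood : ∀ j v, GoodCount S N P.obs L (G.effParents pos j) v ∧
      GoodCount S N P.obs L (insert j (G.effParents pos j)) v) :
    tvDist (P.doDist X x) (estDist S N hpos hA X x) ≤ ε := by
  have hq : 0 < q := x.pos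
  have hN' : (0 : ℝ) < N := by exact_mod_cast hN
  set r := P.condProb pos with hr
  set p := estimate G pos (3 * L) S N with hp
  have Hr : IsBayesNet pos r := P.isBayesNet_condProb hpos hq
  have Hp : IsBayesNet pos p := isBayesNet_estimate S N hpos hA
  have Hr' := CausalBayesNet.isBayesNet_intervene (G := G) Hr X x
  have Hp' := CausalBayesNet.isBayesNet_intervene (G := G) Hp X x
  have hppos : ∀ j v, 0 < p j v := fun j v => estimate_pos S N hA j v
  set B : (Fin n → Fin q) → ℝ := fun v => ∏ j, r j (G.intervene X x j v) with hB
  set B' : (Fin n → Fin q) → ℝ := fun v => ∏ j, p j (G.intervene X x j v) with hB'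
  have hBnn : ∀ v, 0 ≤ B v := fun v => Finset.prod_nonneg fun j _ => Hr.nonneg j _
  have hB'pos : ∀ v, 0 < B' v := fun v => Finset.prod_pos fun j _ => hppos j _
  -- Both distributions are marginals of nets on all variables, and summing out `X` does not
  -- increase the distance.
  have htv : tvDist (P.doDist X x) (estDist S N hpos hA X x) ≤ 1 / 2 * ∑ v, |B v - B' v| := by
    unfold tvDist
    refine mul_le_mul_of_nonneg_left ?_ (by norm_num)
    rw [← sum_extendAssign X]
    refine Finset.sum_le_sum fun w _ => ?_
    rw [P.toReal_doDist_eq_sum hpos hid, toReal_estDist, ← Finset.sum_sub_distrib]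
    exact Finset.abs_sum_le_sum_abs _ _
  have hsq := sum_abs_sub_sq_le B B' hBnn hB'pos (Hr'.sum_prod hq) (Hp'.sum_prod hq)
  have hkl : ∑ v, B v * Real.log (B v / B' v) =
      ∑ j, ∑ v, B v * Real.log (r j (G.intervene X x j v) / p j (G.intervene X x j v)) := by
    rw [Finset.sum_comm]
    refine Finset.sum_congr rfl fun v _ => ?_
    rw [← Finset.mul_sum]
    -- The logarithm of the product splits only if no factor vanishes; otherwise the weight `B v` is
    -- zero and both sides are.
    by_cases h0 : B v = 0
    · simp [h0]
    · congr 1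
      have hne : ∀ j ∈ (Finset.univ : Finset (Fin n)), r j (G.intervene X x j v) ≠ 0 :=
        Finset.prod_ne_zero_iff.mp h0
      rw [← Real.log_prod fun j hj => div_ne_zero (hne j hj) (hppos j _).ne',
        Finset.prod_div_distrib]
  have hone : ∀ j, ∑ v, B v * Real.log (r j (G.intervene X x j v) / p j (G.intervene X x j v)) ≤
      ρ * ((q : ℝ) ^ ((G.effParents pos j).card + 1) * (312 * L / N)) := by
    intro j
    set T := G.effParents pos j with hT
    have hjT : j ∉ T := G.self_notMem_effParents pos j
    have hne : ∀ l ∈ T, l ≠ j := by rintro l hl rfl; exact hjT hl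
    set ℓ : (Fin n → Fin q) → ℝ := fun v => Real.log (r j v / p j v) with hℓ
    set κ : (Fin n → Fin q) → ℝ := fun v =>
      ∑ a, r j (Function.update v j a) * ℓ (Function.update v j a) with hκ
    set χ : (Fin n → Fin q) → ℝ := fun v =>
      ∑ a, (r j (Function.update v j a) - p j (Function.update v j a)) ^ 2 /
        p j (Function.update v j a) with hχ
    have hrT : ∀ v v', (∀ l ∈ T, v l = v' l) → ∀ a,
        r j (Function.update v j a) = r j (Function.update v' j a) := fun v v' h a =>
      P.condProb_congr hpos (by simp) fun l hl => by simp [hne l hl, h l hl]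
    have hpT : ∀ v v', (∀ l ∈ T, v l = v' l) → ∀ a,
        p j (Function.update v j a) = p j (Function.update v' j a) := fun v v' h a =>
      estimate_congr S N (by simp) fun l hl => by simp [hne l hl, h l hl]
    have hκT : ∀ v v', (∀ l ∈ T, v l = v' l) → κ v = κ v' := fun v v' h => by
      simp only [hκ, hℓ, hrT v v' h, hpT v v' h]
    have hχT : ∀ v v', (∀ l ∈ T, v l = v' l) → χ v = χ v' := fun v v' h => by
      simp only [hχ, hrT v v' h, hpT v v' h]
    have hκ0 : ∀ v, 0 ≤ κ v := fun v => sum_mul_log_div_nonneg _ _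
      (fun a => Hr.nonneg j _) (fun a => hppos j _) (Hr.sum_one j v) (Hp.sum_one j v)
    have hκχ : ∀ v, κ v ≤ χ v := fun v => sum_mul_log_div_le _ _
      (fun a => Hr.nonneg j _) (fun a => hppos j _) (Hr.sum_one j v) (Hp.sum_one j v)
    -- The chi-square error of a row is inversely proportional to the probability of the row, so
    -- their product has a bound that is uniform in the rows.
    have hz : ∀ z, agreeProb P.obs T z * χ z ≤ 312 * (q * L) / N := by
      intro z
      rw [le_div_iff₀ hN']
      have hchi := sum_chiSq_le (fun a => r j (Function.update z j a)) (fun a => Hr.nonneg j _)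
        (Hr.sum_one j z) (m := N * agreeProb P.obs T z) (L := L)
        (mul_nonneg hN'.le (agreeProb_nonneg _ _ _)) hL
        (fun a => agreeCount S N (insert j T) (Function.update z j a)) (agreeCount S N T z)
        (fun a => Nat.cast_nonneg _) (Nat.cast_nonneg _) (fun a => ?_) ((hgood j z).1)
      · have hcz : ∀ a, agreeCount S N T (Function.update z j a) = agreeCount S N T z := fun a =>
          agreeCount_congr S N fun l hl => Function.update_of_ne (hne l hl) _ _
        have : χ z = ∑ a, (r j (Function.update z j a) -
            (agreeCount S N (insert j T) (Function.update z j a) + 3 * L) /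
              (agreeCount S N T z + q * (3 * L))) ^ 2 /
            ((agreeCount S N (insert j T) (Function.update z j a) + 3 * L) /
              (agreeCount S N T z + q * (3 * L))) := by
          simp only [hχ, hp, estimate, ← hT, hcz]
        rw [this]
        linarith
      · have := (hgood j (Function.update z j a)).2
        unfold GoodCount at this
        rw [agreeProb_insert P hpos, ← hT, ← mul_assoc] at this
        exact this
    have hbound : ∑ v, (P.obs v).toReal * χ v ≤
        (q : ℝ) ^ (T.card + 1) * (312 * L / N) := by
      rw [sum_mul_eq_sum_reps P.obs T (fun _ => x) χ hχT]
      refine (Finset.sum_le_sum fun z _ => hz z).trans (le_of_eq ?_)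
      rw [Finset.sum_const, card_reps, nsmul_eq_mul]
      push_cast; ring
    -- Averaging first over `j` itself replaces the log-ratio, which has no sign, by the relative
    -- entropy `κ` of a row, which is nonnegative and depends only on the effective parents. Only
    -- then can the change of measure be applied.
    calc ∑ v, B v * ℓ (G.intervene X x j v) = ∑ v, B v * κ (G.intervene X x j v) := by
          rw [hB, Hr'.sum_prod_cond hq j (fun v => ℓ (G.intervene X x j v))]
          · simp only [intervene_update, hκ]
          · intro s hs v a
            have hdep : ∀ f : Fin n → (Fin n → Fin q) → ℝ, IsBayesNet pos f →
                f j (G.intervene X x j (Function.update v s a)) = f j (G.intervene X x j v) :=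
              fun f H => (CausalBayesNet.isBayesNet_intervene (G := G) H X x).update_eq hs v a
            simp only [hℓ, hdep r Hr, hdep p Hp]
      _ ≤ ρ * ∑ v, (P.obs v).toReal * κ v := hratio j κ hκ0 hκT
      _ ≤ ρ * ∑ v, (P.obs v).toReal * χ v := by
          refine mul_le_mul_of_nonneg_left (Finset.sum_le_sum fun v _ => ?_) hρ
          exact mul_le_mul_of_nonneg_left (hκχ v) ENNReal.toReal_nonneg
      _ ≤ _ := mul_le_mul_of_nonneg_left hbound hρ
  have hfin : ∑ v, B v * Real.log (B v / B' v) ≤ ε ^ 2 := by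
    rw [hkl]
    refine (Finset.sum_le_sum fun j _ => hone j).trans ?_
    rw [← Finset.mul_sum, ← Finset.sum_mul]
    have : ρ * ((∑ j, (q : ℝ) ^ ((G.effParents pos j).card + 1)) * (312 * L / N)) =
        312 * (∑ j, (q : ℝ) ^ ((G.effParents pos j).card + 1)) * L * ρ / N := by ring
    rw [this, div_le_iff₀ hN']
    linarith
  have h2 : (∑ v, |B v - B' v|) ≤ 2 * ε := by
    refine abs_le_of_sq_le_sq' ?_ (by positivity) |>.2
    nlinarith
  linarith

end Estimate

/-! ### Reasoning about programs -/

namespace RealRAM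

/-- The law of the generator speaks of the event that some run has a given result; determinism
identifies that run with the one constructed. -/
theorem Exec.deterministic {E : Env} {c : Cmd} {s s₁ s₂ : State} {t₁ t₂ : ℕ}
    (h₁ : Exec E c s t₁ s₁) (h₂ : Exec E c s t₂ s₂) : t₁ = t₂ ∧ s₁ = s₂ := by
  induction h₁ generalizing t₂ s₂ with
  | skip | setNat | setReal | draw | toss => cases h₂; exact ⟨rfl, rfl⟩
  | seq _ _ ih₁ ih₂ =>
    cases h₂ with
    | seq a b =>
      obtain ⟨rfl, rfl⟩ := ih₁ a
      obtain ⟨rfl, rfl⟩ := ih₂ b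
      exact ⟨rfl, rfl⟩
  | iteTrue hb _ ih | iteFalse hb _ ih =>
    cases h₂ with
    | iteTrue hb' a =>
      first
      | exact absurd hb' hb
      | (obtain ⟨rfl, rfl⟩ := ih a; exact ⟨rfl, rfl⟩)
    | iteFalse hb' a =>
      first
      | exact absurd hb hb'
      | (obtain ⟨rfl, rfl⟩ := ih a; exact ⟨rfl, rfl⟩)
  | whileTrue hb _ _ ih₁ ih₂ =>
    cases h₂ with
    | whileTrue hb' a b =>
      obtain ⟨rfl, rfl⟩ := ih₁ a
      obtain ⟨rfl, rfl⟩ := ih₂ b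
      exact ⟨rfl, rfl⟩
    | whileFalse hb' => exact absurd hb hb'
  | whileFalse hb =>
    cases h₂ with
    | whileTrue hb' a b => exact absurd hb' hb
    | whileFalse hb' => exact ⟨rfl, rfl⟩

/-- Started in `s`, the program halts within `T` steps in a state that satisfies `Q`. -/
def Runs (E : Env) (c : Cmd) (s : State) (T : ℕ) (Q : State → Prop) : Prop :=
  ∃ t s', Exec E c s t s' ∧ t ≤ T ∧ Q s'

theorem Runs.mono {E : Env} {c : Cmd} {s : State} {T T' : ℕ} {Q Q' : State → Prop}
    (h : Runs E c s T Q) (hT : T ≤ T') (hQ : ∀ s', Q s' → Q' s') : Runs E c s T' Q' := by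
  obtain ⟨t, s', he, ht, hq⟩ := h
  exact ⟨t, s', he, ht.trans hT, hQ s' hq⟩

theorem Runs.seq {E : Env} {c₁ c₂ : Cmd} {s : State} {T₁ T₂ : ℕ} {Q₁ Q : State → Prop}
    (h₁ : Runs E c₁ s T₁ Q₁) (h₂ : ∀ s', Q₁ s' → Runs E c₂ s' T₂ Q) :
    Runs E (.seq c₁ c₂) s (T₁ + T₂) Q := by
  obtain ⟨t, s', he, ht, hq⟩ := h₁
  obtain ⟨t', s'', he', ht', hq'⟩ := h₂ s' hq
  exact ⟨t + t', s'', .seq he he', by omega, hq'⟩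

/-- Weakest preconditions of programs without loops. -/
def wp (E : Env) : Cmd → (State → Prop) → State → Prop
  | .skip, Q, s => Q s
  | .setNat a e, Q, s => Q { s with nat := Function.update s.nat (a.eval E s) (e.eval E s) }
  | .setReal a e, Q, s => Q { s with real := Function.update s.real (a.eval E s) (e.eval E s) }
  | .draw a, Q, s => Q { s with
      nat := fun c => if a.eval E s ≤ c ∧ c < a.eval E s + E.width
        then E.samples s.drawn (c - a.eval E s) else s.nat c
      drawn := s.drawn + 1 }
  | .toss a, Q, s => Q { s with
      real := Function.update s.real (a.eval E s) (E.coins s.tossed)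
      tossed := s.tossed + 1 }
  | .seq c₁ c₂, Q, s => wp E c₁ (wp E c₂ Q) s
  | .ite b c₁ c₂, Q, s => (b.Holds E s → wp E c₁ Q s) ∧ (¬ b.Holds E s → wp E c₂ Q s)
  | .while _ _, _, _ => False

/-- A bound for the running time of programs without loops. -/
def Cmd.bound (width : ℕ) : Cmd → ℕ
  | .skip => 1
  | .setNat a e => a.cost + e.cost + 1
  | .setReal a e => a.cost + e.cost + 1
  | .draw a => a.cost + width + 1
  | .toss a => a.cost + 1
  | .seq c₁ c₂ => c₁.bound width + c₂.bound width
  | .ite b c₁ c₂ => b.cost + (c₁.bound width + c₂.bound width)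
  | .while _ _ => 0

theorem runs_of_wp {E : Env} {c : Cmd} {Q : State → Prop} {s : State} (h : wp E c Q s) :
    Runs E c s (c.bound E.width) Q := by
  induction c generalizing Q s with
  | skip => exact ⟨_, _, .skip s, le_rfl, h⟩
  | setNat a e => exact ⟨_, _, .setNat a e s, le_rfl, h⟩
  | setReal a e => exact ⟨_, _, .setReal a e s, le_rfl, h⟩
  | draw a => exact ⟨_, _, .draw a s, le_rfl, h⟩
  | toss a => exact ⟨_, _, .toss a s, le_rfl, h⟩
  | seq c₁ c₂ ih₁ ih₂ => exact (ih₁ h).seq fun s' hs' => ih₂ hs'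
  | ite b c₁ c₂ ih₁ ih₂ =>
    by_cases hb : b.Holds E s
    · obtain ⟨t, s', he, ht, hq⟩ := ih₁ (h.1 hb)
      exact ⟨_, _, .iteTrue hb he, by simp only [Cmd.bound]; omega, hq⟩
    · obtain ⟨t, s', he, ht, hq⟩ := ih₂ (h.2 hb)
      exact ⟨_, _, .iteFalse hb he, by simp only [Cmd.bound]; omega, hq⟩
  | _ => exact h.elim

/-! Sixteen interleaved arrays of natural numbers, stored above the cells `0, …, n`, where `n` is
the first input. -/

/-- Entry `i` of array `r`. -/
def get (E : Env) (s : State) (r : Fin 16) (i : ℕ) : ℕ :=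
  s.nat (E.natIn 0 + 1 + (16 * i + r))

/-- Overwrites entry `i` of array `r`. -/
def put (E : Env) (s : State) (r : Fin 16) (i v : ℕ) : State :=
  { s with nat := Function.update s.nat (E.natIn 0 + 1 + (16 * i + r)) v }

theorem get_put (E : Env) (s : State) (r r' : Fin 16) (i i' v : ℕ) :
    get E (put E s r i v) r' i' = if r' = r ∧ i' = i then v else get E s r' i' := by
  unfold get put
  have : (E.natIn 0 + 1 + (16 * i' + r') = E.natIn 0 + 1 + (16 * i + r)) ↔ r' = r ∧ i' = i := by
    rw [Fin.ext_iff]; omega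
  simp only [Function.update_apply, this]

theorem put_nat_of_le {E : Env} (s : State) (r : Fin 16) (i v : ℕ) {c : ℕ} (h : c ≤ E.natIn 0) :
    (put E s r i v).nat c = s.nat c := by
  unfold put
  exact Function.update_of_ne (by omega) _ _

theorem put_drawn (E : Env) (s : State) (r : Fin 16) (i v : ℕ) :
    (put E s r i v).drawn = s.drawn := rfl

theorem put_tossed (E : Env) (s : State) (r : Fin 16) (i v : ℕ) :
    (put E s r i v).tossed = s.tossed := rfl

theorem put_real (E : Env) (s : State) (r : Fin 16) (i v : ℕ) :
    (put E s r i v).real = s.real := rfl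

/-- The address of entry `i` of array `r`. -/
def adr (r : Fin 16) (i : NExp) : NExp :=
  .add (.add (.natIn (.const 0)) (.const 1)) (.add (.mul (.const 16) i) (.const r))

/-- Reads entry `i` of array `r`. -/
def rd (r : Fin 16) (i : NExp) : NExp := .mem (adr r i)

/-- Writes entry `i` of array `r`. -/
def wr (r : Fin 16) (i e : NExp) : Cmd := .setNat (adr r i) e

/-- The number of variables. -/
def nE : NExp := .natIn (.const 0)

/-- The scalar variable `v`. -/
def sc (v : ℕ) : NExp := rd 0 (.const v)

theorem eval_adr (E : Env) (s : State) (r : Fin 16) (i : NExp) :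
    (adr r i).eval E s = E.natIn 0 + 1 + (16 * i.eval E s + r) := rfl

theorem eval_rd (E : Env) (s : State) (r : Fin 16) (i : NExp) :
    (rd r i).eval E s = get E s r (i.eval E s) := rfl

theorem eval_sc (E : Env) (s : State) (v : ℕ) : (sc v).eval E s = get E s 0 v := rfl

theorem eval_nE (E : Env) (s : State) : nE.eval E s = E.natIn 0 := rfl

theorem wp_wr (E : Env) (r : Fin 16) (i e : NExp) (Q : State → Prop) (s : State) :
    wp E (wr r i e) Q s = Q (put E s r (i.eval E s) (e.eval E s)) := rfl

theorem cost_adr (r : Fin 16) (i : NExp) : (adr r i).cost = i.cost + 9 := by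
  simp [adr, NExp.cost]; omega

theorem cost_rd (r : Fin 16) (i : NExp) : (rd r i).cost = i.cost + 10 := by
  simp [rd, NExp.cost, cost_adr]

theorem cost_sc (v : ℕ) : (sc v).cost = 11 := rfl

theorem cost_nE : nE.cost = 2 := rfl

theorem bound_wr (w : ℕ) (r : Fin 16) (i e : NExp) :
    (wr r i e).bound w = i.cost + e.cost + 10 := by
  simp [wr, Cmd.bound, cost_adr]; omega

/-- A loop in which the scalar variable `v` runs from `0` to `b - 1`. -/
def forC (v : ℕ) (b : NExp) (c : Cmd) : Cmd :=
  .seq (wr 0 (.const v) (.const 0))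
    (.while (.natLt (sc v) b) (.seq c (wr 0 (.const v) (.add (sc v) (.const 1)))))

/-- The counter lives in the memory that the invariant describes, so the invariant is asked for
right after the counter has been written. The body may read the counter but has to leave its value
unchanged. -/
theorem runs_forC {E : Env} {v : ℕ} {b : NExp} {c : Cmd} {s : State} (N : ℕ)
    (Inv : ℕ → State → Prop) (τ : ℕ → ℕ) (h0 : Inv 0 (put E s 0 v 0))
    (hb : ∀ i s', i ≤ N → Inv i s' → b.eval E s' = N)
    (hstep : ∀ i s', i < N → Inv i s' → get E s' 0 v = i → Runs E c s' (τ i)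
      fun s'' => get E s'' 0 v = i ∧ Inv (i + 1) (put E s'' 0 v (i + 1))) :
    Runs E (forC v b c) s (24 + b.cost + ∑ i ∈ Finset.range N, (τ i + 36 + b.cost))
      fun s' => Inv N s' ∧ get E s' 0 v = N := by
  have key : ∀ m i, i + m = N → ∀ s', Inv i s' → get E s' 0 v = i →
      Runs E (.while (.natLt (sc v) b) (.seq c (wr 0 (.const v) (.add (sc v) (.const 1))))) s'
        (12 + b.cost + ∑ l ∈ Finset.Ico i N, (τ l + 36 + b.cost))
        fun s' => Inv N s' ∧ get E s' 0 v = N := by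
    intro m
    induction m with
    | zero =>
      rintro i hi s' hinv hv
      obtain rfl : i = N := by omega
      refine ⟨_, s', .whileFalse ?_, ?_, hinv, hv⟩
      · simp only [BExp.Holds, eval_sc, hv, hb i s' le_rfl hinv, lt_irrefl, not_false_iff]
      · simp [BExp.cost, cost_sc]
    | succ m ih =>
      intro i hi s' hinv hv
      obtain ⟨t, s₁, he, ht, hv₁, hinv₁⟩ := hstep i s' (by omega) hinv hv
      obtain ⟨t', s₂, he', ht', hq⟩ := ih (i + 1) (by omega) _ hinv₁ (by simp [get_put])
      have hw : Exec E (wr 0 (.const v) (.add (sc v) (.const 1))) s₁ 24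
          (put E s₁ 0 v (i + 1)) := by
        have := Exec.setNat (E := E) (adr 0 (.const v)) (.add (sc v) (.const 1)) s₁
        simp only [NExp.eval, eval_sc, hv₁] at this
        exact this
      refine ⟨_, s₂, .whileTrue ?_ (.seq he hw) he', ?_, hq⟩
      · simp only [BExp.Holds, eval_sc, hv, hb i s' (by omega) hinv]; omega
      · rw [Finset.sum_eq_sum_Ico_succ_bot (by omega : i < N)]
        simp [BExp.cost, cost_sc]; omega
  have h1 := key N 0 (by simp) _ h0 (by simp [get_put])
  refine Runs.mono (Runs.seq (T₁ := 12) (Q₁ := fun s' => s' = put E s 0 v 0)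
    ?_ (fun s' hs' => by subst hs'; exact h1)) ?_ fun s' h => h
  · exact (runs_of_wp (by simp [wp_wr, NExp.eval])).mono (by simp [bound_wr, NExp.cost])
      fun s' h => h
  · rw [Finset.range_eq_Ico]; omega

theorem runs_forC_const {E : Env} {v : ℕ} {b : NExp} {c : Cmd} {s : State} (N : ℕ)
    (Inv : ℕ → State → Prop) (τ : ℕ) (h0 : Inv 0 (put E s 0 v 0))
    (hb : ∀ i s', i ≤ N → Inv i s' → b.eval E s' = N)
    (hstep : ∀ i s', i < N → Inv i s' → get E s' 0 v = i → Runs E c s' τ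
      fun s'' => get E s'' 0 v = i ∧ Inv (i + 1) (put E s'' 0 v (i + 1))) :
    Runs E (forC v b c) s (24 + b.cost + N * (τ + 36 + b.cost))
      fun s' => Inv N s' ∧ get E s' 0 v = N := by
  simpa using runs_forC N Inv (fun _ => τ) h0 hb hstep

/-- Only the arrays in `R` may differ. -/
def Frame (E : Env) (R : Finset (Fin 16)) (s s' : State) : Prop :=
  (∀ r ∉ R, ∀ i, get E s' r i = get E s r i) ∧ s'.drawn = s.drawn

theorem Frame.refl (E : Env) (R : Finset (Fin 16)) (s : State) : Frame E R s s :=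
  ⟨fun _ _ _ => rfl, rfl⟩

theorem Frame.trans {E : Env} {R R' R'' : Finset (Fin 16)} {s s' s'' : State}
    (h : Frame E R s s') (h' : Frame E R' s' s'') (h1 : R ⊆ R'') (h2 : R' ⊆ R'') :
    Frame E R'' s s'' :=
  ⟨fun r hr i => (h'.1 r (fun h => hr (h2 h)) i).trans (h.1 r (fun h => hr (h1 h)) i),
    h'.2.trans h.2⟩

theorem Frame.put {E : Env} {R : Finset (Fin 16)} {s s' : State} (h : Frame E R s s')
    {r : Fin 16} (hr : r ∈ R) (i v : ℕ) : Frame E R s (put E s' r i v) := by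
  refine ⟨fun r' hr' i' => ?_, h.2⟩
  rw [get_put, if_neg, h.1 r' hr']
  rintro ⟨rfl, _⟩; exact hr' hr

/-! Building lists -/

/-- For all `j, l < n` (scalars `0`, `1`) with `cond`, appends `push` to list `j`, which is kept in
`rL` from index `j * n` on and has its length in `rN`. -/
def buildLists (cond : BExp) (push : NExp) (rL rN : Fin 16) : Cmd :=
  forC 0 nE (forC 1 nE (.ite cond
    (.seq (wr rL (.add (.mul (sc 0) nE) (rd rN (sc 0))) push)
      (wr rN (sc 0) (.add (rd rN (sc 0)) (.const 1)))) .skip))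

/-- The numbers below `l` that satisfy `C`. -/
def sel (C : ℕ → Bool) (l : ℕ) : List ℕ := (List.range l).filter C

theorem length_sel_le (C : ℕ → Bool) (l : ℕ) : (sel C l).length ≤ l := by
  simpa [sel] using List.length_filter_le C (List.range l)

theorem sel_succ (C : ℕ → Bool) (l : ℕ) :
    sel C (l + 1) = if C l then sel C l ++ [l] else sel C l := by
  unfold sel
  rw [List.range_succ, List.filter_append]
  cases h : C l <;> simp [h]

/-- Uniqueness of division with remainder; it keeps apart the entries of all two-dimensional tables
that are stored in one array. -/
theorem mul_add_ne {n j j' m m' : ℕ} (hm : m < n) (hm' : m' < n) (h : j ≠ j') :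
    j * n + m ≠ j' * n + m' := by
  intro e
  apply h
  have h1 := congrArg (· / n) e
  have hn : 0 < n := by omega
  simp only [Nat.add_comm (_ * n)] at h1
  simpa [Nat.add_mul_div_right _ _ hn, Nat.div_eq_of_lt hm, Nat.div_eq_of_lt hm'] using h1

/-- List `j` holds the images under `p` of the elements of `li`. -/
def HasList (E : Env) (s : State) (rL rN : Fin 16) (n : ℕ) (p : ℕ → ℕ) (li : List ℕ) (j : ℕ) :
    Prop :=
  get E s rN j = li.length ∧ ∀ m < li.length, get E s rL (j * n + m) = p (li.getD m 0)

theorem runs_buildLists {E : Env} {cond : BExp} {push : NExp} {rL rN : Fin 16} {s : State} {n : ℕ}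
    (hn : E.natIn 0 = n) (hL : rL ≠ 0) (hN : rN ≠ 0) (hLN : rL ≠ rN) (C : ℕ → ℕ → Bool)
    (p : ℕ → ℕ → ℕ)
    (hc : ∀ s' j l, j < n → l < n → Frame E {0, rL, rN} s s' → get E s' 0 0 = j →
      get E s' 0 1 = l → (cond.Holds E s' ↔ C j l = true) ∧ push.eval E s' = p j l)
    (hz : ∀ j < n, get E s rN j = 0) :
    Runs E (buildLists cond push rL rN) s
      (26 + n * (200 + n * (200 + cond.cost + push.cost)))
      fun s' => Frame E {0, rL, rN} s s' ∧ ∀ j < n, HasList E s' rL rN n (p j) (sel (C j) n) j := by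
  have hmem : (0 : Fin 16) ∈ ({0, rL, rN} : Finset (Fin 16)) := by simp
  -- `lim j` is the number of candidates already examined for list `j`. A bound for each list serves
  -- the invariants of both loops.
  let Lim : (ℕ → ℕ) → State → Prop := fun lim s' =>
    Frame E {0, rL, rN} s s' ∧ ∀ j < n, HasList E s' rL rN n (p j) (sel (C j) (lim j)) j
  have hput : ∀ lim s' v k, Lim lim s' → Lim lim (put E s' 0 v k) := by
    intro lim s' v k h
    refine ⟨h.1.put hmem v k, fun j hj => ?_⟩
    have := h.2 j hj
    refine ⟨?_, fun m hm => ?_⟩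
    · rw [get_put, if_neg (by simp [hN]), this.1]
    · rw [get_put, if_neg (by simp [hL]), this.2 m hm]
  refine (runs_forC_const n
    (fun j s' => Lim (fun j' => if j' < j then n else 0) s')
    (30 + n * (150 + cond.cost + push.cost)) ?_ ?_ ?_).mono ?_ ?_
  · refine hput _ _ _ _ ⟨Frame.refl _ _ _, fun j hj => ?_⟩
    simp [HasList, sel, hz j hj]
  · intro i s' _ _; exact hn
  · intro j s' hj hinv hv
    refine (runs_forC_const n (fun l s' => get E s' 0 0 = j ∧
      Lim (fun j' => if j' < j then n else if j' = j then l else 0) s')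
      (110 + cond.cost + push.cost) ?_ ?_ ?_).mono ?_ ?_
    · refine ⟨by simp [get_put, hv], hput _ _ _ _ ⟨hinv.1, fun j' hj' => ?_⟩⟩
      simpa using hinv.2 j' hj'
    · intro i s' _ _; exact hn
    · rintro l s₁ hl ⟨hj0, hfr, hli⟩ hl1
      obtain ⟨hc1, hc2⟩ := hc s₁ j l hj hl hfr hj0 hl1
      refine (runs_of_wp (Q := fun s'' => get E s'' 0 0 = j ∧ get E s'' 0 1 = l ∧
        Lim (fun j' => if j' < j then n else if j' = j then l + 1 else 0) s'') ?_).mono ?_ ?_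
      · simp only [wp, wp_wr]
        have hlist : ∀ j' < n, j' ≠ j →
            HasList E s₁ rL rN n (p j') (sel (C j')
              (if j' < j then n else if j' = j then l + 1 else 0)) j' := by
          intro j' hj' hne
          have := hli j' hj'
          simpa [hne] using this
        have hself := hli j hj
        simp only [lt_irrefl, if_false, if_true] at hself
        constructor
        · intro hcond
          have hC := hc1.mp hcond
          set len := (sel (C j) l).length with hlen
          have hlenl : len ≤ l := length_sel_le _ _
          set s₂ := put E s₁ rL (j * n + len) (p j l) with hs₂
          have e1 : put E s₁ rL (NExp.eval E s₁ (.add (.mul (sc 0) nE) (rd rN (sc 0))))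
              (push.eval E s₁) = s₂ := by
            simp only [NExp.eval, eval_sc, eval_nE, eval_rd, hj0, hn, hc2, hself.1, hs₂, hlen]
          rw [e1]
          have e2 : put E s₂ rN (NExp.eval E s₂ (sc 0))
              (NExp.eval E s₂ (.add (rd rN (sc 0)) (.const 1))) = put E s₂ rN j (len + 1) := by
            simp only [NExp.eval, eval_sc, eval_rd, hs₂, get_put, hL.symm, hLN.symm, false_and,
              if_false, hj0, hself.1, hlen]
          rw [e2]
          refine ⟨?_, ?_, (hfr.put (by simp) _ _).put (by simp) _ _, fun j' hj' => ?_⟩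
          · simp [hs₂, get_put, hL.symm, hN.symm, hj0]
          · simp [hs₂, get_put, hL.symm, hN.symm, hl1]
          · by_cases hjj : j' = j
            · subst hjj
              simp only [lt_irrefl, if_false, if_true, sel_succ, hC]
              refine ⟨by simp [get_put, hlen], fun m hm => ?_⟩
              rw [List.length_append, List.length_singleton, ← hlen] at hm
              rw [get_put, if_neg (by simp [hLN]), hs₂, get_put]
              by_cases hm' : m = len
              · subst hm'
                simp [hlen, List.getD_eq_getElem?_getD]
              · rw [if_neg (by simp; omega), hself.2 m (by omega)]
                congr 1
                simp only [List.getD_eq_getElem?_getD]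
                rw [List.getElem?_append_left (by omega)]
            · obtain ⟨a, b⟩ := hlist j' hj' hjj
              refine ⟨?_, fun m hm => ?_⟩
              · rw [get_put, if_neg (by simp [hjj]), hs₂, get_put, if_neg (by simp [hLN.symm]), a]
              · rw [get_put, if_neg (by simp [hLN]), hs₂, get_put, if_neg, b m hm]
                rintro ⟨-, e⟩
                have hmn : m < n := by
                  have := length_sel_le (C j') (if j' < j then n else if j' = j then l + 1 else 0)
                  simp only [hjj, if_false] at this hm
                  split_ifs at this hm <;> omega
                exact mul_add_ne hmn (by omega) hjj e
        · intro hcond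
          have hC : C j l = false := by
            rcases h : C j l with _ | _
            · rfl
            · exact absurd (hc1.mpr h) hcond
          refine ⟨hj0, hl1, hfr, fun j' hj' => ?_⟩
          by_cases hjj : j' = j
          · subst hjj
            simpa [sel_succ, hC] using hself
          · exact hlist j' hj' hjj
      · simp only [Cmd.bound, bound_wr, NExp.cost, cost_sc, cost_rd, cost_nE]; omega
      · rintro s'' ⟨h1, h2, h3⟩
        exact ⟨h2, by simp [get_put, h1], hput _ _ _ _ h3⟩
    · simp only [cost_nE]
      have : n * (110 + cond.cost + push.cost + 36 + 2) ≤ n * (150 + cond.cost + push.cost) :=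
        Nat.mul_le_mul_left _ (by omega)
      omega
    · rintro s'' ⟨⟨h1, h2⟩, -⟩
      refine ⟨h1, hput _ _ _ _ ⟨h2.1, fun j' hj' => ?_⟩⟩
      have := h2.2 j' hj'
      have e : (if j' < j then n else if j' = j then n else 0) = if j' < j + 1 then n else 0 := by
        split_ifs <;> omega
      simpa only [e] using this
  · simp only [cost_nE]
    have : n * (30 + n * (150 + cond.cost + push.cost) + 36 + 2) ≤
        n * (200 + n * (200 + cond.cost + push.cost)) :=
      Nat.mul_le_mul_left _ (by
        have : n * (150 + cond.cost + push.cost) ≤ n * (200 + cond.cost + push.cost) :=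
          Nat.mul_le_mul_left _ (by omega)
        omega)
    omega
  · rintro s'' ⟨⟨h1, h2⟩, -⟩
    refine ⟨h1, fun j hj => ?_⟩
    have := h2 j hj
    simpa [hj] using this

end RealRAM

namespace RealRAM

/-! Propagating values along edges -/

/-- The value that the list entry under consideration proposes. -/
def relaxE (rL rV : Fin 16) (w : ℕ) : NExp :=
  .add (rd rV (rd rL (.add (.mul (sc 1) nE) (sc 2)))) (.const w)

/-- In `n` rounds, raises the values in `rV` until they are at least `w` more than the values of all
list entries. -/
def relax (rL rN rV : Fin 16) (w : ℕ) : Cmd :=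
  forC 0 nE (forC 1 nE (forC 2 (rd rN (sc 1))
    (.ite (.natLt (rd rV (sc 1)) (relaxE rL rV w)) (wr rV (sc 1) (relaxE rL rV w)) .skip)))

/-- The final values are squeezed between two bounds. Above, `F` is closed under the relaxation
step, so no update can exceed it. Below, `Φ t j x` says that `x` is guaranteed at `j` after `t`
rounds. Equality follows when `Φ n` reaches `F`. -/
theorem runs_relax {E : Env} {rL rN rV : Fin 16} {w : ℕ} {s : State} {n D : ℕ}
    (hn : E.natIn 0 = n) (hL : rL ≠ 0) (hN : rN ≠ 0) (hV : rV ≠ 0) (hVL : rV ≠ rL) (hVN : rV ≠ rN)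
    (li : ℕ → List ℕ) (hli : ∀ j < n, HasList E s rL rN n id (li j) j)
    (hD : ∀ j < n, (li j).length ≤ D) (hlt : ∀ j < n, ∀ i ∈ li j, i < n) (F : ℕ → ℕ)
    (hF0 : ∀ j < n, get E s rV j ≤ F j) (hF : ∀ j < n, ∀ i ∈ li j, F i + w ≤ F j)
    (Φ : ℕ → ℕ → ℕ → Prop) (hΦ0 : ∀ j < n, ∀ x, Φ 0 j x → x ≤ get E s rV j)
    (hΦ : ∀ t, ∀ j < n, ∀ x, Φ (t + 1) j x → Φ t j x ∨ ∃ i ∈ li j, ∃ y, Φ t i y ∧ x ≤ y + w) :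
    Runs E (relax rL rN rV w) s (26 + n * (100 + n * (100 + D * 300)))
      fun s' => Frame E {0, rV} s s' ∧
        ∀ j < n, get E s' rV j ≤ F j ∧ ∀ x, Φ n j x → x ≤ get E s' rV j := by
  have hmem : (0 : Fin 16) ∈ ({0, rV} : Finset (Fin 16)) := by simp
  have hLmem : rL ∉ ({0, rV} : Finset (Fin 16)) := by simp [hL, hVL.symm]
  have hNmem : rN ∉ ({0, rV} : Finset (Fin 16)) := by simp [hN, hVN.symm]
  -- In the middle of round `t`, the first `j` variables have already reached the guarantee for `t +
  -- 1`. Updates in place do no harm, because values only grow.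
  let J : ℕ → ℕ → State → Prop := fun t j s' => Frame E {0, rV} s s' ∧
    ∀ j' < n, get E s' rV j' ≤ F j' ∧ (∀ x, Φ t j' x → x ≤ get E s' rV j') ∧
      (j' < j → ∀ x, Φ (t + 1) j' x → x ≤ get E s' rV j')
  have hgp : ∀ s' v k i, get E (put E s' 0 v k) rV i = get E s' rV i := by
    intro s' v k i; rw [get_put, if_neg (by simp [hV])]
  have hJput : ∀ t j s' v k, J t j s' → J t j (put E s' 0 v k) := by
    intro t j s' v k h
    refine ⟨h.1.put hmem v k, ?_⟩
    simpa only [hgp] using h.2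
  refine (runs_forC_const n (fun t s' => J t 0 s') (60 + n * (100 + D * 300)) ?_
    ?_ ?_).mono ?_ ?_
  · exact hJput _ _ _ _ _ ⟨Frame.refl _ _ _, fun j hj => ⟨hF0 j hj, hΦ0 j hj, by simp⟩⟩
  · intro _ _ _ _; exact hn
  · intro t s₁ ht hJ hv
    refine (runs_forC_const n (fun j s' => get E s' 0 0 = t ∧ J t j s') (60 + D * 300) ?_
      ?_ ?_).mono ?_ ?_
    · exact ⟨by simp [get_put, hv], hJput _ _ _ _ _ hJ⟩
    · intro _ _ _ _; exact hn
    · rintro j s₂ hj ⟨h20, h2J⟩ h21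
      refine (runs_forC_const (li j).length (fun l s' => get E s' 0 0 = t ∧ get E s' 0 1 = j ∧
        J t j s' ∧ ∀ m < l, ∀ y, Φ t ((li j).getD m 0) y → y + w ≤ get E s' rV j) 200
        ?_ ?_ ?_).mono ?_ ?_
      · exact ⟨by simp [get_put, h20], by simp [get_put, h21], hJput _ _ _ _ _ h2J, by simp⟩
      · rintro l s₃ - ⟨-, h1, hJ3, -⟩
        rw [eval_rd, eval_sc, h1, hJ3.1.1 rN hNmem, (hli j hj).1]
      · rintro l s₃ hl ⟨h30, h31, hJ3, hlow⟩ h32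
        set i := (li j).getD l 0 with hi
        have hil : i ∈ li j := by
          rw [hi, List.getD_eq_getElem?_getD, List.getElem?_eq_getElem hl]
          exact List.getElem_mem hl
        have hin := hlt j hj i hil
        have heval : (relaxE rL rV w).eval E s₃ = get E s₃ rV i + w := by
          simp only [relaxE, NExp.eval, eval_rd, eval_sc, eval_nE, h31, h32, hn]
          rw [hJ3.1.1 rL hLmem, (hli j hj).2 l hl]; rfl
        refine (runs_of_wp (Q := fun s'' => get E s'' 0 0 = t ∧ get E s'' 0 1 = j ∧
          get E s'' 0 2 = l ∧ Frame E {0, rV} s s'' ∧ ∀ j', get E s'' rV j' =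
            if j' = j then max (get E s₃ rV j) (get E s₃ rV i + w) else get E s₃ rV j')
          ?_).mono ?_ ?_
        · simp only [wp, wp_wr, BExp.Holds, heval, eval_rd, eval_sc, h31]
          constructor
          · intro h
            refine ⟨?_, ?_, ?_, hJ3.1.put (by simp) _ _, fun j' => ?_⟩
            · simp [get_put, hV.symm, h30]
            · simp [get_put, hV.symm, h31]
            · simp [get_put, hV.symm, h32]
            · rw [get_put, max_eq_right h.le]; simp
          · intro h
            refine ⟨h30, trivial, h32, hJ3.1, fun j' => ?_⟩
            rw [max_eq_left (not_lt.mp h)]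
            split_ifs with e
            · rw [e]
            · rfl
        · simp only [Cmd.bound, bound_wr, BExp.cost, relaxE, NExp.cost, cost_rd, cost_sc, cost_nE]
          omega
        · rintro s₄ ⟨h40, h41, h42, hfr, hval⟩
          have hmono : ∀ j', get E s₃ rV j' ≤ get E s₄ rV j' := by
            intro j'; rw [hval]; split_ifs with e
            · rw [e]; exact le_max_left _ _
            · rfl
          refine ⟨h42, by simp [get_put, h40], by simp [get_put, h41],
            hJput _ _ _ _ _ ⟨hfr, fun j' hj' => ?_⟩, fun m hm y hy => ?_⟩
          · obtain ⟨a, b, c⟩ := hJ3.2 j' hj'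
            refine ⟨?_, fun x hx => (b x hx).trans (hmono j'),
              fun hlt x hx => (c hlt x hx).trans (hmono j')⟩
            rw [hval]; split_ifs with e
            · subst e
              refine max_le a (le_trans ?_ (hF j' hj' i hil))
              have := (hJ3.2 i hin).1
              omega
            · exact a
          · rw [hgp, hval, if_pos rfl]
            rcases Nat.lt_succ_iff_lt_or_eq.mp hm with hm | rfl
            · exact (hlow m hm y hy).trans (le_max_left _ _)
            · refine le_trans ?_ (le_max_right _ _)
              have := (hJ3.2 i hin).2.1 y hy
              omega
      · simp only [cost_rd, cost_sc]
        have := hD j hj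
        have : (li j).length * (200 + 36 + (11 + 10)) ≤ D * 300 := by nlinarith
        omega
      · rintro s₃ ⟨⟨h30, h31, hJ3, hlow⟩, -⟩
        refine ⟨h31, by simp [get_put, h30], hJput _ _ _ _ _ ⟨hJ3.1, fun j' hj' => ?_⟩⟩
        obtain ⟨a, b, c⟩ := hJ3.2 j' hj'
        refine ⟨a, b, fun hlt' x hx => ?_⟩
        rcases Nat.lt_succ_iff_lt_or_eq.mp hlt' with h | rfl
        · exact c h x hx
        · rcases hΦ t j' hj' x hx with h | ⟨i, hi, y, hy, hxy⟩
          · exact b x h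
          · obtain ⟨m, hm, rfl⟩ := List.mem_iff_getElem.mp hi
            refine hxy.trans (hlow m hm y ?_)
            rwa [List.getD_eq_getElem?_getD, List.getElem?_eq_getElem hm]
    · simp only [cost_nE]
      have : n * (60 + D * 300 + 36 + 2) ≤ n * (100 + D * 300) :=
        Nat.mul_le_mul_left _ (by omega)
      omega
    · rintro s₃ ⟨⟨h30, hJ3⟩, -⟩
      refine ⟨h30, hJput _ _ _ _ _ ⟨hJ3.1, fun j' hj' => ?_⟩⟩
      obtain ⟨a, b, c⟩ := hJ3.2 j' hj'
      exact ⟨a, c hj', by simp⟩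
  · simp only [cost_nE]
    have : n * (60 + n * (100 + D * 300) + 36 + 2) ≤ n * (100 + n * (100 + D * 300)) :=
      Nat.mul_le_mul_left _ (by omega)
    omega
  · rintro s' ⟨hJ, -⟩
    exact ⟨hJ.1, fun j hj => ⟨(hJ.2 j hj).1, (hJ.2 j hj).2.1⟩⟩

/-! Computing the index of an assignment to the effective parents -/

/-- The number with the digits `f 0, …, f (m - 1)` in base `q`. -/
def digits (q : ℕ) (f : ℕ → ℕ) : ℕ → ℕ
  | 0 => 0
  | m + 1 => digits q f m * q + f m

theorem digits_inj {q : ℕ} {f g : ℕ → ℕ} {m : ℕ} (hf : ∀ i < m, f i < q) (hg : ∀ i < m, g i < q)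
    (h : digits q f m = digits q g m) : ∀ i < m, f i = g i := by
  induction m with
  | zero => simp
  | succ m ih =>
    have hfm := hf m (by omega)
    have hgm := hg m (by omega)
    simp only [digits] at h
    have h1 : f m = g m := by
      have := congrArg (· % q) h
      simpa [Nat.mul_add_mod', Nat.mod_eq_of_lt hfm, Nat.mod_eq_of_lt hgm] using this
    have h2 : digits q f m = digits q g m := by
      rw [h1] at h
      exact Nat.eq_of_mul_eq_mul_right (by omega) (Nat.add_right_cancel h)
    intro i hi
    rcases Nat.lt_succ_iff_lt_or_eq.mp hi with hi | rfl
    · exact ih (fun i hi => hf i (by omega)) (fun i hi => hg i (by omega)) h2 i hi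
    · exact h1

theorem digits_congr {q : ℕ} {f g : ℕ → ℕ} {m : ℕ} (h : ∀ i < m, f i = g i) :
    digits q f m = digits q g m := by
  induction m with
  | zero => rfl
  | succ m ih => simp only [digits]; rw [ih fun i hi => h i (by omega), h m (by omega)]

/-- The array of lists of effective parents. -/
abbrev arrT : Fin 16 := 9

/-- The array of the lengths of these lists. -/
abbrev arrTlen : Fin 16 := 10

/-- Computes into scalar `5` the index of the values of the effective parents of the variable in
scalar `3`; `src` tells whether the lists are in the memory or in the input. -/
def lookup (src : NExp → NExp) (qE : NExp) : Cmd :=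
  .seq (wr 0 (.const 5) (.const 0))
    (forC 6 (src (adr arrTlen (sc 3)))
      (wr 0 (.const 5) (.add (.mul (sc 5) qE)
        (.mem (src (adr arrT (.add (.mul (sc 3) nE) (sc 6))))))))

/-- All cells that are read as digits lie at or below `n` and hence below the arrays, so writing the
scalars does not disturb them. The final state is described exactly, which lets callers keep
everything they know about other cells. -/
theorem runs_lookup {E : Env} {src : NExp → NExp} {qE : NExp} {s : State} {n q len : ℕ}
    (hn : E.natIn 0 = n) (ent : ℕ → ℕ)
    (hsc : ∀ a, (src a).cost = a.cost + 1)
    (hlen : ∀ a b, (src (adr arrTlen (sc 3))).eval E (put E (put E s 0 5 a) 0 6 b) = len)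
    (hent : ∀ a m, m < len → (src (adr arrT (.add (.mul (sc 3) nE) (sc 6)))).eval E
      (put E (put E s 0 5 a) 0 6 m) = ent m)
    (hq : ∀ a b, qE.eval E (put E (put E s 0 5 a) 0 6 b) = q)
    (hz : ∀ m < len, ent m ≤ n) :
    Runs E (lookup src qE) s (100 + len * (200 + qE.cost)) fun s' =>
      s' = put E (put E s 0 5 (digits q (fun m => s.nat (ent m)) len)) 0 6 len := by
  have hpp : ∀ s a b, put E (put E s 0 6 a) 0 6 b = put E s 0 6 b := by
    intro s a b; simp [put]
  have hpc : ∀ s a b c, put E (put E (put E s 0 5 a) 0 6 b) 0 5 c =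
      put E (put E s 0 5 c) 0 6 b := by
    intro s a b c
    simp only [put, State.mk.injEq, and_true]
    rw [Function.update_comm (by simp), Function.update_idem]
  refine Runs.mono (Runs.seq (T₁ := 12) (T₂ := 46 + len * (200 + qE.cost)) (Q₁ := fun s' => s' = put E s 0 5 0)
    ((runs_of_wp (by simp [wp_wr, NExp.eval])).mono (by simp [bound_wr, NExp.cost]) fun _ h => h)
    (fun s' hs' => ?_)) ?_ fun s' h => h
  · subst hs'
    refine (runs_forC_const len (fun m s' => s' =
      put E (put E s 0 5 (digits q (fun m => s.nat (ent m)) m)) 0 6 m) (110 + qE.cost) rfl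
      ?_ ?_).mono ?_ ?_
    · rintro m s' - rfl; exact hlen _ _
    · rintro m s' hm rfl -
      refine (runs_of_wp (Q := fun s'' => s'' =
        put E (put E s 0 5 (digits q (fun m => s.nat (ent m)) (m + 1))) 0 6 m) ?_).mono ?_ ?_
      · simp only [wp_wr, NExp.eval, hent _ m hm, hq, eval_sc]
        rw [hpc, put_nat_of_le _ _ _ _ (hn ▸ hz m hm), put_nat_of_le _ _ _ _ (hn ▸ hz m hm)]
        simp [get_put, digits]
      · simp only [bound_wr, NExp.cost, cost_sc, cost_nE, hsc, cost_adr]; omega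
      · rintro s'' rfl
        exact ⟨by simp [get_put], by rw [hpp]⟩
    · simp only [hsc, cost_adr, cost_sc]
      have : len * (110 + qE.cost + 36 + (11 + 9 + 1)) ≤ len * (200 + qE.cost) :=
        Nat.mul_le_mul_left _ (by omega)
      omega
    · rintro s' ⟨h, -⟩; exact h
  · omega

end RealRAM

namespace RealRAM

/-! ### The evaluation and the generation program -/

/-- Writes a cell below the arrays. -/
def putZ (s : State) (c v : ℕ) : State := { s with nat := Function.update s.nat c v }

/-- Writes a real cell. -/
def putR (s : State) (c : ℕ) (v : ℝ) : State := { s with real := Function.update s.real c v }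

theorem get_putZ {E : Env} (s : State) {c : ℕ} (v : ℕ) (hc : c ≤ E.natIn 0) (r : Fin 16) (i : ℕ) :
    get E (putZ s c v) r i = get E s r i := by
  unfold get putZ
  exact Function.update_of_ne (by omega) _ _

theorem putZ_nat (s : State) (c v c' : ℕ) :
    (putZ s c v).nat c' = if c' = c then v else s.nat c' := by
  simp [putZ, Function.update_apply]

theorem putZ_real (s : State) (c v : ℕ) : (putZ s c v).real = s.real := rfl

theorem get_putR (E : Env) (s : State) (c : ℕ) (v : ℝ) (r : Fin 16) (i : ℕ) :
    get E (putR s c v) r i = get E s r i := rfl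

theorem putR_nat (s : State) (c : ℕ) (v : ℝ) : (putR s c v).nat = s.nat := rfl

theorem putR_tossed (s : State) (c : ℕ) (v : ℝ) : (putR s c v).tossed = s.tossed := rfl

theorem putR_real (s : State) (c : ℕ) (v : ℝ) (c' : ℕ) :
    (putR s c v).real c' = if c' = c then v else s.real c' := by
  simp [putR, Function.update_apply]

/-- Assignment to a cell below the arrays. -/
def wz (a e : NExp) : Cmd := .setNat a e

/-- Assignment to the real cell `c`. -/
def wR (c : ℕ) (e : RExp) : Cmd := .setReal (.const c) e

/-- The real cell `c`. -/
def rc (c : ℕ) : RExp := .mem (.const c)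

theorem wp_wz (E : Env) (a e : NExp) (Q : State → Prop) (s : State) :
    wp E (wz a e) Q s = Q (putZ s (a.eval E s) (e.eval E s)) := rfl

theorem wp_wR (E : Env) (c : ℕ) (e : RExp) (Q : State → Prop) (s : State) :
    wp E (wR c e) Q s = Q (putR s c (e.eval E s)) := rfl

theorem eval_rc (E : Env) (s : State) (c : ℕ) : (rc c).eval E s = s.real c := rfl

theorem bound_wz (w : ℕ) (a e : NExp) : (wz a e).bound w = a.cost + e.cost + 1 := rfl

theorem bound_wR (w c : ℕ) (e : RExp) : (wR c e).bound w = e.cost + 2 := by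
  simp [wR, Cmd.bound, NExp.cost]; omega

theorem cost_rc (c : ℕ) : (rc c).cost = 2 := rfl

/-- Entry `i` of array `r` of the input. -/
def inp (r : Fin 16) (i : NExp) : NExp := .natIn (adr r i)

/-- The value of entry `i` of array `r` of the input. -/
def inGet (E : Env) (r : Fin 16) (i : ℕ) : ℕ := E.natIn (E.natIn 0 + 1 + (16 * i + r))

theorem eval_inp (E : Env) (s : State) (r : Fin 16) (i : NExp) :
    (inp r i).eval E s = inGet E r (i.eval E s) := rfl

theorem cost_inp (r : Fin 16) (i : NExp) : (inp r i).cost = i.cost + 10 := by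
  simp [inp, NExp.cost, cost_adr]

/-- The order of the variables. -/
abbrev arrOrd : Fin 16 := 12

/-- The parameters: alphabet size, `X`, `x` and the smoothing constant. -/
abbrev arrPar : Fin 16 := 13

/-- The counts of the values of the effective parents. -/
abbrev arrZ : Fin 16 := 14

/-- The counts of these values together with the value of the variable. -/
abbrev arrC : Fin 16 := 15

/-- The index that belongs to variable `j` under the values `vals`. -/
def cellIdx (E : Env) (vals : ℕ → ℕ) (j : ℕ) : ℕ :=
  j + E.natIn 0 * digits (inGet E arrPar 0) (fun m => vals (inGet E arrT (j * E.natIn 0 + m)))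
    (inGet E arrTlen j)

/-- The estimated conditional probability that `j` has the value `a`. -/
noncomputable def ratio (E : Env) (vals : ℕ → ℕ) (j a : ℕ) : ℝ :=
  ((inGet E arrC (cellIdx E vals j * inGet E arrPar 0 + a) : ℕ) + (inGet E arrPar 3 : ℕ)) /
    ((inGet E arrZ (cellIdx E vals j) : ℕ) + ((inGet E arrPar 0 * inGet E arrPar 3 : ℕ) : ℝ))

/-- Computes `ratio` from the index in scalar `5`. -/
def ratioE (val : NExp) : RExp :=
  .div (.add (.ofNat (inp arrC (.add (.mul (.add (sc 3) (.mul nE (sc 5))) (inp arrPar (.const 0)))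
      val))) (.ofNat (inp arrPar (.const 3))))
    (.add (.ofNat (inp arrZ (.add (sc 3) (.mul nE (sc 5)))))
      (.ofNat (.mul (inp arrPar (.const 0)) (inp arrPar (.const 3)))))

theorem cost_ratioE (val : NExp) : (ratioE val).cost ≤ val.cost + 200 := by
  simp [ratioE, RExp.cost, NExp.cost, cost_inp, cost_sc, cost_nE]; omega

theorem eval_ratioE {E : Env} {s : State} {val : NExp} {vals : ℕ → ℕ} {j : ℕ}
    (hj : get E s 0 3 = j) (hz : j + E.natIn 0 * get E s 0 5 = cellIdx E vals j) :
    (ratioE val).eval E s = ratio E vals j (val.eval E s) := by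
  simp only [ratioE, RExp.eval, NExp.eval, eval_inp, eval_sc, eval_nE, hj, hz, ratio]

/-- What the evaluation and the generation program assume about their input. -/
structure GoodInput (E : Env) (n q X K : ℕ) : Prop where
  natIn_zero : E.natIn 0 = n
  pos : 0 < n
  par_zero : inGet E arrPar 0 = q
  par_one : inGet E arrPar 1 = X
  X_lt : X < n
  q_pos : 0 < q
  -- Strict, so that `K` also pays for the constant overhead of a lookup, even when there are no
  -- effective parents.
  len_lt : ∀ j < n, inGet E arrTlen j < K
  ent_le : ∀ j < n, ∀ m < inGet E arrTlen j, inGet E arrT (j * n + m) ≤ n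
  ord_lt : ∀ t < n, inGet E arrOrd t < n

theorem runs_lookup_input {E : Env} {n q X K : ℕ} (H : GoodInput E n q X K) {s : State} {j : ℕ}
    (hj : j < n) (hs : get E s 0 3 = j) {vals : ℕ → ℕ} (hv : ∀ c ≤ n, s.nat c = vals c) :
    Runs E (lookup NExp.natIn (inp arrPar (.const 0))) s (300 * K) fun s' =>
      ∃ z, s' = put E (put E s 0 5 z) 0 6 (inGet E arrTlen j) ∧
        j + E.natIn 0 * z = cellIdx E vals j := by
  refine (runs_lookup (n := n) (q := q) (len := inGet E arrTlen j) H.natIn_zero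
    (fun m => inGet E arrT (j * n + m)) (fun a => rfl) ?_ ?_ ?_ (H.ent_le j hj)).mono ?_ ?_
  · intro a b
    simp only [NExp.eval, eval_adr, eval_sc, get_put]
    simp [hs, inGet]
  · intro a m hm
    simp only [NExp.eval, eval_adr, eval_sc, get_put, eval_nE]
    simp [hs, inGet, H.natIn_zero]
  · intro a b
    rw [eval_inp]; exact H.par_zero
  · have := H.len_lt j hj
    simp only [cost_inp, NExp.cost]
    have : inGet E arrTlen j * (200 + (1 + 10)) ≤ (K - 1) * 211 :=
      Nat.mul_le_mul (by omega) (by norm_num)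
    omega
  · rintro s' rfl
    refine ⟨_, rfl, ?_⟩
    unfold cellIdx
    rw [H.par_zero, H.natIn_zero]
    congr 2
    refine digits_congr fun m hm => hv _ (H.ent_le j hj m hm)

/-- Sums over the values of `X` the products of the estimated conditional probabilities. -/
def evalProg : Cmd :=
  -- A zero in the first cell marks the empty memory that the learner leaves for an alphabet with
  -- one letter; the only assignment then has probability one.
  .ite (.natLt nE (.const 1)) (wR 0 (.ofNat (.const 1)))
    (.seq (forC 0 nE (wz (sc 0) (.query (sc 0))))
      (.seq (.seq (wz nE (inp arrPar (.const 2))) (wR 0 (.ofNat (.const 0))))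
        (forC 1 (inp arrPar (.const 0))
          (.seq (.seq (wz (inp arrPar (.const 1)) (sc 1)) (wR 1 (.ofNat (.const 1))))
            (.seq (forC 3 nE (.seq (lookup NExp.natIn (inp arrPar (.const 0)))
                (wR 1 (.mul (rc 1) (ratioE (.mem (sc 3)))))))
              (wR 0 (.add (rc 0) (rc 1))))))))

/-- The values that the evaluation program works with when `X` has the value `a`. -/
def evalVals (E : Env) (a c : ℕ) : ℕ :=
  if c = E.natIn 0 then inGet E arrPar 2 else if c = inGet E arrPar 1 then a else E.query c

/-- Between two rounds of the outer loop only the cell of `X` changes, so the query is copied once.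
The `q` rounds of `n` lookups dominate the time. -/
theorem runs_evalProg {E : Env} {n q X K : ℕ} (H : GoodInput E n q X K) :
    Runs E evalProg State.init (2000 * (n * q * K)) fun s =>
      s.real 0 = ∑ a ∈ Finset.range q, ∏ j ∈ Finset.range n,
        ratio E (evalVals E a) j (evalVals E a j) := by
  have hn := H.natIn_zero
  have hK : 0 < K := (Nat.zero_le _).trans_lt (H.len_lt 0 H.pos)
  have hnq : n ≤ n * q * K := by
    have := Nat.mul_le_mul (Nat.mul_le_mul_left n H.q_pos) hK; simpa using this
  have hqn : q ≤ n * q * K := by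
    have := Nat.mul_le_mul (Nat.mul_le_mul_right q H.pos) hK; simpa using this
  have hp := H.pos
  set val : ℕ → ℝ := fun a => ∏ j ∈ Finset.range n, ratio E (evalVals E a) j (evalVals E a j)
  have hbody : Runs E (.seq (forC 0 nE (wz (sc 0) (.query (sc 0))))
      (.seq (.seq (wz nE (inp arrPar (.const 2))) (wR 0 (.ofNat (.const 0))))
        (forC 1 (inp arrPar (.const 0))
          (.seq (.seq (wz (inp arrPar (.const 1)) (sc 1)) (wR 1 (.ofNat (.const 1))))
            (.seq (forC 3 nE (.seq (lookup NExp.natIn (inp arrPar (.const 0)))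
                (wR 1 (.mul (rc 1) (ratioE (.mem (sc 3)))))))
              (wR 0 (.add (rc 0) (rc 1)))))))) State.init
      ((26 + n * 70) + (19 + (36 + q * (150 + n * (600 * K)))))
      fun s => s.real 0 = ∑ a ∈ Finset.range q, val a := by
    refine Runs.seq (Q₁ := fun s => ∀ c < n, s.nat c = E.query c) ?_ fun s₁ h₁ => ?_
    · refine (runs_forC_const n (fun i s => ∀ c < i, c < n → s.nat c = E.query c) 30 (by simp)
        (by intro _ _ _ _; exact hn) ?_).mono (by simp only [cost_nE]; omega)
        fun s h c hc => h.1 c hc hc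
      intro i s hi hinv hv
      refine (runs_of_wp (Q := fun s' => get E s' 0 0 = i ∧
        ∀ c < i + 1, c < n → s'.nat c = E.query c) ?_).mono
        (by simp only [bound_wz, NExp.cost, cost_sc]; omega) ?_
      · simp only [wp_wz, eval_sc, NExp.eval, hv]
        refine ⟨by rw [get_putZ _ _ (by omega), hv], fun c hc hcn => ?_⟩
        rw [putZ_nat]
        split_ifs with e
        · rw [e]
        · exact hinv c (by omega) hcn
      · rintro s' ⟨h1, h2⟩
        refine ⟨h1, fun c hc hcn => ?_⟩
        rw [put_nat_of_le _ _ _ _ (by omega), h2 c hc hcn]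
    refine Runs.seq (Q₁ := fun s => (∀ c ≤ n, c ≠ X → ∀ a, s.nat c = evalVals E a c) ∧
      s.real 0 = 0) ?_ fun s₂ h₂ => ?_
    · refine (runs_of_wp ?_).mono (by simp [Cmd.bound, bound_wz, bound_wR, cost_inp, NExp.cost,
        RExp.cost, cost_nE]) fun s h => h
      simp only [wp, wp_wz, wp_wR, eval_nE, eval_inp, NExp.eval, RExp.eval, hn]
      refine ⟨fun c hc hcX a => ?_, by simp [putR_real]⟩
      rw [putR_nat, putZ_nat]
      unfold evalVals
      rw [hn, H.par_one]
      split_ifs with e1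
      · rfl
      · exact h₁ c (by omega)
    refine (runs_forC_const q (fun a s => (∀ c ≤ n, c ≠ X → ∀ a, s.nat c = evalVals E a c) ∧
      s.real 0 = ∑ a' ∈ Finset.range a, val a') (80 + n * (600 * K)) ?_ ?_ ?_).mono ?_ ?_
    · refine ⟨fun c hc hcX a => ?_, by simp [put_real, h₂.2]⟩
      rw [put_nat_of_le _ _ _ _ (by omega), h₂.1 c hc hcX a]
    · intro _ _ _ _; exact H.par_zero
    · rintro a s₃ ha ⟨h3, h3r⟩ h31
      have hXn := H.X_lt
      refine (Runs.seq (T₁ := 40) (T₂ := (26 + n * (600 * K)) + 7)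
        (Q₁ := fun s => get E s 0 1 = a ∧ (∀ c ≤ n, s.nat c = evalVals E a c) ∧
        s.real 0 = ∑ a' ∈ Finset.range a, val a' ∧ s.real 1 = 1) ?_ fun s₄ h₄ => ?_).mono ?_
        fun s h => h
      · refine (runs_of_wp ?_).mono (by simp [Cmd.bound, bound_wz, bound_wR, cost_inp, NExp.cost,
          RExp.cost, cost_sc]) fun s h => h
        simp only [wp, wp_wz, wp_wR, eval_sc, eval_inp, NExp.eval, RExp.eval, h31, H.par_one]
        refine ⟨by rw [get_putR, get_putZ _ _ (by omega), h31], fun c hc => ?_, ?_, ?_⟩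
        · rw [putR_nat, putZ_nat]
          split_ifs with e
          · unfold evalVals
            rw [hn, H.par_one, if_neg (by omega), if_pos e]
          · exact h3 c hc e a
        · simp [putR_real, putZ_real, h3r]
        · simp [putR_real]
      · obtain ⟨h41, h4n, h40, h4r⟩ := h₄
        refine Runs.seq (Q₁ := fun s => (∀ c ≤ n, s.nat c = evalVals E a c) ∧
          get E s 0 1 = a ∧ s.real 0 = ∑ a' ∈ Finset.range a, val a' ∧ s.real 1 = val a)
          ?_ fun s₅ h₅ => ?_
        · refine (runs_forC_const n (fun j s => (∀ c ≤ n, s.nat c = evalVals E a c) ∧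
            get E s 0 1 = a ∧ s.real 0 = ∑ a' ∈ Finset.range a, val a' ∧
            s.real 1 = ∏ j' ∈ Finset.range j, ratio E (evalVals E a) j' (evalVals E a j'))
            (300 * K + 250) ?_ (by intro _ _ _ _; exact hn) ?_).mono ?_ fun s h => h.1
          · refine ⟨fun c hc => ?_, by simp [get_put, h41], by simp [put_real, h40],
              by simp [put_real, h4r]⟩
            rw [put_nat_of_le _ _ _ _ (by omega), h4n c hc]
          · rintro j s₅ hj ⟨h5n, h51, h50, h5r⟩ h53
            refine Runs.seq (runs_lookup_input H hj h53 h5n) fun s₆ h₆ => ?_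
            obtain ⟨z, rfl, hz⟩ := h₆
            refine (runs_of_wp ?_).mono ?_ fun s h => h
            · simp only [wp_wR, RExp.eval, eval_rc]
              rw [eval_ratioE (vals := evalVals E a) (j := j) (by simp [get_put, h53])
                (by simpa [get_put] using hz)]
              simp only [NExp.eval, eval_sc, get_put, put_real, putR_real, get_putR]
              refine ⟨by simp [h53], fun c hc => ?_, by simp [h51], by simp [h50], ?_⟩
              · rw [put_nat_of_le _ _ _ _ (by omega), putR_nat, put_nat_of_le _ _ _ _ (by omega),
                  put_nat_of_le _ _ _ _ (by omega), h5n c hc]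
              · rw [Finset.prod_range_succ, ← h5r]
                simp only [if_true]
                rw [put_nat_of_le _ _ _ _ (by simp [h53]; omega),
                  put_nat_of_le _ _ _ _ (by simp [h53]; omega)]
                simp [h53, h5n j hj.le]
            · have := cost_ratioE (.mem (sc 3))
              simp only [bound_wR, RExp.cost, cost_rc, NExp.cost, cost_sc] at this ⊢
              omega
          · simp only [cost_nE]
            have : n * (300 * K + 250 + 36 + 2) ≤ n * (600 * K) :=
              Nat.mul_le_mul_left _ (by omega)
            omega
        · obtain ⟨h5n, h51, h50, h5r⟩ := h₅
          refine (runs_of_wp ?_).mono (by simp [bound_wR, RExp.cost, cost_rc]) fun s h => h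
          simp only [wp_wR, RExp.eval, eval_rc]
          refine ⟨by rw [get_putR, h51], fun c hc hcX a' => ?_, ?_⟩
          · rw [put_nat_of_le _ _ _ _ (by omega), putR_nat, h5n c hc]
            unfold evalVals
            rw [H.par_one, if_neg hcX, if_neg hcX]
          · simp [put_real, putR_real, h50, h5r, Finset.sum_range_succ]
      · omega
    · simp only [cost_inp, NExp.cost]
      have : q * (80 + n * (600 * K) + 36 + (1 + 10)) ≤ q * (150 + n * (600 * K)) :=
        Nat.mul_le_mul_left _ (by omega)
      omega
    · rintro s ⟨⟨-, h⟩, -⟩; exact h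
  obtain ⟨t, s, he, ht, hs⟩ := hbody
  refine ⟨_, s, .iteFalse ?_ he, ?_, hs⟩
  · simp only [BExp.Holds, eval_nE, NExp.eval, hn]; omega
  · simp only [BExp.cost, cost_nE, NExp.cost]
    have : q * (150 + n * (600 * K)) = 150 * q + 600 * (n * q * K) := by ring
    omega

/-- Inverse transform sampling: the number of `b < m` such that `u` is at least the sum of the
probabilities up to `b`. -/
noncomputable def pick (p : ℕ → ℝ) (u : ℝ) : ℕ → ℕ
  | 0 => 0
  | m + 1 => pick p u m + if u < ∑ b ∈ Finset.range (m + 1), p b then 0 else 1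

/-- Samples the variables one after the other. -/
def genProg : Cmd :=
  .ite (.natLt nE (.const 1)) .skip
    (.seq (wz nE (inp arrPar (.const 2)))
      (forC 2 nE
        (.seq (wr 0 (.const 3) (inp arrOrd (sc 2)))
          (.seq (lookup NExp.natIn (inp arrPar (.const 0)))
            (.seq (.seq (.toss (.const 0)) (.seq (wR 1 (.ofNat (.const 0)))
                (wr 0 (.const 7) (.const 0))))
              -- Only `q - 1` comparisons: the last letter takes all that remains, including the
              -- random number `1`.
              (.seq (forC 8 (.sub (inp arrPar (.const 0)) (.const 1))
                  (.seq (wR 1 (.add (rc 1) (ratioE (sc 8))))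
                    (.ite (.realLt (rc 0) (rc 1)) .skip
                      (wr 0 (.const 7) (.add (sc 7) (.const 1))))))
                (wz (sc 3) (sc 7))))))))

/-- The values that the generation program has written after `t` rounds. -/
noncomputable def genVals (E : Env) : ℕ → ℕ → ℕ
  | 0 => fun c => if c = E.natIn 0 then inGet E arrPar 2 else 0
  | t + 1 => Function.update (genVals E t) (inGet E arrOrd t)
      (pick (ratio E (genVals E t) (inGet E arrOrd t)) (E.coins t) (inGet E arrPar 0 - 1))

theorem runs_genProg {E : Env} {n q X K : ℕ} (H : GoodInput E n q X K) :
    Runs E genProg State.init (3000 * (n * q * K)) fun s => ∀ c ≤ n, s.nat c = genVals E n c := by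
  have hn := H.natIn_zero
  have hK : 0 < K := (Nat.zero_le _).trans_lt (H.len_lt 0 H.pos)
  have hp := H.pos
  have hqp := H.q_pos
  have hnq : n ≤ n * q * K := by
    have := Nat.mul_le_mul (Nat.mul_le_mul_left n H.q_pos) hK; simpa using this
  have hnk : n * K ≤ n * q * K := Nat.mul_le_mul_right _ (Nat.le_mul_of_pos_right _ hqp)
  have hnq' : n * q ≤ n * q * K := Nat.le_mul_of_pos_right _ hK
  have hbody : Runs E (.seq (wz nE (inp arrPar (.const 2)))
      (forC 2 nE
        (.seq (wr 0 (.const 3) (inp arrOrd (sc 2)))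
          (.seq (lookup NExp.natIn (inp arrPar (.const 0)))
            (.seq (.seq (.toss (.const 0)) (.seq (wR 1 (.ofNat (.const 0)))
                (wr 0 (.const 7) (.const 0))))
              (.seq (forC 8 (.sub (inp arrPar (.const 0)) (.const 1))
                  (.seq (wR 1 (.add (rc 1) (ratioE (sc 8))))
                    (.ite (.realLt (rc 0) (rc 1)) .skip
                      (wr 0 (.const 7) (.add (sc 7) (.const 1))))))
                (wz (sc 3) (sc 7)))))))) State.init
      (20 + (26 + n * (300 * K + 500 * q + 300)))
      fun s => ∀ c ≤ n, s.nat c = genVals E n c := by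
    refine Runs.seq (Q₁ := fun s => s.tossed = 0 ∧ ∀ c ≤ n, s.nat c = genVals E 0 c)
      ?_ fun s₁ h₁ => ?_
    · refine (runs_of_wp ?_).mono (by simp [bound_wz, cost_inp, NExp.cost, cost_nE]) fun s h => h
      simp only [wp_wz, eval_nE, eval_inp, NExp.eval, hn]
      refine ⟨rfl, fun c hc => ?_⟩
      rw [putZ_nat]
      simp [genVals, hn, State.init]
    -- The invariant ties round `t` to random number `t`, so that different variables use
    -- independent random numbers.
    refine (runs_forC_const n (fun t s => s.tossed = t ∧ ∀ c ≤ n, s.nat c = genVals E t c)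
      (300 * K + 500 * q + 200) ?_ (by intro _ _ _ _; exact hn) ?_).mono ?_ fun s h => h.1.2
    · refine ⟨h₁.1, fun c hc => ?_⟩
      rw [put_nat_of_le _ _ _ _ (by omega), h₁.2 c hc]
    · rintro t s₂ ht ⟨h2t, h2n⟩ h22
      set j := inGet E arrOrd t with hj
      have hjn : j < n := H.ord_lt t ht
      set p := ratio E (genVals E t) j with hpdef
      refine (Runs.seq (T₁ := 50) (T₂ := 300 * K + (50 + ((60 + (q - 1) * 400) + 30)))
        (Q₁ := fun s => s = put E s₂ 0 3 j) ?_ fun s₃ h₃ => ?_).mono (by omega) fun s h => h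
      · refine (runs_of_wp ?_).mono (by simp [bound_wr, cost_inp, NExp.cost, cost_sc]) fun s h => h
        simp only [wp_wr, eval_inp, eval_sc, NExp.eval, h22, hj]
      subst h₃
      refine Runs.seq (runs_lookup_input H hjn (by simp [get_put]) (vals := genVals E t) ?_)
        fun s₄ h₄ => ?_
      · intro c hc; rw [put_nat_of_le _ _ _ _ (by omega), h2n c hc]
      obtain ⟨z, rfl, hz⟩ := h₄
      refine Runs.seq (Q₁ := fun s => s.tossed = t + 1 ∧ (∀ c ≤ n, s.nat c = genVals E t c) ∧
        get E s 0 2 = t ∧ get E s 0 3 = j ∧ get E s 0 5 = z ∧ get E s 0 7 = 0 ∧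
        s.real 0 = E.coins t ∧ s.real 1 = 0) ?_ fun s₅ h₅ => ?_
      · refine (runs_of_wp ?_).mono (by simp [Cmd.bound, bound_wr, bound_wR, NExp.cost,
          RExp.cost]) fun s h => h
        simp only [wp, wp_wR, wp_wr, NExp.eval, RExp.eval]
        refine ⟨by simp [put_tossed, putR_tossed, h2t], fun c hc => ?_, ?_, ?_, ?_, ?_, ?_, ?_⟩
        · rw [put_nat_of_le _ _ _ _ (by omega), putR_nat]
          change (put E (put E (put E s₂ 0 3 j) 0 5 z) 0 6 _).nat c = _
          rw [put_nat_of_le _ _ _ _ (by omega), put_nat_of_le _ _ _ _ (by omega),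
            put_nat_of_le _ _ _ _ (by omega), h2n c hc]
        · rw [get_put, if_neg (by simp), get_putR]
          change get E (put E (put E (put E s₂ 0 3 j) 0 5 z) 0 6 _) 0 2 = _
          simp [get_put, h22]
        · rw [get_put, if_neg (by simp), get_putR]
          change get E (put E (put E (put E s₂ 0 3 j) 0 5 z) 0 6 _) 0 3 = _
          simp [get_put]
        · rw [get_put, if_neg (by simp), get_putR]
          change get E (put E (put E (put E s₂ 0 3 j) 0 5 z) 0 6 _) 0 5 = _
          simp [get_put]
        · simp [get_put]
        · simp [put_real, putR_real, put_tossed, h2t]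
        · simp [put_real, putR_real]
      refine Runs.seq (Q₁ := fun s => s.tossed = t + 1 ∧ (∀ c ≤ n, s.nat c = genVals E t c) ∧
        get E s 0 2 = t ∧ get E s 0 3 = j ∧ get E s 0 7 = pick p (E.coins t) (q - 1))
        ?_ fun s₆ h₆ => ?_
      · refine (runs_forC_const (q - 1) (fun b s => s.tossed = t + 1 ∧
          (∀ c ≤ n, s.nat c = genVals E t c) ∧ get E s 0 2 = t ∧ get E s 0 3 = j ∧
          get E s 0 5 = z ∧ get E s 0 7 = pick p (E.coins t) b ∧
          s.real 0 = E.coins t ∧ s.real 1 = ∑ b' ∈ Finset.range b, p b') 310 ?_ ?_ ?_).mono ?_ ?_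
        · obtain ⟨a1, a2, a3, a4, a5, a6, a7, a8⟩ := h₅
          refine ⟨a1, fun c hc => ?_, by simp [get_put, a3], by simp [get_put, a4],
            by simp [get_put, a5], by simp [get_put, a6, pick], a7, by simp [put_real, a8]⟩
          rw [put_nat_of_le _ _ _ _ (by omega), a2 c hc]
        · intro _ s _ _
          simp only [NExp.eval, eval_inp, H.par_zero]
        · rintro b s₆ hb ⟨a1, a2, a3, a4, a5, a6, a7, a8⟩ h68
          refine (runs_of_wp (Q := fun s => get E s 0 8 = b ∧ s.tossed = t + 1 ∧
            (∀ c ≤ n, s.nat c = genVals E t c) ∧ get E s 0 2 = t ∧ get E s 0 3 = j ∧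
            get E s 0 5 = z ∧ get E s 0 7 = pick p (E.coins t) (b + 1) ∧
            s.real 0 = E.coins t ∧ s.real 1 = ∑ b' ∈ Finset.range (b + 1), p b') ?_).mono ?_ ?_
          · have hev : s₆.real 1 + (ratioE (sc 8)).eval E s₆ =
                ∑ b' ∈ Finset.range (b + 1), p b' := by
              rw [eval_ratioE (vals := genVals E t) (j := j) a4 (by rw [a5]; exact hz), eval_sc,
                h68, a8, Finset.sum_range_succ]
            simp only [wp, wp_wR, wp_wr, NExp.eval, RExp.eval, eval_rc, hev, BExp.Holds, eval_sc,
              putR_real, get_putR]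
            simp only [if_true, zero_ne_one, if_false, a7, a6]
            constructor
            · intro hlt
              exact ⟨h68, a1, a2, a3, a4, a5, by simp [pick, hlt], trivial, trivial⟩
            · intro hlt
              refine ⟨by simp [get_put, get_putR, h68], a1, fun c hc => ?_,
                by simp [get_put, get_putR, a3], by simp [get_put, get_putR, a4],
                by simp [get_put, get_putR, a5], by simp [get_put, pick, hlt], ?_, ?_⟩
              · rw [put_nat_of_le _ _ _ _ (by omega)]; exact a2 c hc
              · simp [put_real, putR_real, a7]
              · simp [put_real, putR_real]
          · have := cost_ratioE (sc 8)
            simp only [Cmd.bound, bound_wr, bound_wR, BExp.cost, RExp.cost, cost_rc, NExp.cost,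
              cost_sc] at this ⊢
            omega
          · rintro s ⟨b0, b1, b2, b3, b4, b5, b6, b7, b8⟩
            refine ⟨b0, b1, fun c hc => ?_, by simp [get_put, b3], by simp [get_put, b4],
              by simp [get_put, b5], by simp [get_put, b6], b7, b8⟩
            rw [put_nat_of_le _ _ _ _ (by omega), b2 c hc]
        · simp only [NExp.cost, cost_inp]
          have : (q - 1) * (310 + 36 + (1 + 10 + 1 + 1)) ≤ (q - 1) * 400 :=
            Nat.mul_le_mul_left _ (by norm_num)
          omega
        · rintro s ⟨⟨a1, a2, a3, a4, a5, a6, a7, a8⟩, -⟩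
          exact ⟨a1, a2, a3, a4, a6⟩
      · obtain ⟨a1, a2, a3, a4, a6⟩ := h₆
        refine (runs_of_wp ?_).mono (by simp [bound_wz, cost_sc]) fun s h => h
        simp only [wp_wz, eval_sc, a4, a6]
        refine ⟨by rw [get_putZ _ _ (by omega), a3], a1, fun c hc => ?_⟩
        rw [put_nat_of_le _ _ _ _ (by omega), putZ_nat]
        simp only [genVals, ← hj, Function.update_apply, H.par_zero, ← hpdef]
        split_ifs
        · rfl
        · exact a2 c hc
    · simp only [cost_nE]
      have : n * (300 * K + 500 * q + 200 + 36 + 2) ≤ n * (300 * K + 500 * q + 300) :=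
        Nat.mul_le_mul_left _ (by omega)
      omega
  obtain ⟨t, s, he, ht, hs⟩ := hbody
  refine ⟨_, s, .iteFalse ?_ he, ?_, hs⟩
  · simp only [BExp.Holds, eval_nE, NExp.eval, hn]; omega
  · simp only [BExp.cost, cost_nE, NExp.cost]
    have : n * (300 * K + 500 * q + 300) = 300 * (n * K) + 500 * (n * q) + 300 * n := by ring
    omega

end RealRAM

namespace RealRAM

/-! ### Inverse transform sampling -/

theorem pick_le (p : ℕ → ℝ) (u : ℝ) (m : ℕ) : pick p u m ≤ m := by
  induction m with
  | zero => simp [pick]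
  | succ m ih => simp only [pick]; split_ifs <;> omega

theorem sum_range_mono {p : ℕ → ℝ} (hp : ∀ b, 0 ≤ p b) {a b : ℕ} (h : a ≤ b) :
    ∑ i ∈ Finset.range a, p i ≤ ∑ i ∈ Finset.range b, p i :=
  Finset.sum_le_sum_of_subset_of_nonneg (Finset.range_mono h) fun i _ _ => hp i

theorem pick_le_of_lt {p : ℕ → ℝ} (hp : ∀ b, 0 ≤ p b) {u : ℝ} {a : ℕ}
    (h : u < ∑ b ∈ Finset.range (a + 1), p b) (m : ℕ) : pick p u m ≤ a := by
  induction m with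
  | zero => simp [pick]
  | succ m ih =>
    simp only [pick]
    split_ifs with h1
    · simpa using ih
    · have : m < a := by
        by_contra hc
        exact h1 (h.trans_le (sum_range_mono hp (by omega)))
      have := pick_le p u m
      omega

theorem le_pick_of_le {p : ℕ → ℝ} (hp : ∀ b, 0 ≤ p b) {u : ℝ} {a : ℕ}
    (h : ∑ b ∈ Finset.range a, p b ≤ u) {m : ℕ} (hm : m ≤ a) : m ≤ pick p u m := by
  induction m with
  | zero => simp
  | succ m ih =>
    simp only [pick]
    rw [if_neg (not_lt.mpr ((sum_range_mono hp hm).trans h))]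
    have := ih (by omega)
    omega

theorem pick_mono (p : ℕ → ℝ) (u : ℝ) {m m' : ℕ} (h : m ≤ m') : pick p u m ≤ pick p u m' := by
  induction h with
  | refl => exact le_rfl
  | step _ ih => exact ih.trans (by simp [pick])

/-- Partial sums increase, so the comparisons succeed from some point on and the count is the
position of that point. Each letter receives a half-open interval, except that the last one has no
upper end. -/
theorem pick_eq_iff {p : ℕ → ℝ} (hp : ∀ b, 0 ≤ p b) {u : ℝ} (hu : 0 ≤ u) {a m : ℕ} (ha : a ≤ m) :
    pick p u m = a ↔ ∑ b ∈ Finset.range a, p b ≤ u ∧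
      (a = m ∨ u < ∑ b ∈ Finset.range (a + 1), p b) := by
  constructor
  · intro h
    constructor
    · rcases Nat.eq_zero_or_pos a with rfl | h0
      · simpa using hu
      · by_contra hc
        have := pick_le_of_lt hp (a := a - 1) (u := u)
          (by rw [Nat.sub_add_cancel h0]; exact not_le.mp hc) m
        omega
    · by_contra hc
      push Not at hc
      have h1 := le_pick_of_le hp hc.2 (m := a + 1) le_rfl
      have h2 := pick_mono p u (m := a + 1) (m' := m) (by omega)
      omega
  · rintro ⟨h1, h2⟩
    have h3 := (le_pick_of_le hp h1 le_rfl).trans (pick_mono p u ha)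
    rcases h2 with rfl | h2
    · exact le_antisymm (pick_le p u a) h3
    · exact le_antisymm (pick_le_of_lt hp h2 m) h3

theorem measurableSet_pick_and_volume {p : ℕ → ℝ} (hp : ∀ b, 0 ≤ p b) {q a : ℕ} (ha : a < q)
    (hs : ∑ b ∈ Finset.range q, p b = 1) :
    MeasurableSet {u : unitInterval | pick p u (q - 1) = a} ∧
      volume {u : unitInterval | pick p u (q - 1) = a} = ENNReal.ofReal (p a) := by
  have hF : ∀ b ≤ q, ∑ i ∈ Finset.range b, p i ∈ Set.Icc (0 : ℝ) 1 := fun b hb =>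
    ⟨Finset.sum_nonneg fun i _ => hp i, hs ▸ sum_range_mono hp hb⟩
  set x : unitInterval := ⟨_, hF a ha.le⟩ with hx
  by_cases h : a = q - 1
  · have e : {u : unitInterval | pick p u (q - 1) = a} = Set.Ici x := by
      ext u
      rw [Set.mem_ofPred_eq, pick_eq_iff hp u.2.1 (by omega)]
      simp [h, hx, ← Subtype.coe_le_coe]
    rw [e]
    refine ⟨measurableSet_Ici, ?_⟩
    rw [unitInterval.volume_Ici]
    congr 1
    have h2 : ∑ b ∈ Finset.range q, p b = ∑ b ∈ Finset.range a, p b + p a := by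
      rw [← Finset.sum_range_succ]; congr 2; omega
    change 1 - ∑ b ∈ Finset.range a, p b = p a
    linarith
  · set y : unitInterval := ⟨_, hF (a + 1) (by omega)⟩ with hy
    have e : {u : unitInterval | pick p u (q - 1) = a} = Set.Ico x y := by
      ext u
      rw [Set.mem_ofPred_eq, pick_eq_iff hp u.2.1 (by omega)]
      simp [h, hx, hy, ← Subtype.coe_le_coe, ← Subtype.coe_lt_coe]
    rw [e]
    refine ⟨measurableSet_Ico, ?_⟩
    rw [unitInterval.volume_Ico]
    congr 1
    have h2 := Finset.sum_range_succ p a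
    change ∑ b ∈ Finset.range (a + 1), p b - ∑ b ∈ Finset.range a, p b = p a
    linarith

/-! ### What the learner leaves in memory -/

variable {n q : ℕ}

open Classical in
/-- The list of the effective parents of `j`. -/
noncomputable def parentList (G : ADMG n) (pos : Fin n → ℕ) (j : ℕ) : List ℕ :=
  sel (fun l => decide (∃ (hj : j < n) (hl : l < n), (⟨l, hl⟩ : Fin n) ∈ G.effParents pos ⟨j, hj⟩)) n

theorem mem_parentList {G : ADMG n} {pos : Fin n → ℕ} {j : Fin n} {l : ℕ} :
    l ∈ parentList G pos j ↔ ∃ i ∈ G.effParents pos j, (i : ℕ) = l := by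
  unfold parentList sel
  simp only [List.mem_filter, List.mem_range, decide_eq_true_eq]
  constructor
  · rintro ⟨-, hj, hl, h⟩; exact ⟨_, h, rfl⟩
  · rintro ⟨i, hi, rfl⟩; exact ⟨i.2, j.2, i.2, hi⟩

theorem length_parentList (G : ADMG n) (pos : Fin n → ℕ) (j : Fin n) :
    (parentList G pos j).length = (G.effParents pos j).card := by
  have hnd : (parentList G pos j).Nodup := List.nodup_range.filter _
  rw [← List.toFinset_card_of_nodup hnd, ← Finset.card_map Fin.valEmbedding]
  congr 1
  ext l
  simp [mem_parentList]

theorem forall_parentList {G : ADMG n} {pos : Fin n → ℕ} {j : Fin n} {Q : ℕ → Prop} :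
    (∀ m < (parentList G pos j).length, Q ((parentList G pos j).getD m 0)) ↔
      ∀ i ∈ G.effParents pos j, Q i := by
  constructor
  · intro h i hi
    obtain ⟨m, hm, e⟩ := List.mem_iff_getElem.mp (mem_parentList.mpr ⟨i, hi, rfl⟩)
    have := h m hm
    rwa [List.getD_eq_getElem?_getD, List.getElem?_eq_getElem hm, Option.getD_some, e] at this
  · intro h m hm
    rw [List.getD_eq_getElem?_getD, List.getElem?_eq_getElem hm, Option.getD_some]
    obtain ⟨i, hi, e⟩ := mem_parentList.mp (List.getElem_mem hm)
    rw [← e]; exact h i hi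

open Classical in
/-- The cell from which the value of the effective parent `l` of `j` is read. -/
noncomputable def entry (G : ADMG n) (X : Fin n) (j l : ℕ) : ℕ :=
  if l = X ∧ ¬ ∃ hj : j < n, G.bi.Reachable X ⟨j, hj⟩ then n else l

/-- The value of variable `i` in sample `t`, as the machine sees it. -/
def samp (S : ℕ → Fin n → Fin q) (t i : ℕ) : ℕ := if h : i < n then (S t ⟨i, h⟩ : ℕ) else 0

theorem samp_coe (S : ℕ → Fin n → Fin q) (t : ℕ) (i : Fin n) : samp S t i = S t i := by
  simp [samp]

/-- The index of the values of the effective parents of `j` in sample `t`. -/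
noncomputable def sampleCode (G : ADMG n) (pos : Fin n → ℕ) (S : ℕ → Fin n → Fin q) (j t : ℕ) : ℕ :=
  digits q (fun m => samp S t ((parentList G pos j).getD m 0)) (parentList G pos j).length

/-- Entry `i` of array `r` in the memory of `s`. -/
def memAt (n : ℕ) (s : State) (r : Fin 16) (i : ℕ) : ℕ := s.nat (n + 1 + (16 * i + r))

/-- The memory `out` describes the estimate from the first `N` of the samples `S`. -/
structure IsOutput (out : State) (G : ADMG n) (X : Fin n) (x : Fin q) (pos : Fin n → ℕ) (A : ℕ)
    (S : ℕ → Fin n → Fin q) (N : ℕ) : Prop where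
  zero : out.nat 0 = n
  topo : G.IsTopoOrder pos
  pos_lt : ∀ j, pos j < n
  par_zero : memAt n out arrPar 0 = q
  par_one : memAt n out arrPar 1 = X
  par_two : memAt n out arrPar 2 = x
  par_three : memAt n out arrPar 3 = A
  ord : ∀ j, memAt n out arrOrd (pos j) = j
  len : ∀ j : Fin n, memAt n out arrTlen j = (parentList G pos j).length
  ent : ∀ j : Fin n, ∀ m < (parentList G pos j).length,
    memAt n out arrT (j * n + m) = entry G X j ((parentList G pos j).getD m 0)
  cntZ : ∀ (j : Fin n) (z : ℕ), memAt n out arrZ (j + n * z) =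
    ((Finset.range N).filter fun t => sampleCode G pos S j t = z).card
  cntC : ∀ (j : Fin n) (z : ℕ) (a : Fin q), memAt n out arrC ((j + n * z) * q + a) =
    ((Finset.range N).filter fun t => sampleCode G pos S j t = z ∧ S t j = a).card

namespace IsOutput

variable {out : State} {G : ADMG n} {X : Fin n} {x : Fin q} {pos : Fin n → ℕ} {A : ℕ}
    {S : ℕ → Fin n → Fin q} {N : ℕ}

theorem inGet_eq (H : IsOutput out G X x pos A S N) {E : Env} (hE : E.natIn = out.nat)
    (r : Fin 16) (i : ℕ) : inGet E r i = memAt n out r i := by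
  unfold inGet memAt; rw [hE, H.zero]

theorem pos_surj (H : IsOutput out G X x pos A S N) {t : ℕ} (ht : t < n) : ∃ j, pos j = t := by
  have hinj : Function.Injective fun j => (⟨pos j, H.pos_lt j⟩ : Fin n) := fun i j h =>
    H.topo.inj (by simpa using h)
  obtain ⟨j, hj⟩ := (Finite.injective_iff_surjective.mp hinj) ⟨t, ht⟩
  exact ⟨j, by simpa using hj⟩

theorem goodInput (H : IsOutput out G X x pos A S N) {E : Env} (hE : E.natIn = out.nat) {K : ℕ}
    (hK : ∀ j, (G.effParents pos j).card < K) : GoodInput E n q X K where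
  natIn_zero := by rw [hE, H.zero]
  pos := X.pos
  par_zero := by rw [H.inGet_eq hE, H.par_zero]
  par_one := by rw [H.inGet_eq hE, H.par_one]
  X_lt := X.2
  q_pos := x.pos
  len_lt j hj := by rw [H.inGet_eq hE, H.len ⟨j, hj⟩, length_parentList]; exact hK _
  ent_le j hj m hm := by
    rw [H.inGet_eq hE, H.len ⟨j, hj⟩] at hm
    rw [H.inGet_eq hE, H.ent ⟨j, hj⟩ m hm]
    have : (parentList G pos j).getD m 0 ≤ n := by
      refine (forall_parentList (j := ⟨j, hj⟩) (Q := fun l => l ≤ n)).mpr ?_ m hm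
      intro i _; exact i.2.le
    unfold entry
    split_ifs
    · exact le_rfl
    · exact this
  ord_lt t ht := by
    obtain ⟨j, rfl⟩ := H.pos_surj ht
    rw [H.inGet_eq hE, H.ord]; exact j.2

/-- The intervention is built into the addresses: outside the c-component of `X`, the parent `X` is
read from the extra cell `n`, which holds `x`. The lookup itself needs no case distinction. -/
theorem intervene_entry (G : ADMG n) (X : Fin n) (x : Fin q) {j l : Fin n} {v : Fin n → Fin q}
    {vals : ℕ → ℕ} (hl : vals l = v l) (hx : vals n = x) :
    vals (entry G X j l) = G.intervene X x j v l := by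
  unfold entry ADMG.intervene
  by_cases hr : G.bi.Reachable X j
  · simp [hr, hl]
  · by_cases h : l = X
    · subst h; simp [hr, hx]
    · have : (l : ℕ) ≠ X := fun e => h (Fin.ext e)
      simp [hr, h, this, hl]

/-- The machine computes the smoothed empirical conditional probabilities. -/
theorem ratio_eq (H : IsOutput out G X x pos A S N) {E : Env} (hE : E.natIn = out.nat) {j : Fin n}
    {v : Fin n → Fin q} {vals : ℕ → ℕ} (hv : ∀ l ∈ G.effParents pos j, vals l = v l)
    (hx : vals n = x) (a : Fin q) :
    ratio E vals j a =
      estimate G pos A S N j (Function.update (G.intervene X x j v) j a) := by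
  set T := G.effParents pos j with hT
  set v' := G.intervene X x j v with hv'
  have hjT : j ∉ T := G.self_notMem_effParents pos j
  have hne : ∀ l ∈ T, l ≠ j := by rintro l hl rfl; exact hjT hl
  set z := digits q (fun m => vals (entry G X j ((parentList G pos j).getD m 0)))
    (parentList G pos j).length with hz
  have hcell : cellIdx E vals j = j + n * z := by
    unfold cellIdx
    rw [H.inGet_eq hE, H.inGet_eq hE, H.par_zero, H.len, hE, H.zero]
    congr 2
    refine digits_congr fun m hm => ?_
    rw [H.inGet_eq hE, H.ent j m hm]
  have hval : ∀ m < (parentList G pos j).length,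
      ∀ l ∈ T, (parentList G pos j).getD m 0 = l →
        vals (entry G X j ((parentList G pos j).getD m 0)) = v' l := by
    intro m _ l hl e
    rw [e]; exact intervene_entry G X x (hv l hl) hx
  -- All digits are below `q`, so equal codes mean equal values. The sample is read unredirected,
  -- while the other side reads through `entry`; thus samples are compared with the intervened
  -- assignment.
  have hcode : ∀ t, sampleCode G pos S j t = z ↔ ∀ i ∈ T, S t i = v' i := by
    intro t
    have h1 : (∀ i ∈ T, S t i = v' i) ↔ ∀ m < (parentList G pos j).length,
        samp S t ((parentList G pos j).getD m 0) =
          vals (entry G X j ((parentList G pos j).getD m 0)) := by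
      rw [forall_parentList (Q := fun l => samp S t l = vals (entry G X j l))]
      refine forall₂_congr fun i hi => ?_
      rw [samp_coe, intervene_entry G X x (hv i hi) hx, Fin.ext_iff]
    rw [h1]
    constructor
    · refine digits_inj ?_ ?_
      · rw [forall_parentList (Q := fun l => samp S t l < q)]
        intro i _; rw [samp_coe]; exact (S t i).2
      · rw [forall_parentList (Q := fun l => vals (entry G X j l) < q)]
        intro i hi; rw [intervene_entry G X x (hv i hi) hx]; exact (v' i).2
    · exact fun h => digits_congr h
  unfold ratio estimate
  rw [hcell]
  simp only [H.inGet_eq hE, H.par_zero, H.par_three, H.cntZ, H.cntC]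
  have e1 : ((Finset.range N).filter fun t => sampleCode G pos S j t = z).card =
      agreeCount S N T (Function.update v' j a) := by
    rw [agreeCount_congr S N (v' := v') fun l hl => Function.update_of_ne (hne l hl) _ _]
    unfold agreeCount
    congr 1
    exact Finset.filter_congr fun t _ => hcode t
  have e2 : ((Finset.range N).filter fun t => sampleCode G pos S j t = z ∧ S t j = a).card =
      agreeCount S N (insert j T) (Function.update v' j a) := by
    unfold agreeCount
    congr 1
    refine Finset.filter_congr fun t _ => ?_
    rw [hcode t]
    simp only [Finset.mem_insert, forall_eq_or_imp, Function.update_self]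
    rw [and_comm]
    refine and_congr_right fun _ => forall₂_congr fun i hi => ?_
    rw [Function.update_of_ne (hne i hi)]
  rw [e1, e2]
  push_cast
  rfl

theorem evaluatesWithin (H : IsOutput out G X x pos A S N) (hA : (0 : ℝ) < A) {K : ℕ}
    (hK : ∀ j, (G.effParents pos j).card < K) :
    EvaluatesWithin evalProg out (estDist S N H.topo hA X x) (3000 * (n * q * K)) := by
  intro w
  obtain ⟨t, s, he, ht, hs⟩ := runs_evalProg (H.goodInput (E := evalEnv X out w) rfl hK)
  refine ⟨t, s, he, ?_, ?_⟩
  · have : (t : ℝ) ≤ (2000 * (n * q * K) : ℕ) := by exact_mod_cast ht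
    refine this.trans ?_
    push_cast
    have : (0 : ℝ) ≤ n * q * K := by positivity
    linarith
  · rw [hs, toReal_estDist, Finset.sum_range]
    refine Finset.sum_congr rfl fun a _ => ?_
    rw [Finset.prod_range]
    refine Finset.prod_congr rfl fun j _ => ?_
    set E := evalEnv X out w
    have hE0 : E.natIn 0 = n := H.zero
    have hpar2 : inGet E arrPar 2 = x := by rw [H.inGet_eq rfl, H.par_two]
    have hpar1 : inGet E arrPar 1 = X := by rw [H.inGet_eq rfl, H.par_one]
    have hvals : ∀ i : Fin n, evalVals E a i = extendAssign X a w i := by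
      intro i
      unfold evalVals
      rw [hE0, if_neg (by have := i.2; omega), hpar1]
      by_cases hi : i = X
      · subst hi; simp [extendAssign]
      · rw [if_neg fun e => hi (Fin.ext e)]
        simp [E, evalEnv, extendAssign, hi]
    have hn : evalVals E a n = x := by
      unfold evalVals; rw [hE0, if_pos rfl, hpar2]
    rw [hvals j, H.ratio_eq (v := extendAssign X a w) rfl (fun l _ => hvals l) hn,
      ← intervene_update, Function.update_eq_self]

/-! ### The law of the generated sample -/

theorem genVals_n (H : IsOutput out G X x pos A S N) (r : ℕ → unitInterval) (t : ℕ)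
    (ht : t ≤ n) : genVals (genEnv n out r) t n = x := by
  have hE : (genEnv n out r).natIn = out.nat := rfl
  induction t with
  | zero => simp only [genVals]; rw [hE, if_pos H.zero.symm, H.inGet_eq hE, H.par_two]
  | succ t ih =>
    simp only [genVals]
    obtain ⟨j, hj⟩ := H.pos_surj (t := t) (by omega)
    rw [Function.update_of_ne, ih (by omega)]
    rw [H.inGet_eq hE, ← hj, H.ord]
    exact j.2.ne'

theorem genVals_succ_pos (H : IsOutput out G X x pos A S N) (r : ℕ → unitInterval)
    (j : Fin n) : genVals (genEnv n out r) (pos j + 1) j =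
    pick (ratio (genEnv n out r) (genVals (genEnv n out r) (pos j)) j) (r (pos j)) (q - 1) := by
  have hE : (genEnv n out r).natIn = out.nat := rfl
  simp only [genVals]
  rw [H.inGet_eq hE, H.ord, H.inGet_eq hE, H.par_zero, Function.update_self]
  rfl

theorem genVals_stable (H : IsOutput out G X x pos A S N) (r : ℕ → unitInterval)
    (j : Fin n) {t : ℕ} (h1 : pos j < t) (h2 : t ≤ n) :
    genVals (genEnv n out r) t j = genVals (genEnv n out r) (pos j + 1) j := by
  have hE : (genEnv n out r).natIn = out.nat := rfl
  induction t, h1 using Nat.le_induction with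
  | base => rfl
  | succ t ht ih =>
    rw [← ih (by omega)]
    simp only [genVals]
    obtain ⟨i, hi⟩ := H.pos_surj (t := t) (by omega)
    rw [Function.update_of_ne]
    rw [H.inGet_eq hE, ← hi, H.ord]
    intro e
    have : j = i := Fin.ext e
    subst this; omega

/-- The program generates `v` if and only if every coin falls into the right interval. -/
theorem genVals_eq_iff (H : IsOutput out G X x pos A S N) (r : ℕ → unitInterval)
    (v : Fin n → Fin q) :
    (∀ i : Fin n, genVals (genEnv n out r) n i = v i) ↔
      ∀ j, pick (fun b => if h : b < q then
        estimate G pos A S N j (Function.update (G.intervene X x j v) j ⟨b, h⟩) else 0)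
          (r (pos j)) (q - 1) = v j := by
  have hE : (genEnv n out r).natIn = out.nat := rfl
  have hpick : ∀ (p p' : ℕ → ℝ) (u : ℝ) (m : ℕ), (∀ b < m, p b = p' b) →
      pick p u m = pick p' u m := by
    intro p p' u m
    induction m with
    | zero => intro _; rfl
    | succ m ih =>
      intro h
      simp only [pick]
      rw [ih fun b hb => h b (by omega), Finset.sum_congr rfl fun b hb => h b (Finset.mem_range.mp hb)]
  have key : ∀ j, (∀ l, pos l < pos j → genVals (genEnv n out r) (pos j) l = v l) →
      genVals (genEnv n out r) (pos j + 1) j = pick (fun b => if h : b < q then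
        estimate G pos A S N j (Function.update (G.intervene X x j v) j ⟨b, h⟩) else 0)
          (r (pos j)) (q - 1) := by
    intro j hj
    rw [H.genVals_succ_pos]
    refine hpick _ _ _ _ fun b hb => ?_
    have hbq : b < q := by omega
    rw [dif_pos hbq]
    exact H.ratio_eq hE (fun l hl => hj l ((G.mem_effParents pos j l).mp hl).2)
      (H.genVals_n r _ (H.pos_lt j).le) ⟨b, hbq⟩
  constructor
  · intro h j
    rw [← key j fun l hl => ?_, ← H.genVals_stable r j (H.pos_lt j) le_rfl, h j]
    rw [H.genVals_stable r l hl (H.pos_lt j).le, ← H.genVals_stable r l (H.pos_lt l) le_rfl, h l]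
  · intro h
    -- The conditional probabilities used for `j` agree with those under `v` once all earlier
    -- variables have the values given by `v`; hence strong induction along the order.
    have : ∀ m, ∀ j, pos j = m → genVals (genEnv n out r) (pos j + 1) j = v j := by
      intro m
      induction m using Nat.strong_induction_on with
      | _ m ih =>
        rintro j rfl
        rw [key j fun l hl => ?_, h j]
        rw [H.genVals_stable r l hl (H.pos_lt j).le, ih (pos l) hl l rfl]
    intro i
    rw [H.genVals_stable r i (H.pos_lt i) le_rfl, this _ i rfl]

/-- By `genVals_eq_iff` the event is a box in the first `n` random numbers, whose sides have the
estimated conditional probabilities as lengths. Independence makes its probability their product. -/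
theorem coinLaw_genVals (H : IsOutput out G X x pos A S N) (hA : (0 : ℝ) < A) (v : Fin n → Fin q) :
    MeasurableSet {r : ℕ → unitInterval | ∀ i : Fin n, genVals (genEnv n out r) n i = v i} ∧
    coinLaw {r | ∀ i : Fin n, genVals (genEnv n out r) n i = v i} =
      ENNReal.ofReal (∏ j, estimate G pos A S N j (G.intervene X x j v)) := by
  set p : Fin n → ℕ → ℝ := fun j b => if h : b < q then
        estimate G pos A S N j (Function.update (G.intervene X x j v) j ⟨b, h⟩) else 0 with hp
  have hp0 : ∀ j b, 0 ≤ p j b := by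
    intro j b
    simp only [hp]
    split_ifs
    · exact (estimate_pos S N hA _ _).le
    · exact le_rfl
  have hp1 : ∀ j, ∑ b ∈ Finset.range q, p j b = 1 := by
    intro j
    rw [Finset.sum_range, ← (isBayesNet_estimate S N H.topo hA).sum_one j (G.intervene X x j v)]
    exact Finset.sum_congr rfl fun b _ => by simp [hp]
  have hvol := fun j => measurableSet_pick_and_volume (hp0 j) (v j).2 (hp1 j)
  let ord : ℕ → Fin n := fun t => if h : ∃ j, pos j = t then h.choose else X
  have hord : ∀ j, ord (pos j) = j := by
    intro j
    have h : ∃ i, pos i = pos j := ⟨j, rfl⟩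
    simp only [ord, dif_pos h]
    exact H.topo.inj h.choose_spec
  have hset : {r : ℕ → unitInterval | ∀ i : Fin n, genVals (genEnv n out r) n i = v i} =
      Set.pi (Finset.range n) fun t =>
        {u : unitInterval | pick (p (ord t)) u (q - 1) = v (ord t)} := by
    ext r
    rw [Set.mem_ofPred_eq, H.genVals_eq_iff r v]
    simp only [Set.mem_pi, Finset.coe_range, Set.mem_Iio, Set.mem_ofPred_eq]
    constructor
    · intro h t ht
      obtain ⟨j, rfl⟩ := H.pos_surj ht
      rw [hord]; exact h j
    · intro h j
      have := h (pos j) (H.pos_lt j)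
      rwa [hord] at this
  rw [hset]
  refine ⟨MeasurableSet.pi (Finset.range n).countable_toSet fun t _ => (hvol _).1, ?_⟩
  unfold coinLaw
  rw [Measure.infinitePi_pi _ fun t _ => (hvol _).1]
  simp only [(hvol _).2]
  rw [ENNReal.ofReal_prod_of_nonneg fun j _ => (estimate_pos S N hA _ _).le]
  symm
  refine Finset.prod_bij (fun j _ => pos j) (fun j _ => Finset.mem_range.mpr (H.pos_lt j))
    (fun i _ j _ h => H.topo.inj h) (fun t ht => ?_) fun j _ => ?_
  · obtain ⟨j, hj⟩ := H.pos_surj (Finset.mem_range.mp ht)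
    exact ⟨j, Finset.mem_univ _, hj⟩
  · rw [hord]
    congr 1
    simp only [hp, (v j).2, dite_true, Fin.eta]
    congr 1
    have : v j = G.intervene X x j v j := by
      unfold ADMG.intervene
      split_ifs with hr
      · rfl
      · rw [Function.update_of_ne]
        rintro rfl; exact hr (SimpleGraph.Reachable.refl _)
    rw [this, Function.update_eq_self]

theorem generatesWithin (H : IsOutput out G X x pos A S N) (hA : (0 : ℝ) < A) {K : ℕ}
    (hK : ∀ j, (G.effParents pos j).card < K) :
    GeneratesWithin genProg out (estDist S N H.topo hA X x) (3000 * (n * q * K)) := by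
  have hrun := fun r => runs_genProg (H.goodInput (E := genEnv n out r) rfl hK)
  refine ⟨fun r => ?_, fun w => ?_⟩
  · obtain ⟨t, s, he, ht, -⟩ := hrun r
    exact ⟨t, s, he, by exact_mod_cast ht⟩
  -- The value generated for `X` is ignored, so the event is a disjoint union over its possible
  -- values. This is the same sum over `a` as in `estDist`.
  · have hset : {r | ∃ t s, Exec (genEnv n out r) genProg State.init t s ∧
        ∀ i : {i : Fin n // i ≠ X}, s.nat i.1 = w i} =
        ⋃ a : Fin q, {r | ∀ i : Fin n, genVals (genEnv n out r) n i = extendAssign X a w i} := by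
      ext r
      simp only [Set.mem_ofPred_eq, Set.mem_iUnion]
      obtain ⟨t, s, he, -, hs⟩ := hrun r
      constructor
      · rintro ⟨t', s', he', h⟩
        obtain ⟨-, rfl⟩ := he.deterministic he'
        have hlt : genVals (genEnv n out r) n X < q := by
          rw [H.genVals_stable r X (H.pos_lt X) le_rfl, H.genVals_succ_pos]
          have := pick_le (ratio (genEnv n out r) (genVals (genEnv n out r) (pos X)) X)
            (r (pos X)) (q - 1)
          have := x.pos
          omega
        refine ⟨⟨_, hlt⟩, fun i => ?_⟩
        by_cases hi : i = X
        · subst hi; simp [extendAssign]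
        · rw [← hs i i.2.le, h ⟨i, hi⟩]; simp [extendAssign, hi]
      · rintro ⟨a, h⟩
        refine ⟨t, s, he, fun i => ?_⟩
        rw [hs i.1 i.1.2.le, h i.1]; simp [extendAssign, i.2]
    rw [hset, measure_iUnion]
    · simp only [fun v => (H.coinLaw_genVals hA v).2]
      rw [tsum_fintype, ← ENNReal.ofReal_sum_of_nonneg]
      · rfl
      · intro a _
        exact Finset.prod_nonneg fun j _ => (estimate_pos S N hA _ _).le
    · intro a b hab
      rw [Function.onFun, Set.disjoint_left]
      intro r h1 h2
      apply hab
      have e1 := h1 X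
      have e2 := h2 X
      rw [e1] at e2
      simpa [extendAssign, Fin.ext_iff] using e2
    · exact fun a => (H.coinLaw_genVals hA _).1

theorem represents (H : IsOutput out G X x pos A S N) (hA : (0 : ℝ) < A) {K : ℕ}
    (hK : ∀ j, (G.effParents pos j).card < K) :
    Represents evalProg genProg out (estDist S N H.topo hA X x) (3000 * (n * q * K)) :=
  ⟨H.evaluatesWithin hA hK, H.generatesWithin hA hK⟩

end IsOutput

end RealRAM

/-! ### Topological order and labels of c-components -/

namespace ADMG

variable {n : ℕ} (G : ADMG n)

theorem wellFounded_dir : WellFounded G.dir := by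
  have : Std.Irrefl (Relation.TransGen G.dir) := ⟨fun a => G.acyclic a⟩
  have wf := Finite.wellFounded_of_trans_of_irrefl (Relation.TransGen G.dir)
  exact Subrelation.wf (fun h => Relation.TransGen.single h) wf

/-- Well-founded recursion along the edges, one more than the maximum over the parents. The bound
`n` ensures that `n` rounds of relaxation find these values. -/
theorem exists_depth : ∃ dep : Fin n → ℕ, (∀ i j, G.dir i j → dep i + 1 ≤ dep j) ∧
    (∀ j, dep j ≠ 0 → ∃ i, G.dir i j ∧ dep j = dep i + 1) ∧ ∀ j, dep j < n := by
  classical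
  let dep : Fin n → ℕ := G.wellFounded_dir.fix fun j ih =>
    Finset.univ.sup fun i => if h : G.dir i j then ih i h + 1 else 0
  have hdep : ∀ j, dep j = Finset.univ.sup fun i => if G.dir i j then dep i + 1 else 0 := by
    intro j
    simp only [dep]
    rw [WellFounded.fix_eq]
    congr 1
  have h1 : ∀ i j, G.dir i j → dep i + 1 ≤ dep j := by
    intro i j h
    rw [hdep j]
    refine le_trans ?_ (Finset.le_sup (Finset.mem_univ i))
    rw [if_pos h]
  have h2 : ∀ j, dep j ≠ 0 → ∃ i, G.dir i j ∧ dep j = dep i + 1 := by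
    intro j hj
    obtain ⟨i, -, hi⟩ := Finset.exists_mem_eq_sup Finset.univ ⟨j, Finset.mem_univ j⟩
      fun i => if G.dir i j then dep i + 1 else 0
    rw [← hdep j] at hi
    split_ifs at hi with h
    · exact ⟨i, h, hi⟩
    · exact absurd hi hj
  refine ⟨dep, h1, h2, fun j => ?_⟩
  -- The depth is at most the number of proper ancestors, which grows strictly along an edge and
  -- never includes the variable itself.
  have h3 : dep j ≤ (Finset.univ.filter fun i => Relation.TransGen G.dir i j).card := by
    induction j using G.wellFounded_dir.induction with
    | _ j ih =>
      by_cases hj : dep j = 0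
      · omega
      obtain ⟨i, hi, e⟩ := h2 j hj
      rw [e]
      refine Nat.succ_le_of_lt ((ih i hi).trans_lt (Finset.card_lt_card ?_))
      rw [Finset.ssubset_iff_of_subset]
      · exact ⟨i, by simp [Relation.TransGen.single hi], by simpa using G.acyclic i⟩
      · intro l hl
        simp only [Finset.mem_filter, Finset.mem_univ, true_and] at hl ⊢
        exact hl.tail hi
  refine h3.trans_lt ?_
  have : (Finset.univ.filter fun i => Relation.TransGen G.dir i j).card <
      (Finset.univ : Finset (Fin n)).card := by
    refine Finset.card_lt_card ?_
    rw [Finset.ssubset_iff_of_subset (Finset.subset_univ _)]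
    exact ⟨j, Finset.mem_univ j, by simpa using G.acyclic j⟩
  simpa using this

/-- The length of the longest directed path that ends in `j`. -/
noncomputable def depth (j : ℕ) : ℕ := if h : j < n then G.exists_depth.choose ⟨j, h⟩ else 0

theorem depth_coe (j : Fin n) : G.depth j = G.exists_depth.choose j := by simp [depth]

theorem depth_lt_of_dir {i j : Fin n} (h : G.dir i j) : G.depth i + 1 ≤ G.depth j := by
  rw [depth_coe, depth_coe]; exact G.exists_depth.choose_spec.1 i j h

theorem exists_of_depth_ne_zero {j : Fin n} (h : G.depth j ≠ 0) :
    ∃ i, G.dir i j ∧ G.depth j = G.depth i + 1 := by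
  rw [depth_coe] at h ⊢
  obtain ⟨i, hi, e⟩ := G.exists_depth.choose_spec.2.1 j h
  exact ⟨i, hi, by rw [depth_coe]; exact e⟩

theorem depth_lt (j : Fin n) : G.depth j < n := by
  rw [depth_coe]; exact G.exists_depth.choose_spec.2.2 j

open Classical in
/-- The largest element of the c-component of `j`. -/
noncomputable def label (j : ℕ) : ℕ :=
  if h : j < n then (Finset.univ.filter fun i => G.bi.Reachable ⟨j, h⟩ i).sup
    fun i : Fin n => (i : ℕ) else 0

theorem exists_label (j : Fin n) : ∃ i : Fin n, G.bi.Reachable j i ∧ G.label j = i := by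
  classical
  obtain ⟨i, hi, e⟩ := Finset.exists_mem_eq_sup (Finset.univ.filter fun i => G.bi.Reachable j i)
    ⟨j, by simp⟩ fun i : Fin n => (i : ℕ)
  refine ⟨i, by simpa using hi, ?_⟩
  simp [label, e]

theorem le_label {i j : Fin n} (h : G.bi.Reachable j i) : (i : ℕ) ≤ G.label j := by
  classical
  simp only [label, j.2, dif_pos]
  exact Finset.le_sup (f := fun i : Fin n => (i : ℕ)) (by simpa using h)

theorem label_lt (j : Fin n) : G.label j < n := by
  obtain ⟨i, -, e⟩ := G.exists_label j
  rw [e]; exact i.2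

theorem label_eq_iff {i j : Fin n} : G.label i = G.label j ↔ G.bi.Reachable i j := by
  constructor
  · intro h
    obtain ⟨a, ha, ea⟩ := G.exists_label i
    obtain ⟨b, hb, eb⟩ := G.exists_label j
    have : a = b := Fin.ext (by rw [← ea, ← eb, h])
    subst this
    exact ha.trans hb.symm
  · intro h
    obtain ⟨a, ha, ea⟩ := G.exists_label i
    obtain ⟨b, hb, eb⟩ := G.exists_label j
    refine le_antisymm ?_ ?_
    · rw [ea]; exact G.le_label (h.symm.trans ha)
    · rw [eb]; exact G.le_label (h.trans hb)

/-- A key that is larger for children. -/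
noncomputable def key (j : ℕ) : ℕ := G.depth j * n + j

theorem key_inj {i j : Fin n} (h : G.key i = G.key j) : i = j := by
  by_contra hne
  unfold key at h
  by_cases hd : G.depth i = G.depth j
  · rw [hd] at h; exact hne (Fin.ext (by omega))
  · exact mul_add_ne i.2 j.2 hd h

theorem key_lt_of_dir {i j : Fin n} (h : G.dir i j) : G.key i < G.key j := by
  have h1 := G.depth_lt_of_dir h
  have h2 := Nat.mul_le_mul_right n h1
  have := i.2
  unfold key
  rw [Nat.add_mul] at h2
  omega

/-- The number of smaller keys. -/
noncomputable def keyPos (j : ℕ) : ℕ := (sel (fun l => decide (G.key l < G.key j)) n).length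

theorem keyPos_eq (j : ℕ) :
    G.keyPos j = ((Finset.range n).filter fun l => G.key l < G.key j).card := by
  unfold keyPos sel
  have hnd : ((List.range n).filter fun l => decide (G.key l < G.key j)).Nodup :=
    List.nodup_range.filter _
  rw [← List.toFinset_card_of_nodup hnd]
  congr 1
  ext l; simp

theorem keyPos_lt_of_key_lt {i j : Fin n} (h : G.key i < G.key j) : G.keyPos i < G.keyPos j := by
  rw [keyPos_eq, keyPos_eq]
  refine Finset.card_lt_card ?_
  rw [Finset.ssubset_iff_of_subset]
  · exact ⟨i, by simp [h], by simp⟩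
  · intro l hl
    simp only [Finset.mem_filter] at hl ⊢
    exact ⟨hl.1, hl.2.trans h⟩

theorem keyPos_lt (j : Fin n) : G.keyPos j < n := by
  rw [keyPos_eq]
  have : ((Finset.range n).filter fun l => G.key l < G.key j).card < (Finset.range n).card := by
    refine Finset.card_lt_card ?_
    rw [Finset.ssubset_iff_of_subset (Finset.filter_subset _ _)]
    exact ⟨j, by simp, by simp⟩
  simpa using this

theorem isTopoOrder_keyPos : G.IsTopoOrder fun j => G.keyPos j where
  inj i j h := by
    rcases lt_trichotomy (G.key i) (G.key j) with h1 | h1 | h1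
    · have := G.keyPos_lt_of_key_lt h1; simp only at h; omega
    · exact G.key_inj h1
    · have := G.keyPos_lt_of_key_lt h1; simp only at h; omega
  lt i j h := G.keyPos_lt_of_key_lt (G.key_lt_of_dir h)

end ADMG

/-! ### The learner: preparing the graph -/

namespace RealRAM

theorem HasList.frame {E : Env} {R : Finset (Fin 16)} {s s' : State} {rL rN : Fin 16} {n : ℕ}
    {p : ℕ → ℕ} {li : List ℕ} {j : ℕ} (h : HasList E s rL rN n p li j) (hf : Frame E R s s')
    (hL : rL ∉ R) (hN : rN ∉ R) : HasList E s' rL rN n p li j :=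
  ⟨(hf.1 rN hN j).trans h.1, fun m hm => (hf.1 rL hL _).trans (h.2 m hm)⟩

/-- A loop that performs one assignment for every variable. -/
theorem runs_forC_wr {E : Env} {s : State} {n : ℕ} (hn : E.natIn 0 = n) {r : Fin 16} (hr : r ≠ 0)
    {a e : NExp} (f g : ℕ → ℕ)
    (hf : ∀ s' j, j < n → Frame E {0, r} s s' → get E s' 0 0 = j →
      a.eval E s' = f j ∧ e.eval E s' = g j)
    (hinj : ∀ i < n, ∀ j < n, f i = f j → i = j) :
    Runs E (forC 0 nE (wr r a e)) s (26 + n * (a.cost + e.cost + 60)) fun s' =>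
      Frame E {0, r} s s' ∧ ∀ j < n, get E s' r (f j) = g j := by
  refine (runs_forC_const n (fun i s' => Frame E {0, r} s s' ∧ ∀ j < i, get E s' r (f j) = g j)
    (a.cost + e.cost + 10) ?_ (by intro _ _ _ _; exact hn) ?_).mono ?_ fun s' h => h.1
  · exact ⟨(Frame.refl _ _ _).put (by simp) _ _, by simp⟩
  · rintro i s₁ hi ⟨hfr, hval⟩ hv
    obtain ⟨h1, h2⟩ := hf s₁ i hi hfr hv
    refine (runs_of_wp ?_).mono (by rw [bound_wr]) fun s' h => h
    rw [wp_wr, h1, h2]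
    refine ⟨by simp [get_put, hr.symm, hv], (hfr.put (by simp) _ _).put (by simp) _ _,
      fun j hj => ?_⟩
    rw [get_put, if_neg (by simp [hr]), get_put]
    by_cases hji : j = i
    · subst hji; simp
    · rw [if_neg fun h => hji (hinj j (by omega) i hi h.2), hval j (by omega)]
  · simp only [cost_nE]
    have : n * (a.cost + e.cost + 10 + 36 + 2) ≤ n * (a.cost + e.cost + 60) :=
      Nat.mul_le_mul_left _ (by omega)
    omega

/-- The entry of the matrix of directed edges for the edge from scalar `1` to scalar `0`. -/
def dirE : NExp := .natIn (.add (.add (.mul (sc 1) nE) (sc 0)) (.const 4))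

/-- The entry of the matrix of bidirected edges for the scalars `1` and `0`. -/
def biE : NExp :=
  .natIn (.add (.add (.mul nE nE) (.add (.mul (sc 1) nE) (sc 0))) (.const 4))

/-- Computes `1` if `a` and `b` are equal and `0` otherwise. -/
def eqE (a b : NExp) : NExp := .sub (.const 1) (.add (.sub a b) (.sub b a))

theorem eval_eqE (E : Env) (s : State) (a b : NExp) :
    (eqE a b).eval E s = if a.eval E s = b.eval E s then 1 else 0 := by
  simp only [eqE, NExp.eval]; split_ifs <;> omega

theorem cost_eqE (a b : NExp) : (eqE a b).cost = 2 * a.cost + 2 * b.cost + 5 := by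
  simp only [eqE, NExp.cost]; omega

/-- Marks the members of all c-components and their parents. -/
def flagProg : Cmd :=
  forC 0 nE (forC 1 nE (.ite (.natLt (.const 0) (.add dirE (eqE (sc 1) (sc 0))))
    (wr 7 (.add (.mul (rd 6 (sc 0)) nE) (sc 1)) (.const 1)) .skip))

/-- One pass over all pairs marks `l` in the row of the component of `j` if `l` is a parent of `j`
or `j` itself. Row `c` then describes the component labelled `c` together with its parents, without
any search for its members. -/
theorem runs_flagProg {E : Env} {s : State} {n : ℕ} (hn : E.natIn 0 = n) (lab : ℕ → ℕ)
    (hlab : ∀ j < n, get E s 6 j = lab j)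
    (Dr : ℕ → ℕ → Prop) (hDr : ∀ l < n, ∀ j < n, 0 < E.natIn (l * n + j + 4) ↔ Dr l j)
    (hz : ∀ i, get E s 7 i = 0) :
    Runs E flagProg s (26 + n * (100 + n * 400)) fun s' => Frame E {0, 7} s s' ∧
      ∀ c < n, ∀ l < n, 0 < get E s' 7 (c * n + l) ↔ ∃ j < n, lab j = c ∧ (Dr l j ∨ l = j) := by
  let Lim : (ℕ → ℕ) → State → Prop := fun lim s' => Frame E {0, 7} s s' ∧
    ∀ c < n, ∀ l < n, 0 < get E s' 7 (c * n + l) ↔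
      ∃ j < n, lab j = c ∧ l < lim j ∧ (Dr l j ∨ l = j)
  have hput : ∀ lim s' v k, Lim lim s' → Lim lim (put E s' 0 v k) := by
    intro lim s' v k h
    refine ⟨h.1.put (by simp) v k, fun c hc l hl => ?_⟩
    rw [get_put, if_neg (by simp)]; exact h.2 c hc l hl
  have hcongr : ∀ lim lim' s', (∀ j < n, lim j = lim' j) → Lim lim s' → Lim lim' s' := by
    intro lim lim' s' he h
    refine ⟨h.1, fun c hc l hl => (h.2 c hc l hl).trans ?_⟩
    refine exists_congr fun j => and_congr_right fun hj => ?_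
    rw [he j hj]
  refine (runs_forC_const n (fun j s' => Lim (fun j' => if j' < j then n else 0) s')
    (60 + n * 400) ?_ (by intro _ _ _ _; exact hn) ?_).mono ?_ ?_
  · refine hput _ _ _ _ ⟨Frame.refl _ _ _, fun c hc l hl => ?_⟩
    simp [hz]
  · intro j s₁ hj hinv hv
    refine (runs_forC_const n (fun l s' => get E s' 0 0 = j ∧
      Lim (fun j' => if j' < j then n else if j' = j then l else 0) s') 300
      ?_ (by intro _ _ _ _; exact hn) ?_).mono ?_ ?_
    · refine ⟨by simp [get_put, hv], hput _ _ _ _ (hcongr _ _ _ (fun j' _ => ?_) hinv)⟩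
      split_ifs <;> rfl
    · rintro l s₂ hl ⟨h20, h2⟩ h21
      have hlabj : get E s₂ 6 j = lab j := by rw [h2.1.1 6 (by decide), hlab j hj]
      have hcond : (BExp.natLt (.const 0) (.add dirE (eqE (sc 1) (sc 0)))).Holds E s₂ ↔
          (Dr l j ∨ l = j) := by
        simp only [BExp.Holds, NExp.eval, dirE, eval_eqE, eval_sc, eval_nE, h20, h21, hn]
        rw [← hDr l hl j hj]
        split_ifs with e <;> simp [e]
      refine (runs_of_wp (Q := fun s' => get E s' 0 0 = j ∧ get E s' 0 1 = l ∧
        Lim (fun j' => if j' < j then n else if j' = j then l + 1 else 0) s') ?_).mono ?_ ?_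
      · simp only [wp, wp_wr]
        rw [hcond]
        simp only [NExp.eval, eval_rd, eval_sc, eval_nE, h20, h21, hn, hlabj]
        have hstep : ∀ c < n, ∀ l' < n, (∃ j' < n, lab j' = c ∧
            l' < (if j' < j then n else if j' = j then l + 1 else 0) ∧ (Dr l' j' ∨ l' = j')) ↔
            (∃ j' < n, lab j' = c ∧ l' < (if j' < j then n else if j' = j then l else 0) ∧
              (Dr l' j' ∨ l' = j')) ∨ (c = lab j ∧ l' = l ∧ (Dr l j ∨ l = j)) := by
          intro c hc l' hl'
          constructor
          · rintro ⟨j', hj', e, hlim, h⟩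
            by_cases hjj : j' = j
            · subst hjj
              simp only [lt_irrefl, if_false, if_true] at hlim
              rcases Nat.lt_succ_iff_lt_or_eq.mp hlim with h1 | rfl
              · exact Or.inl ⟨j', hj', e, by simpa using h1, h⟩
              · exact Or.inr ⟨e.symm, rfl, h⟩
            · simp only [hjj, if_false] at hlim
              exact Or.inl ⟨j', hj', e, by simpa only [hjj, if_false] using hlim, h⟩
          · rintro (⟨j', hj', e, hlim, h⟩ | ⟨rfl, rfl, h⟩)
            · refine ⟨j', hj', e, ?_, h⟩
              split_ifs at hlim ⊢ <;> omega
            · exact ⟨j, hj, rfl, by simp, h⟩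
        constructor
        · intro hD
          refine ⟨by simp [get_put, h20], by simp [get_put, h21], h2.1.put (by simp) _ _,
            fun c hc l' hl' => ?_⟩
          rw [hstep c hc l' hl', get_put]
          by_cases he : c = lab j ∧ l' = l
          · obtain ⟨rfl, rfl⟩ := he
            simp [hD]
          · rw [if_neg, h2.2 c hc l' hl']
            · constructor
              · exact Or.inl
              · rintro (h | ⟨h1, h2, -⟩)
                · exact h
                · exact absurd ⟨h1, h2⟩ he
            · rintro ⟨-, e⟩
              by_cases hcl : c = lab j
              · subst hcl; exact he ⟨rfl, by omega⟩
              · exact mul_add_ne hl' hl hcl e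
        · intro hD
          refine ⟨trivial, trivial, h2.1, fun c hc l' hl' => ?_⟩
          rw [hstep c hc l' hl', h2.2 c hc l' hl']
          simp [hD]
      · simp only [Cmd.bound, bound_wr, BExp.cost, NExp.cost, dirE, cost_eqE, cost_rd, cost_sc,
          cost_nE]
        omega
      · rintro s' ⟨h1, h2, h3⟩
        exact ⟨h2, by simp [get_put, h1], hput _ _ _ _ h3⟩
    · simp only [cost_nE]; omega
    · rintro s' ⟨⟨h1, h2⟩, -⟩
      refine ⟨h1, hput _ _ _ _ (hcongr _ _ _ (fun j' _ => ?_) h2)⟩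
      split_ifs <;> omega
  · simp only [cost_nE]
    have : n * (60 + n * 400 + 36 + 2) ≤ n * (100 + n * 400) := Nat.mul_le_mul_left _ (by omega)
    omega
  · rintro s' ⟨⟨h1, h2⟩, -⟩
    refine ⟨h1, fun c hc l hl => (h2 c hc l hl).trans ?_⟩
    refine exists_congr fun j => and_congr_right fun hj => ?_
    simp [hj, hl]

end RealRAM

/-! ### The lists of parents and neighbours -/

namespace ADMG

variable {n : ℕ} (G : ADMG n)

/-- The directed edges as a relation on natural numbers. -/
def dirN (l j : ℕ) : Prop := ∃ (hl : l < n) (hj : j < n), G.dir ⟨l, hl⟩ ⟨j, hj⟩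

/-- The bidirected edges as a relation on natural numbers. -/
def biN (l j : ℕ) : Prop := ∃ (hl : l < n) (hj : j < n), G.bi.Adj ⟨l, hl⟩ ⟨j, hj⟩

open Classical in
/-- The list of the parents of `j`. -/
noncomputable def dirList (j : ℕ) : List ℕ := sel (fun l => decide (G.dirN l j)) n

open Classical in
/-- The list of the bidirected neighbours of `j`. -/
noncomputable def biList (j : ℕ) : List ℕ := sel (fun l => decide (G.biN l j)) n

theorem mem_dirList {l j : ℕ} : l ∈ G.dirList j ↔ G.dirN l j := by
  simp only [dirList, sel, List.mem_filter, List.mem_range, decide_eq_true_eq]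
  exact ⟨fun h => h.2, fun h => ⟨h.1, h⟩⟩

theorem mem_biList {l j : ℕ} : l ∈ G.biList j ↔ G.biN l j := by
  simp only [biList, sel, List.mem_filter, List.mem_range, decide_eq_true_eq]
  exact ⟨fun h => h.2, fun h => ⟨h.1, h⟩⟩

theorem length_le_ncard {li : List ℕ} (hnd : li.Nodup) {s : Set (Fin n)}
    (h : ∀ l ∈ li, ∃ i ∈ s, (i : ℕ) = l) : li.length ≤ s.ncard := by
  rw [← List.toFinset_card_of_nodup hnd, ← Set.ncard_coe_finset]
  refine (Set.ncard_le_ncard (t := Fin.val '' s) ?_ (Set.toFinite _)).trans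
    (Set.ncard_image_le (Set.toFinite _))
  intro l hl
  simpa using h l (by simpa using hl)

theorem ncard_parents_le (j : Fin n) : (G.parents j).ncard ≤ G.inDegree :=
  Finset.le_sup (f := fun i => (G.parents i).ncard) (Finset.mem_univ j)

theorem ncard_cComp_le (j : Fin n) : (G.cComp j).ncard ≤ G.maxCComp :=
  Finset.le_sup (f := fun i => (G.cComp i).ncard) (Finset.mem_univ j)

theorem length_dirList_le {j : ℕ} (hj : j < n) : (G.dirList j).length ≤ G.inDegree := by
  refine (length_le_ncard (s := G.parents ⟨j, hj⟩) (List.nodup_range.filter _) ?_).trans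
    (G.ncard_parents_le _)
  intro l hl
  obtain ⟨hl, hj, h⟩ := G.mem_dirList.mp hl
  exact ⟨⟨l, hl⟩, h, rfl⟩

theorem length_biList_le {j : ℕ} (hj : j < n) : (G.biList j).length ≤ G.maxCComp := by
  refine (length_le_ncard (s := G.cComp ⟨j, hj⟩) (List.nodup_range.filter _) ?_).trans
    (G.ncard_cComp_le _)
  intro l hl
  obtain ⟨hl, hj, h⟩ := G.mem_biList.mp hl
  exact ⟨⟨l, hl⟩, h.symm.reachable, rfl⟩

theorem one_le_maxCComp (j : Fin n) : 1 ≤ G.maxCComp := by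
  refine le_trans ?_ (G.ncard_cComp_le j)
  exact Nat.succ_le_of_lt ((Set.ncard_pos (Set.toFinite _)).mpr ⟨j, SimpleGraph.Reachable.refl _⟩)

end ADMG

/-- Directed entries occupy the positions below `n * n` of the matrix part, bidirected ones those
from `n * n` on, so the two cannot be confused. -/
theorem encodeNat_dir {n q : ℕ} (G : ADMG n) (X : Fin n) (x : Fin q) {l j : ℕ} (hl : l < n)
    (hj : j < n) : 0 < encodeNat G X x (l * n + j + 4) ↔ G.dirN l j := by
  have hlt : l * n + j < n * n := by
    have := Nat.mul_le_mul_right n (Nat.succ_le_of_lt hl)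
    rw [Nat.succ_mul] at this; omega
  simp only [encodeNat]
  split_ifs with h
  · simp only [zero_lt_one, true_iff]
    obtain ⟨a, b, ⟨h1, h2⟩ | ⟨h1, h2⟩⟩ := h
    · have e1 : l = a := by
        by_contra hne; exact mul_add_ne hj b.2 hne h2
      subst e1
      have e2 : j = b := by omega
      subst e2
      exact ⟨hl, hj, h1⟩
    · omega
  · simp only [lt_irrefl, false_iff]
    rintro ⟨hl, hj, h1⟩
    exact h ⟨_, _, Or.inl ⟨h1, rfl⟩⟩

theorem encodeNat_bi {n q : ℕ} (G : ADMG n) (X : Fin n) (x : Fin q) {l j : ℕ} (hl : l < n)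
    (hj : j < n) : 0 < encodeNat G X x (n * n + (l * n + j) + 4) ↔ G.biN l j := by
  simp only [encodeNat]
  split_ifs with h
  · simp only [zero_lt_one, true_iff]
    obtain ⟨a, b, ⟨h1, h2⟩ | ⟨h1, h2⟩⟩ := h
    · have := Nat.mul_le_mul_right n (Nat.succ_le_of_lt a.2)
      have := b.2
      rw [Nat.succ_mul] at *; omega
    · have h2 : l * n + j = a * n + b := by omega
      have e1 : l = a := by
        by_contra hne; exact mul_add_ne hj b.2 hne h2
      subst e1
      have e2 : j = b := by omega
      subst e2
      exact ⟨hl, hj, h1⟩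
  · simp only [lt_irrefl, false_iff]
    rintro ⟨hl, hj, h1⟩
    exact h ⟨_, _, Or.inr ⟨h1, rfl⟩⟩

/-! ### Correctness of the graph preprocessing -/

namespace RealRAM

variable {n q : ℕ} {G : ADMG n} {X : Fin n} {x : Fin q} {E : Env} {s : State}

theorem runs_dirLists (hE : E.natIn = encodeNat G X x) (hz : ∀ i, get E s 2 i = 0) :
    Runs E (buildLists (.natLt (.const 0) dirE) (sc 1) 1 2) s (26 + n * (200 + n * 300))
      fun s' => Frame E {0, 1, 2} s s' ∧ ∀ j < n, HasList E s' 1 2 n id (G.dirList j) j := by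
  classical
  have hn : E.natIn 0 = n := by rw [hE]; rfl
  refine (runs_buildLists hn (by decide) (by decide) (by decide)
    (fun j l => decide (G.dirN l j)) (fun _ => id) ?_ fun j _ => hz j).mono ?_ fun s' h => ?_
  · intro s' j l hj hl _ h0 h1
    simp only [BExp.Holds, NExp.eval, dirE, eval_sc, eval_nE, h0, h1, hn, id, decide_eq_true_eq,
      and_true]
    rw [hE, encodeNat_dir G X x hl hj]
  · gcongr
    simp only [BExp.cost, NExp.cost, dirE, cost_sc, cost_nE]; omega
  · refine ⟨h.1, fun j hj => ?_⟩
    convert h.2 j hj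
    unfold ADMG.dirList; congr!

theorem runs_biLists (hE : E.natIn = encodeNat G X x) (hz : ∀ i, get E s 4 i = 0) :
    Runs E (buildLists (.natLt (.const 0) biE) (sc 1) 3 4) s (26 + n * (200 + n * 300))
      fun s' => Frame E {0, 3, 4} s s' ∧ ∀ j < n, HasList E s' 3 4 n id (G.biList j) j := by
  classical
  have hn : E.natIn 0 = n := by rw [hE]; rfl
  refine (runs_buildLists hn (by decide) (by decide) (by decide)
    (fun j l => decide (G.biN l j)) (fun _ => id) ?_ fun j _ => hz j).mono ?_ fun s' h => ?_
  · intro s' j l hj hl _ h0 h1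
    simp only [BExp.Holds, NExp.eval, biE, eval_sc, eval_nE, h0, h1, hn, id, decide_eq_true_eq,
      and_true]
    rw [hE, encodeNat_bi G X x hl hj]
  · gcongr
    simp only [BExp.cost, NExp.cost, biE, cost_sc, cost_nE]; omega
  · refine ⟨h.1, fun j hj => ?_⟩
    convert h.2 j hj
    unfold ADMG.biList; congr!

/-- Relaxation with weight `1` along the directed edges: after `t` rounds the value is at least the
minimum of `t` and the depth, because a variable of positive depth has a parent that is one less
deep. -/
theorem runs_depth (hn : E.natIn 0 = n) (hli : ∀ j < n, HasList E s 1 2 n id (G.dirList j) j)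
    (hz : ∀ i, get E s 5 i = 0) :
    Runs E (relax 1 2 5 1) s (26 + n * (100 + n * (100 + G.inDegree * 300))) fun s' =>
      Frame E {0, 5} s s' ∧ ∀ j < n, get E s' 5 j = G.depth j := by
  refine (runs_relax hn (by decide) (by decide) (by decide) (by decide) (by decide) G.dirList hli
    (fun j hj => G.length_dirList_le hj) (fun j hj i hi => (G.mem_dirList.mp hi).1) G.depth
    (by simp [hz]) ?_ (fun t j x => x ≤ t ∧ x ≤ G.depth j) ?_ ?_).mono le_rfl fun s' h => ?_
  · intro j hj i hi
    obtain ⟨hi, hj, h⟩ := G.mem_dirList.mp hi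
    exact G.depth_lt_of_dir h
  · rintro j hj x ⟨h, -⟩; omega
  · rintro t j hj x ⟨h1, h2⟩
    by_cases hx : x ≤ t
    · exact Or.inl ⟨hx, h2⟩
    · obtain ⟨i, hi, e⟩ := G.exists_of_depth_ne_zero (j := ⟨j, hj⟩) (by simp only; omega)
      simp only at e
      exact Or.inr ⟨i, G.mem_dirList.mpr ⟨i.2, hj, hi⟩, x - 1, ⟨by omega, by omega⟩, by omega⟩
  · refine ⟨h.1, fun j hj => le_antisymm (h.2 j hj).1 ((h.2 j hj).2 _ ⟨?_, le_rfl⟩)⟩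
    exact (G.depth_lt ⟨j, hj⟩).le

/-- Relaxation with weight `0` spreads the largest index through each c-component, starting from
every variable's own index. -/
theorem runs_label (hn : E.natIn 0 = n) (hli : ∀ j < n, HasList E s 3 4 n id (G.biList j) j) :
    Runs E (.seq (forC 0 nE (wr 6 (sc 0) (sc 0))) (relax 3 4 6 0)) s
      (52 + n * (200 + n * (100 + G.maxCComp * 300))) fun s' =>
      Frame E {0, 6} s s' ∧ ∀ j < n, get E s' 6 j = G.label j := by
  refine ((runs_forC_wr hn (r := 6) (by decide) id id ?_ ?_).seq
    (T₂ := 26 + n * (100 + n * (100 + G.maxCComp * 300))) fun s₁ h₁ => ?_).mono ?_ fun s' h => h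
  · intro s' j hj _ h0
    exact ⟨h0, h0⟩
  · exact fun i _ j _ h => h
  · refine (runs_relax hn (by decide) (by decide) (by decide) (by decide) (by decide) G.biList
      (fun j hj => (hli j hj).frame h₁.1 (by decide) (by decide))
      (fun j hj => G.length_biList_le hj) (fun j hj i hi => (G.mem_biList.mp hi).1) G.label ?_ ?_
      -- After `t` rounds every index within `t` bidirected steps has arrived. The largest one is
      -- joined by a path of fewer than `n` edges, so `n` rounds are enough.
      (fun t j x => ∃ (hj : j < n) (hx : x < n) (w : G.bi.Walk ⟨j, hj⟩ ⟨x, hx⟩), w.length ≤ t)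
      ?_ ?_).mono le_rfl fun s' h => ⟨h₁.1.trans h.1 (by simp) (by simp), fun j hj => ?_⟩
    · intro j hj
      rw [show get E s₁ 6 j = j from h₁.2 j hj]
      exact G.le_label (SimpleGraph.Reachable.refl ⟨j, hj⟩)
    · intro j hj i hi
      obtain ⟨hi, hj, h⟩ := G.mem_biList.mp hi
      exact (G.label_eq_iff (i := ⟨i, hi⟩) (j := ⟨j, hj⟩)).mpr h.reachable |>.le
    · rintro j hj x ⟨hj', hx, w, hw⟩
      have := SimpleGraph.Walk.eq_of_length_eq_zero (Nat.le_zero.mp hw)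
      rw [show get E s₁ 6 j = j from h₁.2 j hj]
      exact (Fin.ext_iff.mp this).ge
    · rintro t j hj x ⟨hj', hx, w, hw⟩
      cases w with
      | nil => exact Or.inl ⟨hj', hx, .nil, by simp⟩
      | @cons _ i _ hadj w =>
        simp only [SimpleGraph.Walk.length_cons] at hw
        exact Or.inr ⟨i, G.mem_biList.mpr ⟨i.2, hj, hadj.symm⟩, x, ⟨i.2, hx, w, by omega⟩, by omega⟩
    · refine le_antisymm (h.2 j hj).1 ((h.2 j hj).2 _ ?_)
      obtain ⟨i, hi, e⟩ := G.exists_label ⟨j, hj⟩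
      simp only at e
      classical
      obtain ⟨w, hw⟩ := hi.exists_isPath
      rw [e]
      exact ⟨hj, i.2, w, by simpa using hw.length_lt.le⟩
  · simp only [cost_sc]
    have : 52 + n * (200 + n * (100 + G.maxCComp * 300)) = 26 + n * 100 +
      (26 + n * (100 + n * (100 + G.maxCComp * 300))) := by ring
    rw [this]
    gcongr; omega

/-- The key of the scalar `v`. -/
def keyE (v : ℕ) : NExp := .add (.mul (rd 5 (sc v)) nE) (sc v)

/-- Sorting by counting: the position of a variable is the number of smaller keys, that is, the
length of a list. The contents of these lists, in array `8`, are not used. -/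
theorem runs_pos (hn : E.natIn 0 = n) (hdep : ∀ j < n, get E s 5 j = G.depth j)
    (hz : ∀ i, get E s 11 i = 0) :
    Runs E (.seq (buildLists (.natLt (keyE 1) (keyE 0)) (sc 1) 8 11)
      (forC 0 nE (wr 12 (rd 11 (sc 0)) (sc 0)))) s (52 + n * (400 + n * 400)) fun s' =>
      Frame E {0, 8, 11, 12} s s' ∧ (∀ j < n, get E s' 11 j = G.keyPos j) ∧
        ∀ j < n, get E s' 12 (G.keyPos j) = j := by
  refine ((runs_buildLists hn (by decide) (by decide) (by decide)
    (fun j l => decide (G.key l < G.key j)) (fun _ => id) ?_ fun j _ => hz j).seq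
    (T₂ := 26 + n * 200) fun s₁ h₁ => ?_).mono ?_ fun s' h => h
  · intro s' j l hj hl hf h0 h1
    have hd : ∀ j, get E s' 5 j = get E s 5 j := hf.1 5 (by decide)
    simp only [BExp.Holds, NExp.eval, keyE, eval_sc, eval_nE, eval_rd, h0, h1, hn, hd, hdep j hj,
      hdep l hl, ADMG.key, id]
    exact ⟨⟨fun h => decide_eq_true h, fun h => of_decide_eq_true h⟩, trivial⟩
  · refine (runs_forC_wr hn (r := 12) (by decide) (fun j => G.keyPos j) id ?_ ?_).mono ?_
      fun s' h => ⟨?_, ?_, h.2⟩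
    · intro s' j hj hf h0
      simp only [eval_rd, eval_sc, h0, id, and_true]
      rw [hf.1 11 (by decide)]
      exact (h₁.2 j hj).1
    · intro i hi j hj h
      exact Fin.ext_iff.mp (G.isTopoOrder_keyPos.inj (a₁ := ⟨i, hi⟩) (a₂ := ⟨j, hj⟩) h)
    · gcongr; simp [cost_rd, cost_sc]
    · exact h₁.1.trans h.1 (by decide) (by decide)
    · intro j hj
      rw [h.1.1 11 (by decide)]; exact (h₁.2 j hj).1
  · have : 52 + n * (400 + n * 400) = 26 + n * (200 + n * 400) + (26 + n * 200) := by ring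
    rw [this]
    gcongr
    simp [BExp.cost, NExp.cost, keyE, cost_rd, cost_sc, cost_nE]

/-- The cell from which the value of the effective parent in scalar `1` of the variable in scalar
`0` is read. -/
def entryE : NExp :=
  -- With indicator values this is `l + (n - l) * [l = X] * (1 - [same label as X])`, which computes
  -- `entry` without branching.
  .add (sc 1) (.mul (.sub nE (sc 1)) (.mul (eqE (sc 1) (.natIn (.const 2)))
    (.sub (.const 1) (eqE (rd 6 (sc 0)) (rd 6 (.natIn (.const 2)))))))

theorem runs_parentLists (hE : E.natIn = encodeNat G X x)
    (hlab : ∀ j < n, get E s 6 j = G.label j) (hpos : ∀ j < n, get E s 11 j = G.keyPos j)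
    (hflag : ∀ c < n, ∀ l < n, 0 < get E s 7 (c * n + l) ↔
      ∃ j < n, G.label j = c ∧ (G.dirN l j ∨ l = j)) (hz : ∀ i, get E s 10 i = 0) :
    Runs E (buildLists (.and (.natLt (.const 0) (rd 7 (.add (.mul (rd 6 (sc 0)) nE) (sc 1))))
      (.natLt (rd 11 (sc 1)) (rd 11 (sc 0)))) entryE 9 10) s (26 + n * (200 + n * 500)) fun s' =>
      Frame E {0, 9, 10} s s' ∧ ∀ j < n, HasList E s' 9 10 n (entry G X j)
        (parentList G (fun j => G.keyPos j) j) j := by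
  classical
  have hn : E.natIn 0 = n := by rw [hE]; rfl
  have hX : E.natIn 2 = X := by rw [hE]; rfl
  refine (runs_buildLists hn (by decide) (by decide) (by decide)
    (fun j l => decide (∃ (hj : j < n) (hl : l < n),
      (⟨l, hl⟩ : Fin n) ∈ G.effParents (fun j => G.keyPos j) ⟨j, hj⟩))
    (fun j => entry G X j) ?_ fun j _ => hz j).mono ?_ fun s' h => ?_
  · intro s' j l hj hl hf h0 h1
    have h6 : ∀ j, get E s' 6 j = get E s 6 j := hf.1 6 (by decide)
    have h7 : ∀ j, get E s' 7 j = get E s 7 j := hf.1 7 (by decide)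
    have h11 : ∀ j, get E s' 11 j = get E s 11 j := hf.1 11 (by decide)
    constructor
    · simp only [BExp.Holds, NExp.eval, eval_rd, eval_sc, eval_nE, h0, h1, h6, h7, h11, hn,
        hlab j hj, hpos j hj, hpos l hl, decide_eq_true_eq]
      rw [hflag _ (G.label_lt ⟨j, hj⟩) l hl]
      constructor
      · rintro ⟨⟨i, hi, e, h⟩, hlt⟩
        refine ⟨hj, hl, (G.mem_effParents _ _ _).mpr ⟨(G.mem_paPlus _ _).mpr ?_, hlt⟩⟩
        have hr : (⟨i, hi⟩ : Fin n) ∈ G.cComp ⟨j, hj⟩ :=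
          ((G.label_eq_iff (i := ⟨i, hi⟩) (j := ⟨j, hj⟩)).mp e).symm
        rcases h with ⟨hl', hi', hd⟩ | rfl
        · exact Or.inr ⟨_, hr, hd⟩
        · exact Or.inl hr
      · rintro ⟨_, _, h⟩
        obtain ⟨h, hlt⟩ := (G.mem_effParents _ _ _).mp h
        refine ⟨?_, hlt⟩
        rcases (G.mem_paPlus _ _).mp h with h | ⟨i, hi, hd⟩
        · exact ⟨l, hl, G.label_eq_iff (i := ⟨l, hl⟩) (j := ⟨j, hj⟩) |>.mpr h.symm, Or.inr rfl⟩
        · exact ⟨i, i.2, G.label_eq_iff (i := i) (j := ⟨j, hj⟩) |>.mpr hi.symm,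
            Or.inl ⟨hl, i.2, hd⟩⟩
    · simp only [entryE, NExp.eval, eval_eqE, eval_rd, eval_sc, eval_nE, h0, h1, h6, hn, hX,
        hlab j hj, hlab X X.2, entry]
      have hr : (∃ hj : j < n, G.bi.Reachable X ⟨j, hj⟩) ↔ G.label j = G.label X := by
        rw [show G.label j = G.label ((⟨j, hj⟩ : Fin n) : ℕ) from rfl, G.label_eq_iff]
        exact ⟨fun ⟨_, h⟩ => h.symm, fun h => ⟨hj, h.symm⟩⟩
      by_cases h1 : l = X <;> by_cases h2 : G.label j = G.label X <;> simp only [hr, h1, h2] <;>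
        simp
  · gcongr
    simp only [BExp.cost, NExp.cost, entryE, cost_eqE, cost_rd, cost_sc, cost_nE]; omega
  · refine ⟨h.1, fun j hj => ?_⟩
    convert h.2 j hj
    unfold parentList; congr!

end RealRAM

/-! ### Assembly of the preprocessing and choice of the sample size -/

namespace RealRAM

variable {n q : ℕ} {G : ADMG n} {X : Fin n} {x : Fin q} {E : Env} {s : State}

theorem runs_while {b : BExp} {c : Cmd} (N : ℕ) (Inv : ℕ → State → Prop) (τ : ℕ) (h0 : Inv 0 s)
    (hb : ∀ i s', i ≤ N → Inv i s' → (b.Holds E s' ↔ i < N))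
    (hstep : ∀ i s', i < N → Inv i s' → Runs E c s' τ (Inv (i + 1))) :
    Runs E (.while b c) s (b.cost + N * (τ + b.cost)) (Inv N) := by
  have key : ∀ m i, i + m = N → ∀ s', Inv i s' →
      Runs E (.while b c) s' (b.cost + m * (τ + b.cost)) (Inv N) := by
    intro m
    induction m with
    | zero =>
      rintro i hi s' hinv
      obtain rfl : i = N := by omega
      exact ⟨_, s', .whileFalse (by simp [hb i s' le_rfl hinv]), by simp, hinv⟩
    | succ m ih =>
      intro i hi s' hinv
      obtain ⟨t, s₁, he, ht, hinv₁⟩ := hstep i s' (by omega) hinv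
      obtain ⟨t', s₂, he', ht', hq⟩ := ih (i + 1) (by omega) _ hinv₁
      refine ⟨_, s₂, .whileTrue ((hb i s' (by omega) hinv).mpr (by omega)) he he', ?_, hq⟩
      rw [Nat.succ_mul]; omega
  exact key N 0 (by simp) s h0

theorem loop_time_le {n K D a b c e : ℕ} (hn : 1 ≤ n) (hK : 1 ≤ K) (hD : D ≤ K) :
    c + n * (a + n * (b + D * e)) ≤ (c + a + b + e) * (n * n * K) := by
  have h1 : 1 ≤ n * n * K := Nat.one_le_iff_ne_zero.mpr (by positivity)
  have h2 : n * 1 * 1 ≤ n * n * K := by gcongr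
  have h3 : n * n * 1 ≤ n * n * K := by gcongr
  have h4 : n * n * D ≤ n * n * K := by gcongr
  calc c + n * (a + n * (b + D * e)) = c * 1 + a * (n * 1 * 1) + b * (n * n * 1) +
        e * (n * n * D) := by ring
    _ ≤ c * (n * n * K) + a * (n * n * K) + b * (n * n * K) + e * (n * n * K) := by gcongr
    _ = _ := by ring

/-- The part of the learner that only looks at the graph. -/
def prepProg : Cmd :=
  .seq (buildLists (.natLt (.const 0) dirE) (sc 1) 1 2) <|
  .seq (buildLists (.natLt (.const 0) biE) (sc 1) 3 4) <|
  .seq (relax 1 2 5 1) <|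
  .seq (.seq (forC 0 nE (wr 6 (sc 0) (sc 0))) (relax 3 4 6 0)) <|
  .seq flagProg <|
  .seq (.seq (buildLists (.natLt (keyE 1) (keyE 0)) (sc 1) 8 11)
    (forC 0 nE (wr 12 (rd 11 (sc 0)) (sc 0))))
  (buildLists (.and (.natLt (.const 0) (rd 7 (.add (.mul (rd 6 (sc 0)) nE) (sc 1))))
    (.natLt (rd 11 (sc 1)) (rd 11 (sc 0)))) entryE 9 10)

/-- What is known about the memory when the graph has been processed. -/
structure Prepared (E : Env) (s : State) (G : ADMG n) (X : Fin n) : Prop where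
  drawn : s.drawn = 0
  dirLen : ∀ j < n, get E s 2 j = (G.dirList j).length
  ord : ∀ j < n, get E s 12 (G.keyPos j) = j
  lists : ∀ j < n, HasList E s 9 10 n (entry G X j) (parentList G (fun j => G.keyPos j) j) j
  zero : ∀ r : Fin 16, 13 ≤ r → ∀ i, get E s r i = 0

theorem runs_prepProg (hE : E.natIn = encodeNat G X x) {K : ℕ} (hd : G.inDegree ≤ K)
    (hk : G.maxCComp ≤ K) :
    Runs E prepProg State.init (5000 * (n * n * K)) fun s => Prepared E s G X := by
  have hn : E.natIn 0 = n := by rw [hE]; rfl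
  have h1n : 1 ≤ n := by have := X.2; omega
  have hK : 1 ≤ K := (G.one_le_maxCComp X).trans hk
  have hz : ∀ {R : Finset (Fin 16)} {s : State}, Frame E R State.init s → ∀ r ∉ R, ∀ i,
      get E s r i = 0 := fun hf r hr i => hf.1 r hr i
  have hDr : ∀ l < n, ∀ j < n, 0 < E.natIn (l * n + j + 4) ↔ G.dirN l j := by
    intro l hl j hj; rw [hE]; exact encodeNat_dir G X x hl hj
  have key := Runs.seq (runs_dirLists (G := G) hE (s := State.init) (hz (Frame.refl E ∅ _) 2 (by decide)))
    fun s₁ h₁ => Runs.seq (runs_biLists (G := G) hE (hz h₁.1 4 (by decide)))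
    fun s₂ h₂ => by
      have f₂ : Frame E {0, 1, 2, 3, 4} State.init s₂ := h₁.1.trans h₂.1 (by decide) (by decide)
      have d₂ := fun j hj => (h₁.2 j hj).frame h₂.1 (by decide) (by decide)
      exact Runs.seq (runs_depth hn d₂ (hz f₂ 5 (by decide)))
        fun s₃ h₃ => by
        have f₃ : Frame E {0, 1, 2, 3, 4, 5} State.init s₃ := f₂.trans h₃.1 (by decide) (by decide)
        have b₃ := fun j hj => (h₂.2 j hj).frame h₃.1 (by decide) (by decide)
        exact Runs.seq (runs_label hn b₃)
          fun s₄ h₄ => by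
          have f₄ : Frame E {0, 1, 2, 3, 4, 5, 6} State.init s₄ :=
            f₃.trans h₄.1 (by decide) (by decide)
          exact Runs.seq (runs_flagProg hn G.label h₄.2 G.dirN hDr (hz f₄ 7 (by decide)))
            fun s₅ h₅ => by
            have f₅ : Frame E {0, 1, 2, 3, 4, 5, 6, 7} State.init s₅ :=
              f₄.trans h₅.1 (by decide) (by decide)
            have e₅ : ∀ j < n, get E s₅ 5 j = G.depth j := fun j hj => by
              rw [h₅.1.1 5 (by decide), h₄.1.1 5 (by decide), h₃.2 j hj]
            exact Runs.seq (runs_pos hn e₅ (hz f₅ 11 (by decide)))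
              fun s₆ h₆ => by
              have f₆ : Frame E {0, 1, 2, 3, 4, 5, 6, 7, 8, 11, 12} State.init s₆ :=
                f₅.trans h₆.1 (by decide) (by decide)
              have l₆ : ∀ j < n, get E s₆ 6 j = G.label j := fun j hj => by
                rw [h₆.1.1 6 (by decide), h₅.1.1 6 (by decide), h₄.2 j hj]
              refine (runs_parentLists hE l₆ h₆.2.1 (fun c hc l hl => ?_)
                (hz f₆ 10 (by decide))).mono le_rfl
                fun s₇ h₇ => (?_ : Prepared E s₇ G X)
              · rw [h₆.1.1 7 (by decide)]; exact h₅.2 c hc l hl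
              have f₇ : Frame E {0, 1, 2, 3, 4, 5, 6, 7, 8, 9, 10, 11, 12} State.init s₇ :=
                f₆.trans h₇.1 (by decide) (by decide)
              refine ⟨f₇.2, fun j hj => ?_, fun j hj => ?_, h₇.2, fun r hr i => hz f₇ r ?_ i⟩
              · rw [h₇.1.1 2 (by decide), h₆.1.1 2 (by decide), h₅.1.1 2 (by decide),
                  h₄.1.1 2 (by decide), h₃.1.1 2 (by decide)]
                exact (d₂ j hj).1
              · rw [h₇.1.1 12 (by decide)]; exact h₆.2.2 j hj
              · revert r; decide
  refine key.mono ?_ fun s h => h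
  have t1 := loop_time_le (c := 26) (a := 200) (b := 300) (e := 0) (D := 0) h1n hK (by omega)
  have t2 := loop_time_le (c := 26) (a := 100) (b := 100) (e := 300) h1n hK hd
  have t3 := loop_time_le (c := 52) (a := 200) (b := 100) (e := 300) h1n hK hk
  have t4 := loop_time_le (c := 26) (a := 100) (b := 400) (e := 0) (D := 0) h1n hK (by omega)
  have t5 := loop_time_le (c := 52) (a := 400) (b := 400) (e := 0) (D := 0) h1n hK (by omega)
  have t6 := loop_time_le (c := 26) (a := 200) (b := 500) (e := 0) (D := 0) h1n hK (by omega)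
  simp only [mul_zero, add_zero] at t1 t4 t5 t6
  omega

/-! ### The learner: the number of samples -/

/-- Computes the total number of table entries and the number of edges. -/
def sizeProg : Cmd :=
  forC 0 nE
    (.seq (wr 13 (.const 5) (.natIn (.const 1))) <|
     .seq (forC 1 (rd 10 (sc 0)) (wr 13 (.const 5) (.mul (rd 13 (.const 5)) (.natIn (.const 1))))) <|
     .seq (wr 13 (.const 4) (.add (rd 13 (.const 4)) (rd 13 (.const 5))))
      (wr 13 (.const 6) (.add (rd 13 (.const 6)) (rd 2 (sc 0)))))

/-- The number of table entries governs the union bound and the sample size; the number of directed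
edges decides whether the factor `1/α` is required. -/
theorem runs_sizeProg (hn : E.natIn 0 = n) (hq : E.natIn 1 = q) (len dl : ℕ → ℕ) {K : ℕ}
    (hlen : ∀ j < n, get E s 10 j = len j) (hK : ∀ j < n, len j ≤ K)
    (hdl : ∀ j < n, get E s 2 j = dl j)
    (hz : ∀ i, get E s 13 i = 0) :
    Runs E sizeProg s (26 + n * (300 + K * 100)) fun s' => Frame E {0, 13} s s' ∧
      get E s' 13 4 = ∑ j ∈ Finset.range n, q ^ (len j + 1) ∧
      get E s' 13 6 = ∑ j ∈ Finset.range n, dl j := by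
  refine (runs_forC_const n (fun j s' => Frame E {0, 13} s s' ∧
    get E s' 13 4 = ∑ j ∈ Finset.range j, q ^ (len j + 1) ∧
    get E s' 13 6 = ∑ j ∈ Finset.range j, dl j) (200 + K * 100) ?_
    (by intro _ _ _ _; exact hn) ?_).mono ?_ fun s' h => h.1
  · exact ⟨(Frame.refl _ _ _).put (by simp) _ _, by simp [get_put, hz], by simp [get_put, hz]⟩
  · rintro j s₁ hj ⟨f₁, w₁, e₁⟩ v₁
    have hle : len j ≤ K := hK j hj
    refine ((runs_of_wp (Q := fun s' => s' = put E s₁ 13 5 q) ?_).seq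
      (T₂ := 170 + K * 100) fun s₂ h₂ => ?_).mono (T' := 200 + K * 100) ?_ fun s' h => h
    · simp [wp_wr, NExp.eval, hq]
    · subst h₂
      refine ((runs_forC_const (len j) (fun m s' => ∃ a, s' = put E (put E s₁ 13 5 (q ^ (m + 1))) 0 1 a)
        40 ?_ ?_ ?_).seq (T₂ := 120) fun s₃ h₃ => ?_).mono (T' := 170 + K * 100) ?_ fun s' h => h
      · exact ⟨0, by simp⟩
      · rintro m s' - ⟨a, rfl⟩
        simp [eval_rd, eval_sc, get_put, v₁, f₁.1 10 (by decide), hlen j hj]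
      · rintro m s' hm ⟨a, rfl⟩ v
        refine (runs_of_wp ?_).mono ?_ fun s' h => h
        · simp only [wp_wr, NExp.eval, eval_rd, hq, get_put] at v ⊢
          simp at v
          subst v
          simp only [Fin.reduceEq, false_and, if_false, and_self, if_true]
          refine ⟨trivial, a + 1, ?_⟩
          simp only [put, State.mk.injEq, and_true]
          funext c
          simp only [Function.update_apply]
          split_ifs <;> first | omega | ring
        · simp [bound_wr, NExp.cost, cost_rd]
      · obtain ⟨⟨a, rfl⟩, -⟩ := h₃
        refine (runs_of_wp ?_).mono ?_ fun s' h => h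
        · simp only [wp, wp_wr, NExp.eval, eval_rd, eval_sc, get_put]
          simp only [Finset.sum_range_succ]
          refine ⟨by simp [v₁], ?_, by simp [w₁], ?_⟩
          · refine Frame.put (Frame.put (Frame.put (Frame.put (Frame.put f₁ ?_ _ _) ?_ _ _)
              ?_ _ _) ?_ _ _) ?_ _ _ <;> decide
          · simp [e₁, v₁, f₁.1 2 (by decide), hdl j hj]
        · simp [Cmd.bound, bound_wr, NExp.cost, cost_rd, cost_sc]
      · simp only [cost_rd, cost_sc]
        have := Nat.mul_le_mul_right 100 hle
        omega
    · simp [bound_wr, NExp.cost]; omega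
  · simp only [cost_nE]
    have : n * (200 + K * 100 + 36 + 2) ≤ n * (300 + K * 100) := Nat.mul_le_mul_left _ (by omega)
    omega

/-- Computes the logarithm of the inverse failure probability. -/
def logProg : Cmd :=
  .seq (.seq (wr 13 (.const 7) (.const 0)) (wr 13 (.const 8) (.const 1)))
    (.while (.realLt (.mul (.ofNat (rd 13 (.const 8))) (.realIn (.const 2)))
        (.mul (.ofNat (.const 4)) (.ofNat (rd 13 (.const 4)))))
      (.seq (wr 13 (.const 7) (.add (rd 13 (.const 7)) (.const 1)))
        (wr 13 (.const 8) (.add (rd 13 (.const 8)) (rd 13 (.const 8))))))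

/-- The machine has no logarithm, so `L` is found by doubling: it is the first exponent with `2 ^ L
* δ ≥ 4 * W`. -/
theorem runs_logProg {δ : ℝ} (hδ : E.realIn 2 = δ) {W : ℕ} (hW : get E s 13 4 = W) (L : ℕ)
    (hL : ∀ i ≤ L, (2 : ℝ) ^ i * δ < 4 * W ↔ i < L) :
    Runs E logProg s (200 + L * 200) fun s' => Frame E {13} s s' ∧
      (∀ i < 7, get E s' 13 i = get E s 13 i) ∧ get E s' 13 7 = L := by
  refine ((runs_of_wp (Q := fun s' => s' = put E (put E s 13 7 0) 13 8 1) ?_).seq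
      (T₂ := 100 + L * 200) fun s₁ h₁ => ?_).mono (T' := 200 + L * 200) ?_ fun s' h => h
  · simp [wp, wp_wr, NExp.eval]
  · refine (runs_while L (fun i s' => Frame E {13} s s' ∧ (∀ i < 7, get E s' 13 i = get E s 13 i) ∧
      get E s' 13 7 = i ∧ get E s' 13 8 = 2 ^ i) 100 ?_ ?_ ?_).mono ?_ fun s' h =>
        ⟨h.1, h.2.1, h.2.2.1⟩
    · subst h₁
      refine ⟨((Frame.refl _ _ _).put (by decide) _ _).put (by decide) _ _, fun i hi => ?_, ?_, ?_⟩
      · rw [get_put, if_neg (by omega), get_put, if_neg (by omega)]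
      · simp [get_put]
      · simp [get_put]
    · rintro i s' hi ⟨-, h4, -, h8⟩
      simp only [BExp.Holds, RExp.eval, NExp.eval, eval_rd, h8, h4 4 (by omega), hW, hδ]
      rw [← hL i hi]; push_cast; rfl
    · rintro i s' hi ⟨hf, h4, h7, h8⟩
      refine (runs_of_wp ?_).mono ?_ fun s' h => h
      · simp only [wp, wp_wr, NExp.eval, eval_rd]
        refine ⟨(hf.put (by decide) _ _).put (by decide) _ _, fun i hi => ?_, ?_, ?_⟩
        · rw [get_put, if_neg (by omega), get_put, if_neg (by omega), h4 i hi]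
        · simp [get_put, h7]
        · simp [get_put, h8, pow_succ, mul_two]
      · simp [Cmd.bound, bound_wr, NExp.cost, cost_rd]
    · simp only [BExp.cost, RExp.cost, NExp.cost, cost_rd]; omega
  · simp [Cmd.bound, bound_wr, NExp.cost]; omega

/-- Stores the parameters of the output and the number of samples needed. -/
def paramProg : Cmd :=
  .seq (wr 13 (.const 0) (.natIn (.const 1))) <|
  .seq (wr 13 (.const 1) (.natIn (.const 2))) <|
  .seq (wr 13 (.const 2) (.natIn (.const 3))) <|
  .seq (wr 13 (.const 3) (.mul (.const 3) (rd 13 (.const 7)))) <|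
  .seq (wR 0 (.div (.mul (.mul (.ofNat (.const 312)) (.ofNat (rd 13 (.const 4))))
    (.ofNat (rd 13 (.const 7)))) (.mul (.realIn (.const 1)) (.realIn (.const 1)))))
  (.ite (.natLt (.const 0) (rd 13 (.const 6))) (wR 0 (.div (rc 0) (.realIn (.const 0)))) .skip)

theorem runs_paramProg {W L D : ℕ} (hW : get E s 13 4 = W) (hL : get E s 13 7 = L)
    (hD : get E s 13 6 = D) :
    Runs E paramProg s 400 fun s' => Frame E {13} s s' ∧ get E s' 13 0 = E.natIn 1 ∧
      get E s' 13 1 = E.natIn 2 ∧ get E s' 13 2 = E.natIn 3 ∧ get E s' 13 3 = 3 * L ∧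
      s'.real 0 = 312 * W * L / (E.realIn 1 * E.realIn 1) * (if 0 < D then 1 / E.realIn 0 else 1) := by
  refine (runs_of_wp ?_).mono ?_ fun s' h => h
  · simp only [paramProg, wp, wp_wr, wp_wR, NExp.eval, RExp.eval, eval_rd, BExp.Holds, eval_rc,
      get_put, get_putR]
    have hf : ∀ v c, Frame E {13} s (putR (put E (put E (put E (put E s 13 0 (E.natIn 1))
        13 1 (E.natIn 2)) 13 2 (E.natIn 3)) 13 3 (3 * L)) c v) := fun v c =>
      ⟨((((Frame.refl E {13} s).put (by decide) _ _).put (by decide) _ _).put (by decide) _ _).put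
        (by decide) _ _ |>.1, rfl⟩
    simp [hW, hL, hD, putR_real]
    exact ⟨fun h => ⟨⟨(hf 0 0).1, rfl⟩, by rw [if_pos h, div_eq_mul_inv _ (E.realIn 0)]⟩,
      fun h => ⟨hf _ _, fun h' => by omega⟩⟩
  · simp [paramProg, Cmd.bound, bound_wr, bound_wR, BExp.cost, NExp.cost, RExp.cost, cost_rd, cost_rc]

end RealRAM

namespace RealRAM

/-! ### The learner: counting -/

variable {n q : ℕ} {G : ADMG n} {X : Fin n} {x : Fin q} {E : Env} {s : State}
    {S : ℕ → Fin n → Fin q}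

/-- For every variable `j`, the counters describe the first `lim j` samples. -/
def Counts (E : Env) (s : State) (G : ADMG n) (S : ℕ → Fin n → Fin q) (lim : ℕ → ℕ) : Prop :=
  ∀ j < n, ∀ z, get E s arrZ (j + n * z) = ((Finset.range (lim j)).filter fun t =>
      sampleCode G (fun j => G.keyPos j) S j t = z).card ∧
    ∀ a < q, get E s arrC ((j + n * z) * q + a) = ((Finset.range (lim j)).filter fun t =>
      sampleCode G (fun j => G.keyPos j) S j t = z ∧ samp S t j = a).card

theorem Counts.congr {s' : State} {lim lim' : ℕ → ℕ} (h : Counts E s G S lim)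
    (hZ : ∀ i, get E s' arrZ i = get E s arrZ i) (hC : ∀ i, get E s' arrC i = get E s arrC i)
    (hl : ∀ j < n, lim' j = lim j) : Counts E s' G S lim' := by
  intro j hj z
  rw [hl j hj, hZ]
  exact ⟨(h j hj z).1, fun a ha => (hC _).trans ((h j hj z).2 a ha)⟩

theorem card_filter_range_succ (p : ℕ → Prop) [DecidablePred p] (t : ℕ) :
    ((Finset.range (t + 1)).filter p).card =
      ((Finset.range t).filter p).card + if p t then 1 else 0 := by
  rw [Finset.range_add_one, Finset.filter_insert]
  split_ifs
  · rw [Finset.card_insert_of_notMem (by simp)]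
  · rfl

/-- The addresses `j + n * z` and `(j + n * z) * q + a` determine `j`, `z` and `a`, so exactly one
counter of each kind changes. -/
theorem Counts.step {lim : ℕ → ℕ} {j t : ℕ} (h : Counts E s G S lim) (hj : j < n) (hl : lim j = t) :
    let i := j + n * sampleCode G (fun j => G.keyPos j) S j t
    let i' := i * q + samp S t j
    Counts E (put E (put E s arrZ i (get E s arrZ i + 1)) arrC i' (get E s arrC i' + 1)) G S
      (Function.update lim j (t + 1)) := by
  intro i i' j' hj' z
  have hv : samp S t j < q := by simp [samp, hj]
  have hidx : ∀ z, j' + n * z = i ↔ j' = j ∧ z = sampleCode G (fun j => G.keyPos j) S j t := by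
    intro z
    constructor
    · intro e
      have e' : z * n + j' = sampleCode G (fun j => G.keyPos j) S j t * n + j := by
        simp only [i] at e
        rw [Nat.mul_comm z, Nat.mul_comm (sampleCode _ _ _ _ _)]; omega
      have hz : z = sampleCode G (fun j => G.keyPos j) S j t := by
        by_contra hne
        exact mul_add_ne hj' hj hne e'
      refine ⟨?_, hz⟩
      rw [hz] at e'; omega
    · rintro ⟨rfl, rfl⟩; rfl
  constructor
  · rw [get_put, if_neg (by simp [arrZ, arrC]), get_put]
    by_cases hjj : j' = j
    · subst hjj
      rw [Function.update_self, card_filter_range_succ, ← hl, ← (h j' hj' z).1, hl]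
      by_cases hz : sampleCode G (fun j => G.keyPos j) S j' t = z
      · subst hz; simp [i]
      · rw [if_neg hz, if_neg, Nat.add_zero]
        rintro ⟨-, e⟩
        exact hz ((hidx z).mp e).2.symm
    · rw [Function.update_of_ne hjj, if_neg, (h j' hj' z).1]
      rintro ⟨-, e⟩
      exact hjj ((hidx z).mp e).1
  · intro a ha
    have hidx' : (j' + n * z) * q + a = i' ↔ j' + n * z = i ∧ a = samp S t j := by
      constructor
      · intro e
        have hz : j' + n * z = i := by
          by_contra hne
          exact mul_add_ne ha hv hne e
        refine ⟨hz, ?_⟩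
        rw [hz] at e; simp only [i'] at e; omega
      · rintro ⟨e, rfl⟩; rw [e]
    rw [get_put, get_put, if_neg (c := arrC = arrZ ∧ _) (by simp [arrZ, arrC])]
    by_cases hjj : j' = j
    · subst hjj
      rw [Function.update_self, card_filter_range_succ, ← hl, ← (h j' hj' z).2 a ha, hl]
      by_cases hz : sampleCode G (fun j => G.keyPos j) S j' t = z ∧ samp S t j' = a
      · rw [if_pos hz, if_pos ⟨rfl, hidx'.mpr ⟨(hidx z).mpr ⟨rfl, hz.1.symm⟩, hz.2.symm⟩⟩,
          hidx'.mpr ⟨(hidx z).mpr ⟨rfl, hz.1.symm⟩, hz.2.symm⟩]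
      · rw [if_neg hz, if_neg, Nat.add_zero]
        rintro ⟨-, e⟩
        obtain ⟨e1, e2⟩ := hidx'.mp e
        exact hz ⟨((hidx z).mp e1).2.symm, e2.symm⟩
    · rw [Function.update_of_ne hjj, if_neg, (h j' hj' z).2 a ha]
      rintro ⟨-, e⟩
      exact hjj ((hidx z).mp (hidx'.mp e).1).1

/-- The index of the first counter of the variable in scalar `3`. -/
def idxZ : NExp := .add (sc 3) (.mul nE (sc 5))

/-- The index of the second counter of the variable in scalar `3`. -/
def idxC : NExp := .add (.mul idxZ (.natIn (.const 1))) (.mem (sc 3))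

/-- Updates the counters of the variable in scalar `3`. -/
def countProg : Cmd :=
  .seq (lookup NExp.mem (.natIn (.const 1)))
    (.seq (wr arrZ idxZ (.add (rd arrZ idxZ) (.const 1)))
      (wr arrC idxC (.add (rd arrC idxC) (.const 1))))

/-- What does not change while a sample is processed. -/
structure Static (E : Env) (s₀ s : State) (cells : ℕ → ℕ) (drawn : ℕ) (ρ : ℝ) (t : ℕ) : Prop where
  arr : ∀ r : Fin 16, r ∉ ({0, arrZ, arrC} : Finset (Fin 16)) → ∀ i, get E s r i = get E s₀ r i
  cells : ∀ i ≤ E.natIn 0, s.nat i = cells i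
  drawn : s.drawn = drawn
  real : s.real 0 = ρ
  time : get E s 0 9 = t

theorem Static.put {s₀ : State} {cells : ℕ → ℕ} {drawn : ℕ} {ρ : ℝ} {t : ℕ}
    (h : Static E s₀ s cells drawn ρ t) {r : Fin 16} (hr : r ∈ ({0, arrZ, arrC} : Finset (Fin 16)))
    {i : ℕ} (hi : ¬ (r = 0 ∧ i = 9)) (v : ℕ) : Static E s₀ (put E s r i v) cells drawn ρ t where
  arr r' hr' i' := by
    rw [get_put, if_neg, h.arr r' hr']
    rintro ⟨rfl, _⟩; exact hr' hr
  cells c hc := by rw [put_nat_of_le _ _ _ _ hc, h.cells c hc]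
  drawn := h.drawn
  real := h.real
  time := by
    rw [get_put, if_neg, h.time]
    rintro ⟨h1, h2⟩; exact hi ⟨h1.symm, h2.symm⟩

/-- While learning, cell `n` holds the sampled value of `X`, so the redirection of `X` has no effect
and the code is that of the true sample. -/
theorem runs_countProg (hn : E.natIn 0 = n) (hq : E.natIn 1 = q) {s₀ : State} {K t : ℕ} {ρ : ℝ}
    (hK : ∀ j : Fin n, (G.effParents (fun j => G.keyPos j) j).card ≤ K)
    (hlists : ∀ j < n, HasList E s₀ arrT arrTlen n (entry G X j)
      (parentList G (fun j => G.keyPos j) j) j)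
    {cells : ℕ → ℕ} (hcells : ∀ i < n, cells i = samp S t i) (hX : cells n = samp S t X)
    {d : ℕ} {lim : ℕ → ℕ} {j : ℕ} (hj : j < n) (hst : Static E s₀ s cells d ρ t)
    (hc : Counts E s G S lim) (hl : lim j = t) (h3 : get E s 0 3 = j) :
    Runs E countProg s (400 + K * 300) fun s' => get E s' 0 3 = j ∧ Static E s₀ s' cells d ρ t ∧
      Counts E s' G S (Function.update lim j (t + 1)) := by
  set li := parentList G (fun j => G.keyPos j) j with hli
  have hT : get E s arrTlen j = li.length := by
    rw [hst.arr arrTlen (by decide)]; exact (hlists j hj).1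
  have hT' : ∀ m < li.length, get E s arrT (j * n + m) = entry G X j (li.getD m 0) := by
    intro m hm
    rw [hst.arr arrT (by decide)]; exact (hlists j hj).2 m hm
  have hlt : ∀ m < li.length, li.getD m 0 < n := by
    have := (forall_parentList (G := G) (pos := fun j => G.keyPos j) (j := ⟨j, hj⟩)
      (Q := fun l => l < n)).mpr fun i _ => i.2
    exact this
  have hent : ∀ m < li.length, entry G X j (li.getD m 0) ≤ n ∧
      s.nat (entry G X j (li.getD m 0)) = samp S t (li.getD m 0) := by
    intro m hm
    have := hlt m hm
    unfold entry
    split_ifs with h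
    · exact ⟨le_rfl, by rw [hst.cells n hn.ge, hX, h.1]⟩
    · exact ⟨this.le, by rw [hst.cells _ (hn ▸ this.le), hcells _ this]⟩
  have hlen : li.length ≤ K := by
    have := length_parentList G (fun j => G.keyPos j) ⟨j, hj⟩
    simp only at this
    rw [hli, this]; exact hK _
  refine ((runs_lookup hn (s := s) (q := q) (len := li.length)
    (fun m => entry G X j (li.getD m 0)) (fun a => rfl) ?_ ?_ ?_ fun m hm => (hent m hm).1).seq
    (T₂ := 300) fun s₁ h₁ => ?_).mono ?_ fun s' h => h
  · intro a b
    change get E (put E (put E s 0 5 a) 0 6 b) arrTlen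
      (get E (put E (put E s 0 5 a) 0 6 b) 0 3) = _
    simp only [get_put]
    simp [h3, hT, arrTlen]
  · intro a m hm
    change get E (put E (put E s 0 5 a) 0 6 m) arrT
      (get E (put E (put E s 0 5 a) 0 6 m) 0 3 * E.natIn 0 +
        get E (put E (put E s 0 5 a) 0 6 m) 0 6) = _
    have := hT' m hm
    simp only [get_put]
    simp only [arrT] at this ⊢
    simp [h3, hn, this]
  · intro a b; exact hq
  · rw [digits_congr fun m hm => (hent m hm).2] at h₁
    have hcode : digits q (fun m => samp S t (li.getD m 0)) li.length =
        sampleCode G (fun j => G.keyPos j) S j t := rfl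
    rw [hcode] at h₁
    have hst₁ : Static E s₀ s₁ cells d ρ t := by
      rw [h₁]; exact (hst.put (by decide) (by simp) _).put (by decide) (by simp) _
    have hc₁ : Counts E s₁ G S lim := by
      rw [h₁]
      exact hc.congr (fun i => by simp [get_put, arrZ]) (fun i => by simp [get_put, arrC]) fun _ _ => rfl
    have h3₁ : get E s₁ 0 3 = j := by rw [h₁]; simp [get_put, h3]
    have h5₁ : get E s₁ 0 5 = sampleCode G (fun j => G.keyPos j) S j t := by
      rw [h₁]; simp [get_put]
    have hcell : s₁.nat j = samp S t j := by rw [hst₁.cells j (hn ▸ hj.le), hcells j hj]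
    refine (runs_of_wp ?_).mono ?_ fun s' h => h
    · have p0 : ∀ i v c, get E (put E s₁ arrZ i v) 0 c = get E s₁ 0 c := fun i v c => by
        rw [get_put, if_neg (by simp [arrZ])]
      have pC : ∀ i v c, get E (put E s₁ arrZ i v) arrC c = get E s₁ arrC c := fun i v c => by
        rw [get_put, if_neg (by simp [arrZ, arrC])]
      have pj : ∀ i v, (put E s₁ arrZ i v).nat j = samp S t j := fun i v => by
        rw [put_nat_of_le _ _ _ _ (hn ▸ hj.le), hcell]
      simp only [wp, wp_wr, idxZ, idxC, NExp.eval, eval_rd, eval_sc, eval_nE, p0, pC, h3₁, h5₁, pj,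
        hn, hq]
      refine ⟨?_, (hst₁.put (by decide) (by simp [arrZ]) _).put (by decide) (by simp [arrC]) _,
        hc₁.step hj hl⟩
      rw [get_put, if_neg (by simp [arrC]), p0, h3₁]
    · simp [Cmd.bound, bound_wr, NExp.cost, idxZ, idxC, cost_rd, cost_sc, cost_nE]
  · simp only [NExp.cost]
    have := Nat.mul_le_mul_right 300 hlen
    omega

/-- Draws samples and counts. -/
def sampleProg : Cmd :=
  .seq (wr 0 (.const 9) (.const 0))
    (.while (.realLt (.ofNat (sc 9)) (rc 0))
      (.seq (.seq (.draw (.const 0)) (wz nE (.mem (.natIn (.const 2)))))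
        (.seq (forC 3 nE countProg) (wr 0 (.const 9) (.add (sc 9) (.const 1))))))

/-- The loop compares its counter with the real sample size and therefore stops after exactly the
ceiling of it, although the machine cannot round. -/
theorem runs_sampleProg (hn : E.natIn 0 = n) (hq : E.natIn 1 = q) (hX : E.natIn 2 = X)
    (hw : E.width = n) (hS : E.samples = samp S) {K : ℕ} (h1n : 1 ≤ n) (hK1 : 1 ≤ K)
    (hK : ∀ j : Fin n, (G.effParents (fun j => G.keyPos j) j).card ≤ K)
    (hlists : ∀ j < n, HasList E s arrT arrTlen n (entry G X j)
      (parentList G (fun j => G.keyPos j) j) j)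
    (hd : s.drawn = 0) (hZ : ∀ i, get E s arrZ i = 0) (hC : ∀ i, get E s arrC i = 0) :
    Runs E sampleProg s (100 + ⌈s.real 0⌉₊ * (1000 * (n * K))) fun s' =>
      (∀ r : Fin 16, r ∉ ({0, arrZ, arrC} : Finset (Fin 16)) → ∀ i, get E s' r i = get E s r i) ∧
      s'.drawn = ⌈s.real 0⌉₊ ∧ Counts E s' G S fun _ => ⌈s.real 0⌉₊ := by
  have h1 : 1 ≤ n * K := Nat.one_le_iff_ne_zero.mpr (by positivity)
  refine ((runs_of_wp (Q := fun s' => s' = put E s 0 9 0) ?_).seq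
      (T₂ := 50 + ⌈s.real 0⌉₊ * (1000 * (n * K))) fun s₁ h₁ => ?_).mono ?_ fun s' h => h
  · simp [wp_wr, NExp.eval]
  · refine (runs_while ⌈s.real 0⌉₊ (fun t s' => (∃ cells, Static E s s' cells t (s.real 0) t) ∧
      Counts E s' G S fun _ => t) (900 * (n * K)) ?_ ?_ ?_).mono ?_ ?_
    · subst h₁
      refine ⟨⟨s.nat, ?_, ?_, ?_, ?_, ?_⟩, ?_⟩
      · intro r hr i
        rw [get_put, if_neg]
        rintro ⟨rfl, _⟩; exact absurd hr (by decide)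
      · intro i hi; rw [put_nat_of_le _ _ _ _ hi]
      · rw [put_drawn, hd]
      · rfl
      · simp [get_put]
      · intro j hj z
        simp [get_put, hZ, hC]
    · rintro t s' - ⟨⟨cells, hst⟩, -⟩
      simp only [BExp.Holds, RExp.eval, eval_sc, eval_rc, hst.time, hst.real]
      exact Nat.lt_ceil.symm
    · rintro t s' ht ⟨⟨cells, hst⟩, hc⟩
      let cells' : ℕ → ℕ := fun i => if i = n then samp S t X else samp S t i
      have hgn : ∀ (f : ℕ → ℕ) (r : Fin 16) (i : ℕ), n + 1 + (16 * i + r) ≠ n ∧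
          ¬ n + 1 + (16 * i + (r : ℕ)) < n := by intro f r i; omega
      refine ((runs_of_wp (Q := fun s' => Static E s s' cells' (t + 1) (s.real 0) t ∧
        Counts E s' G S fun _ => t) ?_).seq (T₂ := 800 * (n * K)) fun s₂ h₂ => ?_).mono ?_
        fun s' h => h
      · simp only [wp, wp_wz, NExp.eval, eval_nE, hn, hX, hw, hS, Nat.zero_le, true_and, zero_add,
          Nat.sub_zero, X.2, if_true, hst.drawn]
        have hget : ∀ r i, get E (putZ { s' with
            nat := fun c => if c < n then samp S t c else s'.nat c, drawn := t + 1 } n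
            (samp S t X)) r i = get E s' r i := by
          intro r i
          simp only [get, hn, putZ, Function.update_of_ne (hgn cells r i).1, if_neg (hgn cells r i).2]
        refine ⟨⟨fun r hr i => (hget r i).trans (hst.arr r hr i), fun i hi => ?_, rfl, hst.real,
          (hget _ _).trans hst.time⟩, hc.congr (hget _) (hget _) fun _ _ => rfl⟩
        rw [putZ_nat]
        simp only [cells']
        rw [hn] at hi
        split_ifs with h h'
        · rfl
        · rfl
        · omega
      · obtain ⟨hst₂, hc₂⟩ := h₂
        refine ((runs_forC_const n (fun j s' => Static E s s' cells' (t + 1) (s.real 0) t ∧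
          Counts E s' G S fun i => if i < j then t + 1 else t) (400 + K * 300) ?_
          (by intro _ _ _ _; exact hn) ?_).seq (T₂ := 30) fun s₃ h₃ => ?_).mono ?_ fun s' h => h
        · exact ⟨hst₂.put (by decide) (by simp) _, hc₂.congr (fun i => by simp [get_put, arrZ])
            (fun i => by simp [get_put, arrC]) (by simp)⟩
        · rintro j s₃ hj ⟨hst₃, hc₃⟩ h3
          refine (runs_countProg hn hq hK hlists (fun i hi => ?_) ?_ hj hst₃ hc₃ (by simp) h3).mono
            le_rfl fun s' h => ⟨h.1, h.2.1.put (by decide) (by simp) _,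
              h.2.2.congr (fun i => by simp [get_put, arrZ]) (fun i => by simp [get_put, arrC]) ?_⟩
          · simp [cells', hi.ne]
          · simp [cells']
          · intro i hi
            by_cases hij : i = j
            · subst hij; simp
            · rw [Function.update_of_ne hij]
              split_ifs <;> omega
        · obtain ⟨⟨hst₃, hc₃⟩, -⟩ := h₃
          refine (runs_of_wp ?_).mono ?_ fun s' h => h
          · simp only [wp_wr, NExp.eval, eval_sc, hst₃.time]
            refine ⟨⟨cells', fun r hr i => ?_, fun i hi => ?_, hst₃.drawn, hst₃.real, ?_⟩,
              hc₃.congr (fun i => by simp [get_put, arrZ]) (fun i => by simp [get_put, arrC])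
                fun j hj => by simp [hj]⟩
            · rw [get_put, if_neg, hst₃.arr r hr]
              rintro ⟨rfl, _⟩; exact absurd hr (by decide)
            · rw [put_nat_of_le _ _ _ _ hi, hst₃.cells i hi]
            · simp [get_put]
          · simp [bound_wr, NExp.cost, cost_sc]
        · simp only [cost_nE]
          have : n * 1 ≤ n * K := Nat.mul_le_mul_left _ hK1
          have e : n * (400 + K * 300 + 36 + 2) = 438 * (n * 1) + 300 * (n * K) := by ring
          rw [e]; omega
      · simp only [Cmd.bound, bound_wz, NExp.cost, cost_nE, hw]
        have : n * 1 ≤ n * K := Nat.mul_le_mul_left _ hK1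
        omega
    · simp only [BExp.cost, RExp.cost, cost_sc, cost_rc]
      have : ⌈s.real 0⌉₊ * (900 * (n * K) + (11 + 1 + 2 + 1)) ≤ ⌈s.real 0⌉₊ * (1000 * (n * K)) :=
        Nat.mul_le_mul_left _ (by omega)
      omega
    · rintro s' ⟨⟨cells, hst⟩, hc⟩
      exact ⟨hst.arr, hst.drawn, hc⟩
  · simp only [bound_wr, NExp.cost]; omega

end RealRAM

/-! ### The learner -/

/-- The number of entries of all the tables that are estimated. -/
noncomputable def ADMG.tableSize {n : ℕ} (G : ADMG n) (q : ℕ) : ℕ :=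
  ∑ j : Fin n, q ^ ((G.effParents (fun j => G.keyPos j) j).card + 1)

open Classical in
/-- The factor by which probabilities may grow under the intervention. -/
noncomputable def ADMG.ratioBound {n : ℕ} (G : ADMG n) (α : ℝ) : ℝ :=
  if ∃ i j, G.dir i j then 1 / α else 1

/-- The number of samples that the learner draws. -/
noncomputable def ADMG.sampleSize {n : ℕ} (G : ADMG n) (q L : ℕ) (α ε : ℝ) : ℕ :=
  ⌈312 * G.tableSize q * L / (ε * ε) * G.ratioBound α⌉₊

namespace RealRAM

variable {n q : ℕ} {G : ADMG n} {X : Fin n} {x : Fin q} {α ε δ : ℝ} {S : ℕ → Fin n → Fin q}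
    {r : ℕ → unitInterval}

/-- The learning algorithm. If the alphabet has only one letter, there is nothing to learn. -/
def learnProg : Cmd :=
  .ite (.natLt (.natIn (.const 1)) (.const 2)) .skip <|
  .seq prepProg <| .seq sizeProg <| .seq logProg <| .seq paramProg <| .seq sampleProg <|
    wz (.const 0) nE

theorem sum_length_dirList_pos :
    0 < ∑ j ∈ Finset.range n, (G.dirList j).length ↔ ∃ i j, G.dir i j := by
  rw [Finset.sum_pos_iff]
  constructor
  · rintro ⟨j, -, h⟩
    obtain ⟨l, hl⟩ := List.exists_mem_of_length_pos h
    obtain ⟨h1, h2, h3⟩ := G.mem_dirList.mp hl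
    exact ⟨_, _, h3⟩
  · rintro ⟨i, j, h⟩
    exact ⟨j, by simp, List.length_pos_of_mem (G.mem_dirList.mpr ⟨i.2, j.2, h⟩)⟩

theorem runs_learnProg (hq : 2 ≤ q) {K L : ℕ} (hd : G.inDegree ≤ K) (hk : G.maxCComp ≤ K)
    (hK : ∀ j : Fin n, (G.effParents (fun j => G.keyPos j) j).card ≤ K)
    (hL : ∀ i ≤ L, (2 : ℝ) ^ i * δ < 4 * G.tableSize q ↔ i < L) :
    Runs (learnEnv G X x α ε δ S r) learnProg State.init
      (10000 * (n * n * K) + 200 * L + G.sampleSize q L α ε * (1000 * (n * K))) fun out =>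
      IsOutput out G X x (fun j => G.keyPos j) (3 * L) S (G.sampleSize q L α ε) ∧
        out.drawn = G.sampleSize q L α ε := by
  classical
  set E := learnEnv G X x α ε δ S r with hEdef
  have hE : E.natIn = encodeNat G X x := rfl
  have hn : E.natIn 0 = n := rfl
  have hq' : E.natIn 1 = q := rfl
  have h1n : 1 ≤ n := by have := X.2; omega
  have hK1 : 1 ≤ K := (G.one_le_maxCComp X).trans hk
  have hlenK : ∀ j < n, (parentList G (fun j => G.keyPos j) j).length ≤ K := fun j hj => by
    have := length_parentList G (fun j => G.keyPos j) ⟨j, hj⟩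
    simp only at this
    rw [this]; exact hK _
  have hsize : ∑ j ∈ Finset.range n, q ^ ((parentList G (fun j => G.keyPos j) j).length + 1) =
      G.tableSize q := by
    rw [Finset.sum_range]
    exact Finset.sum_congr rfl fun j _ => by rw [length_parentList]
  have key := Runs.seq (runs_prepProg (G := G) (X := X) hE hd hk) fun s₁ h₁ =>
    Runs.seq (runs_sizeProg hn hq' _ _ (fun j hj => (h₁.lists j hj).1) hlenK h₁.dirLen
      (h₁.zero 13 (by decide))) fun s₂ h₂ =>
    Runs.seq (runs_logProg (E := E) (δ := δ) rfl (h₂.2.1.trans hsize) L hL) fun s₃ h₃ => by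
      have l₃ : ∀ j < n, HasList E s₃ 9 10 n (entry G X j)
          (parentList G (fun j => G.keyPos j) j) j := fun j hj =>
        ((h₁.lists j hj).frame h₂.1 (by decide) (by decide)).frame h₃.1 (by decide) (by decide)
      exact Runs.seq (runs_paramProg ((h₃.2.1 4 (by omega)).trans (h₂.2.1.trans hsize)) h₃.2.2
        ((h₃.2.1 6 (by omega)).trans h₂.2.2)) fun s₄ h₄ => by
        have l₄ : ∀ j < n, HasList E s₄ 9 10 n (entry G X j)
            (parentList G (fun j => G.keyPos j) j) j := fun j hj =>
          (l₃ j hj).frame h₄.1 (by decide) (by decide)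
        have g₄ : ∀ r : Fin 16, r ∉ ({0, 13} : Finset (Fin 16)) → ∀ i,
            get E s₄ r i = get E s₁ r i := fun r hr i => by
          have hr' : r ∉ ({13} : Finset (Fin 16)) := fun h => hr (by simp at h ⊢; exact Or.inr h)
          rw [h₄.1.1 r hr', h₃.1.1 r hr', h₂.1.1 r hr]
        have z₄ : ∀ r : Fin 16, 14 ≤ r → ∀ i, get E s₄ r i = 0 := fun r hr i => by
          rw [g₄ r (by revert r; decide), h₁.zero r (by revert r; decide)]
        have N₄ : ⌈s₄.real 0⌉₊ = G.sampleSize q L α ε := by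
          rw [h₄.2.2.2.2.2, ADMG.sampleSize, ADMG.ratioBound]
          congr 2
          simp only [sum_length_dirList_pos]
          rfl
        have key := runs_sampleProg (E := E) (X := X) (S := S) (s := s₄) hn hq' rfl rfl
          (by funext t i; rfl) h1n hK1 hK
          l₄ (by rw [h₄.1.2, h₃.1.2, h₂.1.2, h₁.drawn]) (z₄ _ (by decide)) (z₄ _ (by decide))
        rw [N₄] at key
        exact Runs.seq key fun s₅ h₅ => by
          have g₅ : ∀ r i, memAt n (putZ s₅ 0 n) r i = get E s₅ r i := fun r i =>
            get_putZ (E := E) s₅ n (Nat.zero_le _) r i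
          refine (runs_of_wp (c := wz (.const 0) nE) (Q := fun out =>
            IsOutput out G X x (fun j => G.keyPos j) (3 * L) S (G.sampleSize q L α ε) ∧
              out.drawn = G.sampleSize q L α ε) ?_).mono (T' := 10) ?_ fun s' h => h
          · rw [wp_wz]
            simp only [NExp.eval, eval_nE, hn]
            refine ⟨⟨by simp [putZ], G.isTopoOrder_keyPos, G.keyPos_lt, ?_, ?_, ?_, ?_, ?_, ?_, ?_, ?_,
              ?_⟩, h₅.2.1⟩
            · rw [g₅, h₅.1 _ (by decide)]; exact h₄.2.1
            · rw [g₅, h₅.1 _ (by decide)]; exact h₄.2.2.1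
            · rw [g₅, h₅.1 _ (by decide)]; exact h₄.2.2.2.1
            · rw [g₅, h₅.1 _ (by decide)]; exact h₄.2.2.2.2.1
            · intro j
              rw [g₅, h₅.1 _ (by decide), g₄ _ (by decide)]; exact h₁.ord j j.2
            · intro j
              rw [g₅, h₅.1 _ (by decide)]; exact (l₄ j j.2).1
            · intro j m hm
              rw [g₅, h₅.1 _ (by decide)]; exact (l₄ j j.2).2 m hm
            · intro j z
              rw [g₅]; exact (h₅.2.2 j j.2 z).1
            · intro j z a
              rw [g₅, (h₅.2.2 j j.2 z).2 a a.2]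
              congr 1
              ext t
              simp [samp_coe, Fin.ext_iff]
          · simp [bound_wz, NExp.cost, cost_nE]
  obtain ⟨t, out, he, ht, hQ⟩ := key
  refine ⟨_, out, .iteFalse ?_ he, ?_, hQ⟩
  · simp only [BExp.Holds, NExp.eval, hq']; omega
  · have t1 : n * 1 * 1 ≤ n * n * K := by gcongr
    have t2 : n * 1 * K ≤ n * n * K := by gcongr
    have e : n * (300 + K * 100) = 300 * (n * 1 * 1) + 100 * (n * 1 * K) := by ring
    rw [e] at ht
    simp only [BExp.cost, NExp.cost]
    omega

end RealRAM

/-! ### Sizes -/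

namespace ADMG

variable {n : ℕ} (G : ADMG n)

theorem ncard_paPlus_cComp_le (j : Fin n) :
    (G.paPlus (G.cComp j)).ncard ≤ G.maxCComp * G.inDegree + G.maxCComp := by
  classical
  have h1 : (⋃ i ∈ G.cComp j, G.parents i).ncard ≤ G.maxCComp * G.inDegree := by
    have hfin := Set.toFinite (G.cComp j)
    have e : (⋃ i ∈ G.cComp j, G.parents i) =
        ((hfin.toFinset.biUnion fun i => (Set.toFinite (G.parents i)).toFinset : Finset (Fin n)) :
          Set (Fin n)) := by
      ext l; simp
    rw [e, Set.ncard_coe_finset]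
    refine (Finset.card_biUnion_le_card_mul _ _ G.inDegree fun i _ => ?_).trans ?_
    · rw [← Set.ncard_eq_toFinset_card]; exact G.ncard_parents_le i
    · rw [← Set.ncard_eq_toFinset_card]; exact Nat.mul_le_mul_right _ (G.ncard_cComp_le j)
  have h2 := Set.ncard_union_le (G.cComp j) (⋃ i ∈ G.cComp j, G.parents i)
  have h3 := G.ncard_cComp_le j
  unfold paPlus
  omega

/-- The variable `j` belongs to its own c-component but is not an effective parent of itself. The
strict inequality makes room for the value of `j`, so a table has at most `q ^ (kd + k)` entries. -/
theorem card_effParents_lt (pos : Fin n → ℕ) (j : Fin n) :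
    (G.effParents pos j).card < G.maxCComp * G.inDegree + G.maxCComp := by
  have hj : j ∉ G.effParents pos j := fun h => absurd ((G.mem_effParents _ _ _).mp h).2 (lt_irrefl _)
  have h := G.ncard_paPlus_cComp_le j
  refine lt_of_lt_of_le ?_ h
  refine Nat.lt_of_succ_le ?_
  rw [Nat.succ_eq_add_one, ← Finset.card_insert_of_notMem hj, ← Set.ncard_coe_finset]
  refine Set.ncard_le_ncard ?_ (Set.toFinite _)
  intro l hl
  rcases Finset.mem_insert.mp (Finset.mem_coe.mp hl) with rfl | hl
  · exact (G.mem_paPlus _ _).mpr (Or.inl (SimpleGraph.Reachable.refl _))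
  · exact ((G.mem_effParents _ _ _).mp hl).1

theorem inDegree_pos {i j : Fin n} (h : G.dir i j) : 1 ≤ G.inDegree :=
  le_trans (Nat.succ_le_of_lt ((Set.ncard_pos (Set.toFinite _)).mpr ⟨i, h⟩)) (G.ncard_parents_le j)

theorem inDegree_eq_zero (h : ¬ ∃ i j, G.dir i j) : G.inDegree = 0 := by
  rw [← Nat.le_zero]
  refine Finset.sup_le fun i _ => ?_
  rw [show G.parents i = ∅ from Set.eq_empty_of_forall_notMem fun l hl => h ⟨l, i, hl⟩]
  simp

theorem tableSize_le {q : ℕ} (hq : 1 ≤ q) :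
    G.tableSize q ≤ n * q ^ (G.maxCComp * G.inDegree + G.maxCComp) := by
  unfold tableSize
  refine (Finset.sum_le_card_nsmul _ _ (q ^ (G.maxCComp * G.inDegree + G.maxCComp))
    fun j _ => Nat.pow_le_pow_right hq (G.card_effParents_lt _ j)).trans ?_
  simp

theorem le_tableSize {q : ℕ} (hq : 1 ≤ q) : n ≤ G.tableSize q := by
  unfold tableSize
  have := Finset.card_nsmul_le_sum Finset.univ
    (fun j : Fin n => q ^ ((G.effParents (fun j => G.keyPos j) j).card + 1)) 1
    fun j _ => Nat.one_le_pow _ _ hq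
  simpa using this

/-- The quantity that governs the number of samples. -/
noncomputable def sampleScale (q : ℕ) (α ε : ℝ) : ℝ :=
  (q : ℝ) ^ (2 * G.maxCComp * G.inDegree) * n / (α ^ G.maxCComp * ε ^ 2)

variable {q : ℕ} {α ε : ℝ}

/-- With a directed edge, `d ≥ 1` gives `kd + k ≤ 2kd`, and `1/α ≤ 1/α^k` pays for the change of
measure. Without edges the table size is at most `n q^k`, and `qα < 1` bounds it by `n/α^k`; nothing
would be left for a further factor `1/α`. -/
theorem tableSize_mul_ratioBound_le (X : Fin n) (hq : 1 ≤ q) (hα : 0 < α) (hqα : q * α < 1)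
    (hε : 0 < ε) :
    G.tableSize q * G.ratioBound α / (ε * ε) ≤ G.sampleScale q α ε := by
  have hq' : (1 : ℝ) ≤ q := by exact_mod_cast hq
  have hα1 : α ≤ 1 := by nlinarith
  have hW : (G.tableSize q : ℝ) ≤ n * (q : ℝ) ^ (G.maxCComp * G.inDegree + G.maxCComp) := by
    exact_mod_cast G.tableSize_le hq
  have hk := G.one_le_maxCComp X
  have hαk : 0 < α ^ G.maxCComp := by positivity
  have key : G.tableSize q * G.ratioBound α ≤
      (q : ℝ) ^ (2 * G.maxCComp * G.inDegree) * n / α ^ G.maxCComp := by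
    unfold ratioBound
    split_ifs with h
    · obtain ⟨i, j, h⟩ := h
      have hd := G.inDegree_pos h
      have hexp : G.maxCComp * G.inDegree + G.maxCComp ≤ 2 * G.maxCComp * G.inDegree := by
        nlinarith
      have h1 := pow_le_pow_right₀ hq' hexp
      have h2 : 1 / α ≤ 1 / α ^ G.maxCComp := by
        refine one_div_le_one_div_of_le hαk ?_
        calc α ^ G.maxCComp ≤ α ^ 1 := pow_le_pow_of_le_one hα.le hα1 hk
          _ = α := pow_one α
      rw [div_eq_mul_one_div _ (α ^ _)]
      refine mul_le_mul (hW.trans ?_) h2 (by positivity) (by positivity)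
      rw [mul_comm]; gcongr
    · have hd := G.inDegree_eq_zero h
      rw [hd] at hW ⊢
      simp only [mul_zero, zero_add, pow_zero, one_mul, mul_one] at hW ⊢
      refine hW.trans ?_
      rw [le_div_iff₀ hαk, mul_assoc, ← mul_pow]
      have : (q * α) ^ G.maxCComp ≤ 1 := pow_le_one₀ (by positivity) hqα.le
      nlinarith [(Nat.cast_nonneg n : (0 : ℝ) ≤ n)]
  unfold sampleScale
  rw [← div_div _ (α ^ _), pow_two]
  exact div_le_div_of_nonneg_right key (by positivity)

theorem one_le_ratioBound (hα : 0 < α) (hα1 : α ≤ 1) : 1 ≤ G.ratioBound α := by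
  unfold ratioBound
  split_ifs
  · rwa [le_div_iff₀ hα, one_mul]
  · exact le_rfl

theorem tableSize_le_sampleScale (X : Fin n) (hq : 1 ≤ q) (hα : 0 < α) (hqα : q * α < 1)
    (hε : 0 < ε) (hε1 : ε < 1) : G.tableSize q ≤ G.sampleScale q α ε := by
  have hq' : (1 : ℝ) ≤ q := by exact_mod_cast hq
  refine le_trans ?_ (G.tableSize_mul_ratioBound_le X hq hα hqα hε)
  have h1 := G.one_le_ratioBound hα (by nlinarith)
  have hW : (0 : ℝ) ≤ G.tableSize q := Nat.cast_nonneg _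
  rw [le_div_iff₀ (by positivity)]
  have : ε * ε ≤ 1 := by nlinarith
  nlinarith

/-- The quantity that governs the running time. -/
noncomputable def timeScale (q : ℕ) (α ε : ℝ) : ℝ :=
  (q : ℝ) ^ (4 * G.maxCComp * G.inDegree) * (n : ℝ) ^ 2 / (α ^ G.maxCComp * ε ^ 2)

theorem timeScale_eq : G.timeScale q α ε =
    G.sampleScale q α ε * n * (q : ℝ) ^ (2 * G.maxCComp * G.inDegree) := by
  unfold timeScale sampleScale
  rw [show 4 * G.maxCComp * G.inDegree = 2 * G.maxCComp * G.inDegree +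
    2 * G.maxCComp * G.inDegree by ring, pow_add]
  ring

end ADMG

/-! ### Logarithmic factors -/

theorem Real.one_le_log_two_add {M : ℝ} (hM : 1 ≤ M) : 1 ≤ Real.log (2 + M) := by
  rw [Real.le_log_iff_exp_le (by linarith)]
  have := Real.exp_one_lt_d9
  linarith

theorem half_le_log_two : (1 / 2 : ℝ) ≤ Real.log 2 := by
  have := Real.log_two_gt_d9
  linarith

/-- The number of doublings that the learner needs. -/
theorem exists_log_bound {W : ℕ} {δ M : ℝ} (hW : 1 ≤ W) (hWM : W ≤ M) (hδ : 0 < δ) (hδ1 : δ < 1) :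
    ∃ L : ℕ, (∀ i ≤ L, (2 : ℝ) ^ i * δ < 4 * W ↔ i < L) ∧ 1 ≤ L ∧
      4 * (W : ℝ) ≤ Real.exp L * δ ∧ (L : ℝ) ≤ 9 * Real.log (2 + M) * (1 + Real.log (1 / δ)) := by
  classical
  have hW' : (1 : ℝ) ≤ W := by exact_mod_cast hW
  have hex : ∃ i : ℕ, 4 * (W : ℝ) ≤ 2 ^ i * δ := by
    obtain ⟨i, hi⟩ := pow_unbounded_of_one_lt (4 * W / δ) (one_lt_two : (1 : ℝ) < 2)
    exact ⟨i, by rw [div_lt_iff₀ hδ] at hi; exact hi.le⟩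
  have hspec := Nat.find_spec hex
  have hmin : ∀ i, i < Nat.find hex → 2 ^ i * δ < 4 * (W : ℝ) := fun i hi =>
    not_le.mp (Nat.find_min hex hi)
  have hL1 : 1 ≤ Nat.find hex := by
    by_contra h
    have h0 : Nat.find hex = 0 := by omega
    rw [h0] at hspec
    simp only [pow_zero, one_mul] at hspec
    linarith
  refine ⟨Nat.find hex, fun i hi => ⟨fun h => ?_, hmin i⟩, hL1, ?_, ?_⟩
  · refine lt_of_le_of_ne hi fun e => ?_
    rw [e] at h; linarith
  · refine hspec.trans ?_
    gcongr
    rw [← Real.rpow_natCast, Real.rpow_def_of_pos two_pos]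
    refine Real.exp_le_exp.mpr ?_
    have := Real.log_two_lt_d9
    have h0 : (0 : ℝ) ≤ (Nat.find hex : ℝ) := Nat.cast_nonneg _
    nlinarith
  · set L := Nat.find hex
    have h1 := hmin (L - 1) (by omega)
    have h2 := Real.log_lt_log (by positivity) h1
    rw [Real.log_mul (by positivity) hδ.ne', Real.log_pow,
      Real.log_mul (by norm_num) (by positivity)] at h2
    have hc : ((L - 1 : ℕ) : ℝ) = L - 1 := by push_cast [Nat.cast_sub hL1]; ring
    rw [hc] at h2
    have h3 : Real.log W ≤ Real.log (2 + M) := Real.log_le_log (by positivity) (by linarith)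
    have h4 : Real.log 4 = 2 * Real.log 2 := by
      rw [show (4 : ℝ) = 2 ^ 2 by norm_num, Real.log_pow]; norm_num
    have h5 := Real.one_le_log_two_add (hW'.trans hWM)
    have h6 : Real.log (1 / δ) = - Real.log δ := by rw [one_div, Real.log_inv]
    have h7 : 0 ≤ Real.log (1 / δ) := Real.log_nonneg (by rw [le_div_iff₀ hδ]; linarith)
    have h8 := half_le_log_two
    have h9 := Real.log_two_lt_d9
    have hL1' : (1 : ℝ) ≤ L := by exact_mod_cast hL1
    have h10 : ((L : ℝ) - 1) * (1 / 2) ≤ (L - 1) * Real.log 2 :=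
      mul_le_mul_of_nonneg_left h8 (by linarith)
    have h11 : 0 ≤ (Real.log (2 + M) - 1) * Real.log (1 / δ) := mul_nonneg (by linarith) h7
    nlinarith

/-- If `d ≥ 1`, then `kd + k ≤ 2kd ≤ q^(2kd)`. If `d = 0`, the power is trivial, but `2α ≤ qα < 1`
gives `2^k ≤ T`, and `k` is logarithmic in `T`. Both cases need at least two letters. -/
theorem ADMG.size_le_timeScale {n : ℕ} (G : ADMG n) {q : ℕ} {α ε : ℝ} (X : Fin n) (hq : 2 ≤ q)
    (hα : 0 < α) (hqα : q * α < 1) (hε : 0 < ε) (hε1 : ε < 1) :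
    (G.maxCComp * G.inDegree + G.maxCComp : ℕ) ≤
      2 * (q : ℝ) ^ (2 * G.maxCComp * G.inDegree) * Real.log (2 + G.timeScale q α ε) := by
  have hq' : (2 : ℝ) ≤ q := by exact_mod_cast hq
  have hα1 : α ≤ 1 := by nlinarith
  have hk := G.one_le_maxCComp X
  have hn : (1 : ℝ) ≤ n := by
    have := X.2
    exact_mod_cast (by omega : 1 ≤ n)
  have hQ : (1 : ℝ) ≤ (q : ℝ) ^ (2 * G.maxCComp * G.inDegree) := one_le_pow₀ (by linarith)
  have hQ4 : (1 : ℝ) ≤ (q : ℝ) ^ (4 * G.maxCComp * G.inDegree) := one_le_pow₀ (by linarith)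
  have hαk : 0 < α ^ G.maxCComp := by positivity
  have hT : (2 : ℝ) ^ G.maxCComp ≤ G.timeScale q α ε := by
    unfold ADMG.timeScale
    rw [le_div_iff₀ (by positivity)]
    have h1 : (2 : ℝ) ^ G.maxCComp * α ^ G.maxCComp ≤ 1 := by
      rw [← mul_pow]
      exact pow_le_one₀ (by positivity) (by nlinarith)
    have h2 : ε ^ 2 ≤ 1 := pow_le_one₀ hε.le hε1.le
    have h3 : (1 : ℝ) ≤ (n : ℝ) ^ 2 := one_le_pow₀ hn
    calc (2 : ℝ) ^ G.maxCComp * (α ^ G.maxCComp * ε ^ 2)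
        = (2 : ℝ) ^ G.maxCComp * α ^ G.maxCComp * ε ^ 2 := by ring
      _ ≤ 1 * 1 := by gcongr
      _ ≤ _ := by gcongr
  have hT1 : 1 ≤ G.timeScale q α ε := (one_le_pow₀ one_le_two).trans hT
  have hlog := Real.one_le_log_two_add hT1
  by_cases hd : G.inDegree = 0
  · simp only [hd, mul_zero, zero_add, pow_zero, mul_one]
    have h1 : Real.log ((2 : ℝ) ^ G.maxCComp) ≤ Real.log (2 + G.timeScale q α ε) :=
      Real.log_le_log (by positivity) (by linarith)
    rw [Real.log_pow] at h1
    have h2 := mul_le_mul_of_nonneg_left half_le_log_two (Nat.cast_nonneg G.maxCComp)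
    linarith
  · have hd' : 1 ≤ G.inDegree := Nat.one_le_iff_ne_zero.mpr hd
    have h1 : G.maxCComp * G.inDegree + G.maxCComp ≤ 2 * G.maxCComp * G.inDegree := by nlinarith
    have h2 : 2 * G.maxCComp * G.inDegree ≤ q ^ (2 * G.maxCComp * G.inDegree) :=
      (Nat.lt_pow_self (by omega)).le
    have h3 : ((G.maxCComp * G.inDegree + G.maxCComp : ℕ) : ℝ) ≤
        (q : ℝ) ^ (2 * G.maxCComp * G.inDegree) := by exact_mod_cast h1.trans h2
    nlinarith

/-! ### Putting everything together -/

theorem Represents.mono {n q : ℕ} {X : Fin n} {eval gen : Cmd} {out : State}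
    {D : PMF ({i : Fin n // i ≠ X} → Fin q)} {T T' : ℝ} (h : Represents eval gen out D T)
    (hT : T ≤ T') : Represents eval gen out D T' := by
  refine ⟨fun w => ?_, fun r => ?_, h.2.2⟩
  · obtain ⟨t, s, he, ht, hD⟩ := h.1 w
    exact ⟨t, s, he, ht.trans hT, hD⟩
  · obtain ⟨t, s, he, ht⟩ := h.2.1 r
    exact ⟨t, s, he, ht.trans hT⟩

theorem PMF.eq_of_subsingleton {Ω : Type*} [Subsingleton Ω] (p r : PMF Ω) : p = r := by
  ext w
  have h : ∀ p : PMF Ω, p w = 1 := fun p => by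
    have := p.tsum_coe
    rwa [tsum_eq_single w fun w' hw => absurd (Subsingleton.elim w' w) hw] at this
  rw [h, h]

theorem tvDist_self {Ω : Type} [Fintype Ω] (p : PMF Ω) : tvDist p p = 0 := by simp [tvDist]

instance : IsProbabilityMeasure coinLaw := by unfold coinLaw; infer_instance

/-- With only one letter, the empty memory represents the only distribution. -/
theorem represents_init {n : ℕ} {X : Fin n} (D : PMF ({i : Fin n // i ≠ X} → Fin 1)) {T : ℝ}
    (hT : 10 ≤ T) : Represents evalProg genProg State.init D T := by
  have hD : ∀ w, D w = 1 := fun w => by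
    rw [PMF.eq_of_subsingleton D (PMF.pure w)]; simp
  refine ⟨fun w => ⟨_, _, .iteTrue ?_ (.setReal _ _ _), ?_, ?_⟩, fun r => ⟨_, _, .iteTrue ?_ (.skip _), ?_⟩,
    fun w => ?_⟩
  · simp [BExp.Holds, nE, NExp.eval, evalEnv, State.init]
  · simp only [BExp.cost, NExp.cost, RExp.cost, nE]; norm_num; linarith
  · simp [hD, NExp.eval, RExp.eval]
  · simp [BExp.Holds, nE, NExp.eval, genEnv, State.init]
  · simp only [BExp.cost, NExp.cost, nE]; norm_num; linarith
  · rw [hD]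
    convert measure_univ (μ := coinLaw)
    refine Set.eq_univ_of_forall fun r => ⟨_, _, .iteTrue ?_ (.skip _), fun i => ?_⟩
    · simp [BExp.Holds, nE, NExp.eval, genEnv, State.init]
    · simp [State.init]

theorem exec_learnProg_of_subsingleton {n : ℕ} (G : ADMG n) (X : Fin n) (x : Fin 1) (α ε δ : ℝ)
    (S : ℕ → Fin n → Fin 1) (r : ℕ → unitInterval) :
    Exec (learnEnv G X x α ε δ S r) learnProg State.init 5 State.init := by
  refine .iteTrue (t := 1) ?_ (.skip _)
  simp [BExp.Holds, NExp.eval, learnEnv, encodeNat]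

/-- Rounding up costs at most one further unit of the scale times `L`, so the constant is `2817 =
313 * 9`. -/
theorem ADMG.sampleSize_le {n : ℕ} (G : ADMG n) (X : Fin n) {q L : ℕ} {α ε ℓ Λ : ℝ} (hq : 1 ≤ q)
    (hα : 0 < α) (hqα : q * α < 1) (hε : 0 < ε) (hL : 1 ≤ L) (hLe : L ≤ 9 * ℓ * Λ)
    (hM : 1 ≤ G.sampleScale q α ε) :
    (G.sampleSize q L α ε : ℝ) ≤ 2817 * G.sampleScale q α ε * ℓ * Λ := by
  have hq' : (1 : ℝ) ≤ q := by exact_mod_cast hq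
  have hL' : (1 : ℝ) ≤ L := by exact_mod_cast hL
  have h0 := G.one_le_ratioBound hα (by nlinarith)
  have hpos : 0 ≤ 312 * G.tableSize q * L / (ε * ε) * G.ratioBound α := by positivity
  have h1 := (Nat.ceil_lt_add_one hpos).le
  have h2 := G.tableSize_mul_ratioBound_le X hq hα hqα hε
  have h3 : 312 * G.tableSize q * L / (ε * ε) * G.ratioBound α =
      312 * (G.tableSize q * G.ratioBound α / (ε * ε)) * L := by ring
  rw [h3] at h1
  have h4 : 312 * (G.tableSize q * G.ratioBound α / (ε * ε)) * L ≤
      312 * G.sampleScale q α ε * L := by gcongr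
  have h5 : 1 ≤ G.sampleScale q α ε * L := by nlinarith
  have h6 : G.sampleScale q α ε * L ≤ G.sampleScale q α ε * (9 * ℓ * Λ) := by gcongr
  unfold ADMG.sampleSize
  rw [h3]
  linarith

/-- Processing the samples dominates, with `nK` steps for each. Here `M n K ≤ 2Tℓ` costs one
logarithm, and the number of samples contributes a second one. Only the first power of `Λ` arises;
the cube is slack. -/
theorem learnTime_le {n K L N Q M T ℓM ℓ Λ : ℝ} (hn : 0 ≤ n) (hK : 0 ≤ K) (hnM : n ≤ M)
    (hM : 1 ≤ M) (hT : T = M * n * Q) (hKe : K ≤ 2 * Q * ℓ) (hT1 : 1 ≤ T) (hℓM : 1 ≤ ℓM)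
    (hℓ : ℓM ≤ ℓ) (hΛ : 1 ≤ Λ) (hL : L ≤ 9 * ℓM * Λ) (hN : N ≤ 2817 * M * ℓM * Λ) :
    10000 * (n * n * K) + 200 * L + N * (1000 * (n * K)) ≤ 10000000 * T * ℓ ^ 2 * Λ ^ 3 := by
  have hℓ1 : 1 ≤ ℓ := hℓM.trans hℓ
  have h1 : M * n * K ≤ 2 * T * ℓ := by
    calc M * n * K ≤ M * n * (2 * Q * ℓ) := by gcongr
      _ = _ := by rw [hT]; ring
  have h2 : n * n * K ≤ M * n * K := by gcongr
  have h3 : N * (n * K) ≤ 2817 * (2 * T * ℓ) * (ℓ * Λ) := by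
    calc N * (n * K) ≤ 2817 * M * ℓM * Λ * (n * K) := by gcongr
      _ ≤ 2817 * M * ℓ * Λ * (n * K) := by gcongr
      _ = 2817 * (M * n * K) * (ℓ * Λ) := by ring
      _ ≤ _ := by gcongr
  have hΛ3 : Λ ≤ Λ ^ 3 := le_self_pow₀ hΛ (by norm_num)
  have h4 : T * ℓ ^ 2 * Λ ≤ T * ℓ ^ 2 * Λ ^ 3 := by gcongr
  have h5 : T * ℓ * 1 * 1 ≤ T * ℓ * ℓ * Λ := by gcongr
  have h6 : ℓM * Λ ≤ T * ℓ ^ 2 * Λ := by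
    calc ℓM * Λ ≤ 1 * ℓ ^ 2 * Λ := by
          have : ℓ ≤ ℓ ^ 2 := le_self_pow₀ hℓ1 (by norm_num)
          rw [one_mul]; gcongr; linarith
      _ ≤ _ := by gcongr
  have e : 2817 * (2 * T * ℓ) * (ℓ * Λ) = 5634 * (T * ℓ ^ 2 * Λ) := by ring
  have e2 : T * ℓ * ℓ * Λ = T * ℓ ^ 2 * Λ := by ring
  rw [e] at h3
  rw [e2] at h5
  nlinarith

theorem tvDist_estDist_sampleSize_le {n q L : ℕ} {G : ADMG n} (P : CausalBayesNet.{u} G q) {X : Fin n}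
    (hid : G.Identifiable X) (x : Fin q) {α ε A : ℝ} (hα : 0 < α) (hqα : q * α < 1) (hε : 0 < ε)
    (hP : P.StronglyPositive X α) (hL : 1 ≤ L) (hA : 0 < A) (hAL : A = 3 * L)
    (hN : 0 < G.sampleSize q L α ε) (S : ℕ → Fin n → Fin q)
    (hgood : ∀ j v, GoodCount S (G.sampleSize q L α ε) P.obs L
        (G.effParents (fun j => G.keyPos j) j) v ∧
      GoodCount S (G.sampleSize q L α ε) P.obs L
        (insert j (G.effParents (fun j => G.keyPos j) j)) v) :
    tvDist (P.doDist X x) (estDist S (G.sampleSize q L α ε) G.isTopoOrder_keyPos hA X x) ≤ ε := by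
  subst hAL
  have hq : (1 : ℝ) ≤ q := by
    have := x.2
    exact_mod_cast (by omega : 1 ≤ q)
  have hρ := G.one_le_ratioBound hα (by nlinarith)
  refine tvDist_estDist_le (ρ := G.ratioBound α) S _ P G.isTopoOrder_keyPos hid x
    (by exact_mod_cast hL) hA (by linarith) hε hN ?_ ?_ hgood
  · intro j g hg hgT
    unfold ADMG.ratioBound
    split_ifs with h
    · exact CausalBayesNet.sum_intervene_le_of_stronglyPositive P G.isTopoOrder_keyPos hid x hα hP j g hg hgT
    · rw [one_mul]
      exact CausalBayesNet.sum_intervene_le_of_no_edges P G.isTopoOrder_keyPos x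
        (fun i j hij => h ⟨i, j, hij⟩) j g hgT
  · have h : 312 * (G.tableSize q : ℝ) * L / (ε * ε) * G.ratioBound α ≤ G.sampleSize q L α ε :=
      Nat.le_ceil _
    rw [div_mul_eq_mul_div, div_le_iff₀ (by positivity)] at h
    have e : (G.tableSize q : ℝ) =
        ∑ j, (q : ℝ) ^ ((G.effParents (fun j => G.keyPos j) j).card + 1) := by
      simp [ADMG.tableSize]
    rw [← e, pow_two]
    exact h

theorem mainTheorem1 :
    ∃ (learn eval gen : RealRAM.Cmd) (C : ℝ) (c : ℕ),
      ∀ (n q : ℕ) (G : ADMG n) (X : Fin n) (x : Fin q) (α ε δ : ℝ) (P : CausalBayesNet.{u} G q)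
        (k d : ℕ) (M T : ℝ),
        k = G.maxCComp → d = G.inDegree →
        M = (q : ℝ) ^ (2 * k * d) * n / (α ^ k * ε ^ 2) →
        T = (q : ℝ) ^ (4 * k * d) * (n : ℝ) ^ 2 / (α ^ k * ε ^ 2) →
        0 < α → 0 < ε → ε < 1 → 0 < δ → δ < 1 →
        G.Identifiable X → P.StronglyPositive X α →
        -- for all samples and random numbers, the bounds hold and a distribution is represented
        (∀ (S : ℕ → Fin n → Fin q) (r : ℕ → unitInterval), ∃ t out,
          RealRAM.Exec (learnEnv G X x α ε δ S r) learn RealRAM.State.init t out ∧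
          (out.drawn : ℝ) ≤ C * M * Real.log (2 + M) ^ c * (1 + Real.log (1 / δ)) ∧
          (t : ℝ) ≤ C * T * Real.log (2 + T) ^ c * (1 + Real.log (1 / δ)) ^ 3 ∧
          ∃ D : PMF ({i : Fin n // i ≠ X} → Fin q),
            Represents eval gen out D (C * (n * q * (k * d + k)))) ∧
        -- except with probability `δ`, that distribution is `ε`-close to the interventional one
        ((sampleLaw P.obs).prod coinLaw) {ω | ¬ ∃ t out,
          RealRAM.Exec (learnEnv G X x α ε δ ω.1 ω.2) learn RealRAM.State.init t out ∧
          ∃ D : PMF ({i : Fin n // i ≠ X} → Fin q),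
            Represents eval gen out D (C * (n * q * (k * d + k))) ∧
            tvDist (P.doDist X x) D ≤ ε} ≤ ENNReal.ofReal δ := by
  -- The exponent `2` comes from the two logarithms in the running time, one from `L` and one from
  -- the bound on `kd + k`. The constant is that of `learnTime_le`, which exceeds all the others.
  refine ⟨learnProg, evalProg, genProg, 10000000, 2, ?_⟩
  rintro n q G X x α ε δ P k d M T rfl rfl hM hT hα hε hε1 hδ hδ1 hid hP
  change M = G.sampleScale q α ε at hM
  change T = G.timeScale q α ε at hT
  have hqα := CausalBayesNet.StronglyPositive.mul_lt_one hα hP x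
  have hn1 : 1 ≤ n := by have := X.2; omega
  have hq1 : 1 ≤ q := by have := x.2; omega
  have hn : (1 : ℝ) ≤ n := by exact_mod_cast hn1
  have hq : (1 : ℝ) ≤ q := by exact_mod_cast hq1
  have hk := G.one_le_maxCComp X
  have hK1 : (1 : ℝ) ≤ G.maxCComp * G.inDegree + G.maxCComp := by
    have : (1 : ℝ) ≤ G.maxCComp := by exact_mod_cast hk
    nlinarith [(Nat.cast_nonneg G.inDegree : (0 : ℝ) ≤ G.inDegree)]
  have hWM := G.tableSize_le_sampleScale X hq1 hα hqα hε hε1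
  have hnW := G.le_tableSize hq1
  have hnM : (n : ℝ) ≤ M := by
    rw [hM]; exact le_trans (by exact_mod_cast hnW) hWM
  have hM1 : 1 ≤ M := hn.trans hnM
  have hTM : T = M * n * (q : ℝ) ^ (2 * G.maxCComp * G.inDegree) := by
    rw [hT, hM, G.timeScale_eq]
  have hMT : M ≤ T := by
    rw [hTM]
    have : (1 : ℝ) ≤ n * (q : ℝ) ^ (2 * G.maxCComp * G.inDegree) :=
      one_le_mul_of_one_le_of_one_le hn (one_le_pow₀ hq)
    nlinarith
  have hT1 : 1 ≤ T := hM1.trans hMT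
  have hℓM := Real.one_le_log_two_add hM1
  have hℓT := Real.one_le_log_two_add hT1
  have hℓ : Real.log (2 + M) ≤ Real.log (2 + T) := Real.log_le_log (by linarith) (by linarith)
  have hΛ : 1 ≤ 1 + Real.log (1 / δ) := by
    have : 0 ≤ Real.log (1 / δ) := Real.log_nonneg (by rw [le_div_iff₀ hδ]; linarith)
    linarith
  -- A single letter is treated apart, since the bound of `kd + k` through `T` needs two. The
  -- interventional distribution is then represented exactly.
  rcases Nat.lt_or_ge q 2 with hq2 | hq2
  · obtain rfl : q = 1 := by omega
    have hrep : Represents evalProg genProg State.init (P.doDist X x)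
        (10000000 * (n * (1 : ℕ) * (G.maxCComp * G.inDegree + G.maxCComp))) := by
      refine represents_init _ ?_
      have : (1 : ℝ) ≤ n * (1 : ℕ) * (G.maxCComp * G.inDegree + G.maxCComp) := by
        simpa using one_le_mul_of_one_le_of_one_le hn hK1
      linarith
    constructor
    · intro S r
      refine ⟨_, _, exec_learnProg_of_subsingleton G X x α ε δ S r, ?_, ?_, _, hrep⟩
      · simp only [State.init, Nat.cast_zero]; positivity
      · have h1 := one_le_mul_of_one_le_of_one_le (one_le_mul_of_one_le_of_one_le hT1
          (one_le_pow₀ hℓT (n := 2))) (one_le_pow₀ hΛ (n := 3))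
        push_cast
        linarith
    · convert zero_le (a := ENNReal.ofReal δ)
      convert measure_empty (μ := (sampleLaw P.obs).prod coinLaw)
      refine Set.eq_empty_of_forall_notMem fun ω hω => hω ?_
      exact ⟨_, _, exec_learnProg_of_subsingleton G X x α ε δ ω.1 ω.2, _, hrep,
        by rw [tvDist_self]; exact hε.le⟩
  · obtain ⟨L, hLiff, hL1, hLexp, hLle⟩ := exists_log_bound (hn1.trans hnW) (hM ▸ hWM) hδ hδ1
    set K := G.maxCComp * G.inDegree + G.maxCComp with hK
    have hd : G.inDegree ≤ K := by nlinarith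
    have hkK : G.maxCComp ≤ K := by omega
    have hcard := fun j => G.card_effParents_lt (fun j => G.keyPos j) j
    have hA : (0 : ℝ) < ((3 * L : ℕ) : ℝ) := by exact_mod_cast (by omega : 0 < 3 * L)
    have hN : 0 < G.sampleSize q L α ε := by
      have h1 := G.one_le_ratioBound hα (by nlinarith)
      have h2 : (1 : ℝ) ≤ G.tableSize q := by exact_mod_cast hn1.trans hnW
      have h3 : (1 : ℝ) ≤ L := by exact_mod_cast hL1
      exact Nat.ceil_pos.mpr (by positivity)
    have hrep : ∀ out S, IsOutput out G X x (fun j => G.keyPos j) (3 * L) S (G.sampleSize q L α ε) →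
        Represents evalProg genProg out
          (estDist S (G.sampleSize q L α ε) G.isTopoOrder_keyPos hA X x)
          (10000000 * (n * q * (G.maxCComp * G.inDegree + G.maxCComp))) := by
      intro out S H
      refine (H.represents hA hcard).mono ?_
      push_cast
      gcongr
      norm_num
    have hrun := fun S r => runs_learnProg (X := X) (x := x) (α := α) (ε := ε) (S := S) (r := r)
      hq2 hd hkK (fun j => (hcard j).le) hLiff
    constructor
    · intro S r
      obtain ⟨t, out, he, ht, hout, hdr⟩ := hrun S r
      have hNle := G.sampleSize_le X hq1 hα hqα hε hL1 hLle (hM ▸ hM1)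
      rw [← hM] at hNle
      refine ⟨t, out, he, ?_, ?_, _, hrep out S hout⟩
      · rw [hdr]
        refine hNle.trans ?_
        have : Real.log (2 + M) ≤ Real.log (2 + M) ^ 2 := le_self_pow₀ hℓM (by norm_num)
        gcongr
        norm_num
      · have hKe := G.size_le_timeScale X hq2 hα hqα hε hε1
        rw [← hT] at hKe
        refine le_trans ?_ (learnTime_le (by linarith) (Nat.cast_nonneg K) hnM hM1 hTM hKe hT1 hℓM
          hℓ hΛ hLle hNle)
        exact_mod_cast ht
    · let Bad : Set (ℕ → Fin n → Fin q) := {S | ¬ ∀ j v,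
        GoodCount S (G.sampleSize q L α ε) P.obs L (G.effParents (fun j => G.keyPos j) j) v ∧
        GoodCount S (G.sampleSize q L α ε) P.obs L
          (insert j (G.effParents (fun j => G.keyPos j) j)) v}
      have hbad : sampleLaw P.obs Bad ≤ ENNReal.ofReal δ := by
        refine sampleLaw_union_bound _ P.obs (fun _ => x) (by exact_mod_cast hL1) ?_
        convert hLexp using 2
        simp [ADMG.tableSize]
      -- Failure forces a count to deviate, whatever the random numbers are. Monotonicity holds for
      -- arbitrary sets, so the failure event need not be shown measurable.
      refine (measure_mono (t := Bad ×ˢ Set.univ) ?_).trans ?_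
      · rintro ⟨S, r⟩ hω
        refine ⟨fun hgood => hω ?_, trivial⟩
        obtain ⟨t, out, he, -, hout, -⟩ := hrun S r
        exact ⟨t, out, he, _, hrep out S hout, tvDist_estDist_sampleSize_le P hid x hα hqα hε hP hL1
          hA (by push_cast; rfl) hN S hgood⟩
      · rw [Measure.prod_prod, measure_univ, mul_one]
        exact hbad
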